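/- Work over $\mathbb C$. Let $\varepsilon$ be a primitive cube root of $1$ and let $\mathfrak d(\varepsilon)=D(2,1;\varepsilon)$ be the deform of the Lie superalgebra $\mathfrak{osp}(4|2)=D(2,1;1)$ with parameter $\varepsilon$: its even part is $\mathfrak{sl}(2)^{\oplus 3}$, its odd part is $\mathbb C^2\otimes\mathbb C^2\otimes\mathbb C^2$, and the components of the bracket of two odd elements in the three summands $\mathfrak{sl}(2)$ are $1,\ \varepsilon,\ -1-\varepsilon=\varepsilon^2$ times the standard equivariant maps. Then $\mathfrak d(\varepsilon)=\mathfrak g(A)$ for the Cartan matrix $$A=\begin{pmatrix}0&1&\varepsilon^2\\-1&0&-\varepsilon\\ \varepsilon^2&\varepsilon&0\end{pmatrix}$$ with odd Chevalley generators $X_1^\pm,X_2^\pm,X_3^\pm$, namely (with $v_0,v_1$ the standard basis of $\mathbb C^2$) $X_1^+=v_1\otimes v_0\otimes v_0$, $X_2^+=v_0\otimes v_1\otimes v_0$, $X_3^+=v_0\otimes v_0\otimes v_1$, $X_1^-=\frac{\varepsilon}{2}\,v_0\otimes v_1\otimes v_1$, $X_2^-=-\frac{\varepsilon}{2}\,v_1\otimes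 v_0\otimes v_1$, $X_3^-=\frac{\varepsilon}{2}\,v_1\otimes v_1\otimes v_0$: these generate $\mathfrak d(\varepsilon)$; with $H_i=[X_i^+,X_i^-]$ one has $[X_i^+,X_j^-]=0$ for $i\ne j$, $[H_i,H_j]=0$, $[H_i,X_j^\pm]=\pm A_{ij}X_j^\pm$; the $H_i$ are linearly independent, and every graded ideal that meets $\mathrm{span}(H_1,H_2,H_3)$ in $0$ is $0$. Set $$Y_1^+=\varepsilon X_1^++\varepsilon^2X_2^++X_3^+,\qquad Y_2^+=[X_3^-,[X_1^-,X_2^-]],$$ $$Y_1^-=\varepsilon X_1^-+\varepsilon^2X_2^-+X_3^-,\qquad Y_2^-=[X_1^+,X_2^+]-[X_1^+,X_3^+]+[X_2^+,X_3^+].$$ There are outer automorphisms $\sigma_+$, $\sigma_-$ of order $3$ of $\mathfrak d(\varepsilon)$ with $\sigma_+X_i^+=\varepsilon X_{i+1}^+$ and $\sigma_-X_i^-=\varepsilon X_{i+1}^-$ (indices mod $3$), and they are conjugate: $\sigma_-\tau=\tau\sigma_+$ for the automorphism $\tau$ that multiplies $X_2^\pm$ by $-1$ and fixes $X_1^\pm,X_3^\pm$.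 (Outer: not a product of automorphisms $\exp(\operatorname{ad}x)$ with $x$ even and ad-nilpotent.) The twisted loop superalgebra $\mathfrak d(\varepsilon)^{(3)}$ formed with $\sigma_\pm$ consists of the finite sums $\sum_{k\in\mathbb Z}x_kt^k$, $x_k\in\mathfrak d(\varepsilon)$, $\sigma_\pm x_k=\varepsilon^kx_k$. Let $\mathfrak N_+$ (formed with $\sigma_+$) be its subalgebra of the sums over $k\ge0$ with $x_0$ in the subalgebra of $\mathfrak d(\varepsilon)$ generated by the $X_i^+$, and $\mathfrak N_-$ (formed with $\sigma_-$) that of the sums over $k\le0$ with $x_0$ in the subalgebra generated by the $X_i^-$. **Positive part.** Consider, for odd $Y_1,Y_2$, the relations 1. $[Y_2,Y_2]=0$, 2. $[[Y_1,Y_2],[Y_2,[Y_1,Y_1]]]=0$, 3. $(\operatorname{ad}[Y_1,Y_1])^3[Y_1,Y_2]=0$, 4. $[[Y_1,Y_1],[[Y_2,[Y_1,Y_1]],[[Y_2,[Y_1,Y_1]],[[Y_1,Y_1],[Y_2,[Y_1,Y_1]]]]]]=64\,Y_1$, 5. $[[Y_1,Y_2],[[Y_2,[Y_1,Y_1]],[[Y_2,[Y_1,Y_1]],[[Y_1,Y_1],[Y_2,[Y_1,Y_1]]]]]]=-96\,Y_2$.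 Then $Y_1^+t^0$ and $Y_2^+t$ lie in $\mathfrak N_+$, and $\mathfrak N_+$ is the Lie superalgebra presented by these two odd generators and the relations 1–3. In $\mathfrak N_+$ the left-hand sides of 4 and 5 are $64\,t^3\cdot Y_1^+$ and $-96\,t^3\cdot(Y_2^+t)$. At $t=1$: the elements $Y_1=Y_1^+$, $Y_2=Y_2^+$ satisfy all the relations 1–5, and $\mathfrak d(\varepsilon)$ is the Lie superalgebra presented by these two odd generators and the five relations 1–5. **Negative part.** Consider, for odd $Y_1$ and even $Y_2$, the relations 1. $(\operatorname{ad}Y_2)^3Y_1=0$, 2. $[[Y_1,Y_2],[Y_1,Y_2]]-2[Y_2,[Y_2,[Y_1,Y_1]]]=0$, 3. $(\operatorname{ad}[Y_1,Y_1])^2[Y_1,Y_2]=0$, 4. $[[Y_1,Y_1],[[Y_2,[Y_1,Y_1]],[[Y_1,Y_2],[Y_2,[Y_1,Y_1]]]]]=-64\,Y_1$, 5. $[[Y_1,Y_2],[[Y_2,[Y_1,Y_1]],[[Y_1,Y_2],[Y_2,[Y_1,Y_1]]]]]=-64\,Y_2$. Then $Y_1^-t^0$ and $Y_2^-t^{-1}$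 lie in $\mathfrak N_-$, and $\mathfrak N_-$ is the Lie superalgebra presented by these generators (odd and even, respectively) and the relations 1–3. In $\mathfrak N_-$ the left-hand sides of 4 and 5 are $-64\,t^{-3}\cdot Y_1^-$ and $-64\,t^{-3}\cdot(Y_2^-t^{-1})$. At $t=1$: the elements $Y_1=Y_1^-$, $Y_2=Y_2^-$ satisfy all the relations 1–5, and $\mathfrak d(\varepsilon)$ is the Lie superalgebra presented by these two generators and the five relations 1–5. -/

import Mathlib

/-! ### Lie superalgebras over `ℂ` -/

/-- The sign `(-1)^{ij}` for parities `i`, `j`. -/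
noncomputable def superSign (i j : ZMod 2) : ℂ := if i = 1 ∧ j = 1 then -1 else 1

/-- A Lie superalgebra over `ℂ`, with bracket `br`, even part `part 0` and odd part `part 1`. -/
class LieSuperalgebra (L : Type*) [AddCommGroup L] [Module ℂ L] where
  br : L →ₗ[ℂ] L →ₗ[ℂ] L
  part : ZMod 2 → Submodule ℂ L
  isCompl : IsCompl (part 0) (part 1)
  br_mem : ∀ {i j : ZMod 2} {x y : L}, x ∈ part i → y ∈ part j → br x y ∈ part (i + j)
  br_skew : ∀ {i j : ZMod 2} {x y : L}, x ∈ part i → y ∈ part j →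
    br x y = -(superSign i j • br y x)
  br_jacobi : ∀ {i j : ZMod 2} {x y : L} (z : L), x ∈ part i → y ∈ part j →
    br x (br y z) = br (br x y) z + superSign i j • br y (br x z)

namespace LieSuperalgebra

/-- Homomorphisms of Lie superalgebras: even linear maps that preserve the bracket. -/
structure Hom (L M : Type*) [AddCommGroup L] [Module ℂ L] [LieSuperalgebra L]
    [AddCommGroup M] [Module ℂ M] [LieSuperalgebra M] extends L →ₗ[ℂ] M where
  map_br : ∀ x y, toFun (br x y) = br (toFun x) (toFun y)
  map_part : ∀ i, ∀ x ∈ part (L := L) i, toFun x ∈ part (L := M) i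

instance {L M : Type*} [AddCommGroup L] [Module ℂ L] [LieSuperalgebra L]
    [AddCommGroup M] [Module ℂ M] [LieSuperalgebra M] : CoeFun (Hom L M) (fun _ => L → M) :=
  ⟨fun f => f.toLinearMap⟩

/-- A subspace is graded if it contains the homogeneous components of its elements. -/
def IsGraded {L : Type*} [AddCommGroup L] [Module ℂ L] [LieSuperalgebra L]
    (S : Submodule ℂ L) : Prop :=
  ∀ a ∈ part (L := L) 0, ∀ b ∈ part (L := L) 1, a + b ∈ S → a ∈ S

/-- Graded subalgebras of a Lie superalgebra. -/
structure Subalg (L : Type*) [AddCommGroup L] [Module ℂ L] [LieSuperalgebra L]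
    extends Submodule ℂ L where
  br_mem' : ∀ x ∈ toSubmodule, ∀ y ∈ toSubmodule, br x y ∈ toSubmodule
  graded' : IsGraded toSubmodule

section Subalg

variable {L : Type*} [AddCommGroup L] [Module ℂ L] [LieSuperalgebra L]

/-- A graded subalgebra is a Lie superalgebra. -/
noncomputable instance (S : Subalg L) : LieSuperalgebra S.toSubmodule where
  br := LinearMap.mk₂ ℂ (fun x y => ⟨br x.1 y.1, S.br_mem' x.1 x.2 y.1 y.2⟩)
    (fun x x' y => Subtype.ext (by simp)) (fun c x y => Subtype.ext (by simp))
    (fun x y y' => Subtype.ext (by simp)) (fun c x y => Subtype.ext (by simp))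
  part i := (part (L := L) i).comap S.toSubmodule.subtype
  isCompl := by
    constructor
    · rw [Submodule.disjoint_def]
      intro x h0 h1
      exact Subtype.ext ((Submodule.disjoint_def.1 (isCompl (L := L)).disjoint) x.1 h0 h1)
    · rw [codisjoint_iff, eq_top_iff]
      rintro ⟨x, hx⟩ -
      have h : x ∈ part (L := L) 0 ⊔ part (L := L) 1 := by
        rw [(isCompl (L := L)).sup_eq_top]; trivial
      obtain ⟨a, ha, b, hb, rfl⟩ := Submodule.mem_sup.1 h
      have haS : a ∈ S.toSubmodule := S.graded' a ha b hb hx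
      have hbS : b ∈ S.toSubmodule := by simpa using S.toSubmodule.sub_mem hx haS
      exact Submodule.mem_sup.2 ⟨⟨a, haS⟩, ha, ⟨b, hbS⟩, hb, rfl⟩
  br_mem := fun hx hy => br_mem (L := L) hx hy
  br_skew := fun hx hy => Subtype.ext (br_skew (L := L) hx hy)
  br_jacobi := fun z hx hy => Subtype.ext (br_jacobi (L := L) z.1 hx hy)

/-- The intersection of two graded subalgebras. -/
def Subalg.inter (S T : Subalg L) : Subalg L where
  toSubmodule := S.toSubmodule ⊓ T.toSubmodule
  br_mem' x hx y hy := ⟨S.br_mem' x hx.1 y hy.1, T.br_mem' x hx.2 y hy.2⟩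
  graded' a ha b hb h := ⟨S.graded' a ha b hb h.1, T.graded' a ha b hb h.2⟩

/-- The graded subalgebra generated by a set. -/
def Subalg.gen (s : Set L) : Subalg L where
  toSubmodule := ⨅ (S : Subalg L) (_ : s ⊆ S.toSubmodule), S.toSubmodule
  br_mem' x hx y hy := by
    simp only [Submodule.mem_iInf] at hx hy ⊢
    exact fun S hS => S.br_mem' x (hx S hS) y (hy S hS)
  graded' a ha b hb h := by
    simp only [Submodule.mem_iInf] at h ⊢
    exact fun S hS => S.graded' a ha b hb (h S hS)

end Subalg

/-- `L` is the Lie superalgebra `𝔤(A)` with invertible Cartan matrix `A`, with Chevalley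
generators `e i`, `f i` of parity `p i` and `h i = [e i, f i]`: these generate `L`, satisfy the
Chevalley relations, and no nonzero ideal meets the span of the `h i` in zero only. -/
structure IsContragredient {L : Type*} [AddCommGroup L] [Module ℂ L] [LieSuperalgebra L]
    {n : ℕ} (A : Matrix (Fin n) (Fin n) ℂ) (p : Fin n → ZMod 2) (e f : Fin n → L) : Prop where
  det_ne_zero : A.det ≠ 0
  e_mem : ∀ i, e i ∈ part (L := L) (p i)
  f_mem : ∀ i, f i ∈ part (L := L) (p i)
  e_f : ∀ i j, i ≠ j → br (e i) (f j) = 0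
  h_h : ∀ i j, br (br (e i) (f i)) (br (e j) (f j)) = 0
  h_e : ∀ i j, br (br (e i) (f i)) (e j) = A i j • e j
  h_f : ∀ i j, br (br (e i) (f i)) (f j) = -(A i j • f j)
  linearIndependent : LinearIndependent ℂ fun i => br (e i) (f i)
  generate : (Subalg.gen (Set.range e ∪ Set.range f)).toSubmodule = ⊤
  ideal_eq_bot : ∀ I : Submodule ℂ L, IsGraded I → (∀ x, ∀ y ∈ I, br x y ∈ I) →
    I ⊓ Submodule.span ℂ (Set.range fun i => br (e i) (f i)) = ⊥ → I = ⊥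

/-- The monoid (in fact group) of inner automorphisms: products of `exp (ad x)` for even
ad-nilpotent `x`. -/
noncomputable def inner (L : Type*) [AddCommGroup L] [Module ℂ L] [LieSuperalgebra L] :
    Submonoid (Module.End ℂ L) :=
  Submonoid.closure {φ | ∃ x ∈ part (L := L) 0, ∃ n : ℕ, (br x : Module.End ℂ L) ^ n = 0 ∧
    φ = ∑ k ∈ Finset.range n, ((k.factorial : ℂ)⁻¹) • (br x : Module.End ℂ L) ^ k}

/-- Outer automorphisms of order `3`. -/
structure IsOuterOfOrderThree {L : Type*} [AddCommGroup L] [Module ℂ L] [LieSuperalgebra L]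
    (σ : Hom L L) : Prop where
  cube : ∀ x, σ (σ (σ x)) = x
  outer : σ.toLinearMap ∉ inner L

/-- `L` is presented by the generators `y₁`, `y₂` of parities `p`, `q` and the relations `R`:
it is universal among the Lie superalgebras with two elements of these parities that
satisfy `R`. -/
structure IsPresentedBy {L : Type} [AddCommGroup L] [Module ℂ L] [LieSuperalgebra L]
    (p q : ZMod 2)
    (R : ∀ (M : Type) [AddCommGroup M] [Module ℂ M] [LieSuperalgebra M], M → M → Prop)
    (y₁ y₂ : L) : Prop where
  mem_one : y₁ ∈ part (L := L) p
  mem_two : y₂ ∈ part (L := L) q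
  rel : R L y₁ y₂
  existsUnique_hom : ∀ (M : Type) [AddCommGroup M] [Module ℂ M] [LieSuperalgebra M],
    ∀ m₁ ∈ part (L := M) p, ∀ m₂ ∈ part (L := M) q, R M m₁ m₂ →
      ∃! f : Hom L M, f y₁ = m₁ ∧ f y₂ = m₂

/-! ### Loop superalgebras -/

/-- The loop space `L ⊗ ℂ[t, t⁻¹]`; `x tᵏ` is `Finsupp.single k x`. -/
abbrev Loop (L : Type*) [AddCommGroup L] : Type _ := ℤ →₀ L

section Loop

variable {L : Type*} [AddCommGroup L] [Module ℂ L] [LieSuperalgebra L]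

/-- The bracket `[x tⁱ, y tʲ] = [x, y] tⁱ⁺ʲ`. -/
noncomputable def loopBr : Loop L →ₗ[ℂ] Loop L →ₗ[ℂ] Loop L :=
  Finsupp.lsum ℂ fun i => (Finsupp.lsum ℂ fun j =>
    ((br (L := L)).compr₂ (Finsupp.lsingle (i + j))).flip).flip

theorem loopBr_single (i j : ℤ) (x y : L) :
    loopBr (Finsupp.single i x) (Finsupp.single j y) = Finsupp.single (i + j) (br x y) := by
  simp [loopBr]

theorem loopBr_eq (f g : Loop L) : loopBr f g =
    ∑ i ∈ f.support, ∑ j ∈ g.support, Finsupp.single (i + j) (br (f i) (g j)) := by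
  conv_lhs => rw [← f.sum_single, ← g.sum_single]
  simp only [Finsupp.sum, map_sum, LinearMap.sum_apply, loopBr_single]
  exact Finset.sum_comm

theorem loopBr_apply (f g : Loop L) (k : ℤ) : loopBr f g k =
    ∑ i ∈ f.support, ∑ j ∈ g.support, if i + j = k then br (f i) (g j) else 0 := by
  simp [loopBr_eq, Finsupp.finsetSum_apply, Finsupp.single_apply]

/-- Loops all of whose coefficients are of parity `p`. -/
def loopPart (p : ZMod 2) : Submodule ℂ (Loop L) where
  carrier := {f | ∀ k, f k ∈ part (L := L) p}
  add_mem' hf hg k := add_mem (hf k) (hg k)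
  zero_mem' _ := zero_mem _
  smul_mem' c _ hf k := Submodule.smul_mem _ c (hf k)

theorem loopPart_induction {p : ZMod 2} {P : Loop L → Prop} (h0 : P 0)
    (hadd : ∀ f g, P f → P g → P (f + g))
    (hs : ∀ k, ∀ x ∈ part (L := L) p, P (Finsupp.single k x))
    (f : Loop L) (hf : f ∈ loopPart p) : P f := by
  rw [← f.sum_single]
  exact Finset.sum_induction _ P hadd h0 fun k _ => hs k _ (hf k)

theorem single_mem_loopPart {p : ZMod 2} (k : ℤ) {x : L} (hx : x ∈ part (L := L) p) :
    Finsupp.single k x ∈ loopPart (L := L) p := by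
  intro j
  rw [Finsupp.single_apply]
  split_ifs
  exacts [hx, zero_mem _]

noncomputable instance : LieSuperalgebra (Loop L) where
  br := loopBr
  part := loopPart
  isCompl := by
    constructor
    · rw [Submodule.disjoint_def]
      intro f h0 h1
      ext k
      exact (Submodule.disjoint_def.1 (isCompl (L := L)).disjoint) _ (h0 k) (h1 k)
    · rw [codisjoint_iff, eq_top_iff]
      rintro f -
      induction f using Finsupp.induction_linear with
      | zero => exact zero_mem _
      | add f g hf hg => exact add_mem hf hg
      | single k x =>
        have h : x ∈ part (L := L) 0 ⊔ part (L := L) 1 := by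
          rw [(isCompl (L := L)).sup_eq_top]; trivial
        obtain ⟨a, ha, b, hb, rfl⟩ := Submodule.mem_sup.1 h
        rw [Finsupp.single_add]
        exact Submodule.add_mem_sup (single_mem_loopPart k ha) (single_mem_loopPart k hb)
  br_mem := by
    intro p q f g hf hg k
    rw [loopBr_apply]
    refine Submodule.sum_mem _ fun i _ => Submodule.sum_mem _ fun j _ => ?_
    split_ifs
    exacts [br_mem (hf i) (hg j), zero_mem _]
  br_skew := by
    intro p q f g hf hg
    refine loopPart_induction (P := fun f => loopBr f g = -(superSign p q • loopBr g f))
      ?_ (fun f f' h h' => ?_) (fun i x hx => ?_) f hf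
    · simp
    · simp only [map_add, LinearMap.add_apply, h, h', smul_add, neg_add]
    · refine loopPart_induction (P := fun g => loopBr (Finsupp.single i x) g =
          -(superSign p q • loopBr g (Finsupp.single i x)))
        ?_ (fun f f' h h' => ?_) (fun j y hy => ?_) g hg
      · simp
      · simp only [map_add, LinearMap.add_apply, h, h', smul_add, neg_add]
      · rw [loopBr_single, loopBr_single, br_skew hx hy, add_comm j i, Finsupp.single_neg,
          Finsupp.smul_single]
  br_jacobi := by
    intro p q f g h hf hg
    refine loopPart_induction (P := fun f => loopBr f (loopBr g h) =
        loopBr (loopBr f g) h + superSign p q • loopBr g (loopBr f h))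
      ?_ (fun f f' e e' => ?_) (fun i x hx => ?_) f hf
    · simp
    · simp only [map_add, LinearMap.add_apply, e, e', smul_add]; abel
    · refine loopPart_induction (P := fun g => loopBr (Finsupp.single i x) (loopBr g h) =
          loopBr (loopBr (Finsupp.single i x) g) h + superSign p q • loopBr g (loopBr (Finsupp.single i x) h))
        ?_ (fun f f' e e' => ?_) (fun j y hy => ?_) g hg
      · simp
      · simp only [map_add, LinearMap.add_apply, e, e', smul_add]; abel
      · induction h using Finsupp.induction_linear with
        | zero => simp
        | add f g hf hg => simp only [map_add, hf, hg, smul_add]; abel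
        | single k z =>
          simp only [loopBr_single]
          rw [br_jacobi z hx hy, Finsupp.single_add, add_assoc, Finsupp.smul_single,
            add_left_comm j i k]

/-- The twisted loop superalgebra: `∑ xₖ tᵏ` with `σ xₖ = ωᵏ xₖ`. -/
noncomputable def twistedLoop (σ : Hom L L) (ω : ℂ) (hω : ω ≠ 0) : Subalg (Loop L) where
  carrier := {f | ∀ k, σ (f k) = ω ^ k • f k}
  add_mem' hf hg k := by
    simp only [Set.mem_ofPred_eq] at hf hg
    simp [hf k, hg k]
  zero_mem' k := by simp
  smul_mem' c f hf k := by
    simp only [Set.mem_ofPred_eq] at hf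
    simp [hf k, smul_comm c]
  br_mem' f hf g hg k := by
    change σ (loopBr f g k) = _ • loopBr f g k
    rw [loopBr_apply, map_sum, Finset.smul_sum]
    refine Finset.sum_congr rfl fun i _ => ?_
    rw [map_sum, Finset.smul_sum]
    refine Finset.sum_congr rfl fun j _ => ?_
    split_ifs with hij
    · have h1 : σ (br (f i) (g j)) = br (σ (f i)) (σ (g j)) := σ.map_br _ _
      rw [h1, show σ (f i) = _ from hf i, show σ (g j) = _ from hg j, ← hij, zpow_add₀ hω]
      simp [smul_smul, mul_comm]
    · simp
  graded' f hf g hg h k := by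
    have h1 : σ (f k) + σ (g k) = ω ^ k • f k + ω ^ k • g k := by
      rw [← map_add, ← smul_add]; exact h k
    have h2 : σ (f k) - ω ^ k • f k = ω ^ k • g k - σ (g k) := by
      rw [sub_eq_sub_iff_add_eq_add, h1, add_comm]
    have h3 := (Submodule.disjoint_def.1 (isCompl (L := L)).disjoint) (σ (f k) - ω ^ k • f k)
      (sub_mem (σ.map_part 0 _ (hf k)) (Submodule.smul_mem _ _ (hf k)))
      (h2 ▸ sub_mem (Submodule.smul_mem _ _ (hg k)) (σ.map_part 1 _ (hg k)))
    exact sub_eq_zero.1 h3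

/-- Loops that involve only `tᵏ` with `k ≥ 0` (if `s = 1`) or `k ≤ 0` (if `s = -1`), with
the coefficient of `t⁰` in `𝔫`. -/
noncomputable def halfLoop (s : ℤˣ) (𝔫 : Subalg L) : Subalg (Loop L) where
  carrier := {f | (∀ k : ℤ, (s : ℤ) * k < 0 → f k = 0) ∧ f 0 ∈ 𝔫.toSubmodule}
  add_mem' hf hg := ⟨fun k hk => by simp [hf.1 k hk, hg.1 k hk], add_mem hf.2 hg.2⟩
  zero_mem' := ⟨fun k _ => rfl, zero_mem _⟩
  smul_mem' c f hf := ⟨fun k hk => by simp [hf.1 k hk], Submodule.smul_mem _ c hf.2⟩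
  br_mem' f hf g hg := by
    have key : ∀ i j : ℤ, (s : ℤ) * i < 0 ∨ (s : ℤ) * j < 0 → br (f i) (g j) = 0 := by
      rintro i j (h | h)
      · simp [hf.1 i h]
      · simp [hg.1 j h]
    constructor
    · intro k hk
      change loopBr f g k = 0
      rw [loopBr_apply]
      refine Finset.sum_eq_zero fun i _ => Finset.sum_eq_zero fun j _ => ?_
      split_ifs with hij
      · refine key i j ?_
        by_contra! hc
        rw [← hij, mul_add] at hk
        lia
      · rfl
    · change loopBr f g 0 ∈ _
      rw [loopBr_apply]
      refine Submodule.sum_mem _ fun i _ => Submodule.sum_mem _ fun j _ => ?_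
      split_ifs with hij
      · by_cases hc : (s : ℤ) * i < 0 ∨ (s : ℤ) * j < 0
        · rw [key i j hc]; exact zero_mem _
        · push Not at hc
          have hs : (s : ℤ) * i = 0 := by
            have : (s : ℤ) * i + (s : ℤ) * j = 0 := by rw [← mul_add, hij, mul_zero]
            lia
          have hi : i = 0 := by simpa using hs
          have hj : j = 0 := by lia
          subst hi hj
          exact 𝔫.br_mem' _ hf.2 _ hg.2
      · exact zero_mem _
  graded' f hf g hg h := by
    refine ⟨fun k hk => ?_, 𝔫.graded' _ (hf 0) _ (hg 0) h.2⟩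
    have h1 : f k + g k = 0 := h.1 k hk
    refine (Submodule.disjoint_def.1 (isCompl (L := L)).disjoint) _ (hf k) ?_
    rw [eq_neg_of_add_eq_zero_left h1]
    exact neg_mem (hg k)

/-- The positive (`s = 1`) or negative (`s = -1`) maximal nilpotent subalgebra of the twisted
loop superalgebra, where `𝔫` is the corresponding maximal nilpotent subalgebra of `L`. -/
noncomputable def nilLoop (σ : Hom L L) (ω : ℂ) (hω : ω ≠ 0) (s : ℤˣ) (𝔫 : Subalg L) :
    Subalg (Loop L) :=
  (twistedLoop σ ω hω).inter (halfLoop s 𝔫)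

end Loop

end LieSuperalgebra

/-! ### The deforms `D(2,1;α)` of `osp(4|2)` -/

namespace D21

section

attribute [local instance] LieRing.ofAssociativeRing LieAlgebra.ofAssociativeAlgebra

/-- The even part `sl(2) ⊕ sl(2) ⊕ sl(2)`. -/
abbrev Even : Type := Fin 3 → LieAlgebra.SpecialLinear.sl (Fin 2) ℂ
/-- The odd part `V ⊗ V ⊗ V`, `V = ℂ²`, in coordinates. -/
abbrev Odd : Type := (Fin 3 → Fin 2) → ℂ

/-- The invariant symplectic form of `V`. -/
noncomputable def J : Matrix (Fin 2) (Fin 2) ℂ := !![0, 1; -1, 0]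

/-- The three structure parameters; they add up to zero. -/
noncomputable def weight (α : ℂ) : Fin 3 → ℂ := ![1, α, -1 - α]

/-- The action of `sl(2) ⊕ sl(2) ⊕ sl(2)` on `V ⊗ V ⊗ V`. -/
noncomputable def act (A : Even) (ψ : Odd) : Odd := fun t =>
  ∑ s : Fin 3, ∑ r : Fin 2, (A s).1 (t s) r * ψ (Function.update t s r)

/-- The `s`-th equivariant map `S²(V ⊗ V ⊗ V) → sl(2)`: it contracts the tensor factors other
than `s` by the symplectic form `ω` and sends `x`, `y` in the factor `s` to
`z ↦ ω(y, z) x + ω(x, z) y`. -/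
noncomputable def pairMat (s : Fin 3) (φ ψ : Odd) : Matrix (Fin 2) (Fin 2) ℂ := Matrix.of fun a b =>
  ∑ t : Fin 3 → Fin 2, ∑ u : Fin 3 → Fin 2,
    φ t * ψ u * (∏ s' ∈ Finset.univ.erase s, J (t s') (u s')) *
      ((if t s = a then J (u s) b else 0) + (if u s = a then J (t s) b else 0))

theorem pairMat_mem (s : Fin 3) (φ ψ : Odd) : pairMat s φ ψ ∈ LieAlgebra.SpecialLinear.sl (Fin 2) ℂ := by
  change pairMat s φ ψ ∈ LinearMap.ker (Matrix.traceLinearMap (Fin 2) ℂ ℂ)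
  rw [LinearMap.mem_ker, Matrix.traceLinearMap_apply]
  simp only [Matrix.trace, Matrix.diag, pairMat, Matrix.of_apply]
  rw [Finset.sum_comm]
  refine Finset.sum_eq_zero fun t _ => ?_
  rw [Finset.sum_comm]
  refine Finset.sum_eq_zero fun u _ => ?_
  rw [← Finset.mul_sum]
  refine mul_eq_zero_of_right _ ?_
  generalize t s = a
  generalize u s = b
  fin_cases a <;> fin_cases b <;> simp [J]

/-- The `s`-th component of the bracket of two odd elements. -/
noncomputable def pair (α : ℂ) (s : Fin 3) (φ ψ : Odd) : LieAlgebra.SpecialLinear.sl (Fin 2) ℂ :=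
  ⟨weight α s • pairMat s φ ψ, (LieAlgebra.SpecialLinear.sl (Fin 2) ℂ).smul_mem _ (pairMat_mem s φ ψ)⟩

theorem sum_tri {M : Type*} [AddCommMonoid M] (F : (Fin 3 → Fin 2) → M) :
    ∑ t, F t = ∑ a, ∑ b, ∑ c, F ![a, b, c] := by
  rw [← (Fin.consEquiv (fun _ => Fin 2)).sum_comp, Fintype.sum_prod_type]
  refine Finset.sum_congr rfl fun a _ => ?_
  rw [← (Fin.consEquiv (fun _ => Fin 2)).sum_comp, Fintype.sum_prod_type]
  refine Finset.sum_congr rfl fun b _ => ?_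
  rw [← (Fin.consEquiv (fun _ => Fin 2)).sum_comp, Fintype.sum_prod_type]
  refine Finset.sum_congr rfl fun c _ => ?_
  rw [Fintype.sum_unique]
  congr 1

theorem upd0 (a b c r : Fin 2) : Function.update ![a, b, c] 0 r = ![r, b, c] := by
  ext i; fin_cases i <;> rfl
theorem upd1 (a b c r : Fin 2) : Function.update ![a, b, c] 1 r = ![a, r, c] := by
  ext i; fin_cases i <;> rfl
theorem upd2 (a b c r : Fin 2) : Function.update ![a, b, c] 2 r = ![a, b, r] := by
  ext i; fin_cases i <;> rfl

theorem exists_tri (t : Fin 3 → Fin 2) : ∃ a b c, t = ![a, b, c] :=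
  ⟨t 0, t 1, t 2, by ext i; fin_cases i <;> rfl⟩

theorem act_tri (A : Even) (ψ : Odd) (a b c : Fin 2) : act A ψ ![a, b, c] =
    ((A 0).1 a 0 * ψ ![0, b, c] + (A 0).1 a 1 * ψ ![1, b, c]) +
    ((A 1).1 b 0 * ψ ![a, 0, c] + (A 1).1 b 1 * ψ ![a, 1, c]) +
    ((A 2).1 c 0 * ψ ![a, b, 0] + (A 2).1 c 1 * ψ ![a, b, 1]) := by
  simp [act, Fin.sum_univ_three, Fin.sum_univ_two, upd0, upd1, upd2]

theorem act_lie (A B : Even) (ψ : Odd) :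
    act (fun s => ⁅A s, B s⁆) ψ = act A (act B ψ) - act B (act A ψ) := by
  funext t
  obtain ⟨a, b, c, rfl⟩ := exists_tri t
  simp only [Pi.sub_apply, act_tri, LieAlgebra.SpecialLinear.sl_bracket,
    Matrix.sub_apply, Matrix.mul_apply, Fin.sum_univ_two]
  ring


theorem J_eval : J 0 0 = 0 ∧ J 0 1 = 1 ∧ J 1 0 = -1 ∧ J 1 1 = 0 := by simp [J]

theorem pairMat_zero (φ ψ : Odd) (a b : Fin 2) : pairMat 0 φ ψ a b =
    ∑ p, ∑ q, (φ ![p, 0, 0] * ψ ![q, 1, 1] - φ ![p, 0, 1] * ψ ![q, 1, 0]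
      - φ ![p, 1, 0] * ψ ![q, 0, 1] + φ ![p, 1, 1] * ψ ![q, 0, 0]) *
      ((if p = a then J q b else 0) + (if q = a then J p b else 0)) := by
  have h : (Finset.univ : Finset (Fin 3)).erase 0 = {1, 2} := by decide
  obtain ⟨h1, h2, h3, h4⟩ := J_eval
  simp only [pairMat, Matrix.of_apply, sum_tri, h]
  simp only [Finset.prod_insert (show (1 : Fin 3) ∉ ({2} : Finset (Fin 3)) by decide),
    Finset.prod_singleton, Fin.sum_univ_two, Matrix.cons_val, h1, h2, h3, h4]
  fin_cases a <;> fin_cases b <;> simp [h1, h2, h3, h4] <;> ring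

theorem pairMat_one (φ ψ : Odd) (a b : Fin 2) : pairMat 1 φ ψ a b =
    ∑ p, ∑ q, (φ ![0, p, 0] * ψ ![1, q, 1] - φ ![0, p, 1] * ψ ![1, q, 0]
      - φ ![1, p, 0] * ψ ![0, q, 1] + φ ![1, p, 1] * ψ ![0, q, 0]) *
      ((if p = a then J q b else 0) + (if q = a then J p b else 0)) := by
  have h : (Finset.univ : Finset (Fin 3)).erase 1 = {0, 2} := by decide
  obtain ⟨h1, h2, h3, h4⟩ := J_eval
  simp only [pairMat, Matrix.of_apply, sum_tri, h]
  simp only [Finset.prod_insert (show (0 : Fin 3) ∉ ({2} : Finset (Fin 3)) by decide),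
    Finset.prod_singleton, Fin.sum_univ_two, Matrix.cons_val, h1, h2, h3, h4]
  fin_cases a <;> fin_cases b <;> simp [h1, h2, h3, h4] <;> ring

theorem pairMat_two (φ ψ : Odd) (a b : Fin 2) : pairMat 2 φ ψ a b =
    ∑ p, ∑ q, (φ ![0, 0, p] * ψ ![1, 1, q] - φ ![0, 1, p] * ψ ![1, 0, q]
      - φ ![1, 0, p] * ψ ![0, 1, q] + φ ![1, 1, p] * ψ ![0, 0, q]) *
      ((if p = a then J q b else 0) + (if q = a then J p b else 0)) := by
  have h : (Finset.univ : Finset (Fin 3)).erase 2 = {0, 1} := by decide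
  obtain ⟨h1, h2, h3, h4⟩ := J_eval
  simp only [pairMat, Matrix.of_apply, sum_tri, h]
  simp only [Finset.prod_insert (show (0 : Fin 3) ∉ ({1} : Finset (Fin 3)) by decide),
    Finset.prod_singleton, Fin.sum_univ_two, Matrix.cons_val, h1, h2, h3, h4]
  fin_cases a <;> fin_cases b <;> simp [h1, h2, h3, h4] <;> ring

theorem pairMat_symm (s : Fin 3) (φ ψ : Odd) : pairMat s φ ψ = pairMat s ψ φ := by
  obtain ⟨h1, h2, h3, h4⟩ := J_eval
  ext a b
  fin_cases s <;>
  simp only [Fin.zero_eta, Fin.mk_one, Fin.reduceFinMk, pairMat_zero, pairMat_one, pairMat_two, Fin.sum_univ_two] <;>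
  fin_cases a <;> fin_cases b <;> simp [h1, h2, h3, h4] <;> ring

theorem sl_trace (X : LieAlgebra.SpecialLinear.sl (Fin 2) ℂ) : X.1 1 1 = -X.1 0 0 := by
  have h : Matrix.trace X.1 = 0 := X.2
  rw [Matrix.trace_fin_two] at h
  linear_combination h

theorem lie_pairMat (s : Fin 3) (A : Even) (φ ψ : Odd) :
    (A s).1 * pairMat s φ ψ - pairMat s φ ψ * (A s).1 =
      pairMat s (act A φ) ψ + pairMat s φ (act A ψ) := by
  obtain ⟨h1, h2, h3, h4⟩ := J_eval
  ext a b
  fin_cases s <;>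
  simp only [Fin.zero_eta, Fin.mk_one, Fin.reduceFinMk, Matrix.sub_apply, Matrix.add_apply, Matrix.mul_apply,
    pairMat_zero, pairMat_one, pairMat_two, Fin.sum_univ_two, act_tri] <;>
  fin_cases a <;> fin_cases b <;> simp [h1, h2, h3, h4, sl_trace] <;> ring

theorem pair_jacobi (α : ℂ) (φ ψ χ : Odd) :
    act (fun s => pair α s φ ψ) χ + act (fun s => pair α s ψ χ) φ
      + act (fun s => pair α s χ φ) ψ = 0 := by
  obtain ⟨h1, h2, h3, h4⟩ := J_eval
  funext t
  obtain ⟨a, b, c, rfl⟩ := exists_tri t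
  simp only [Pi.add_apply, Pi.zero_apply, act_tri, pair, Matrix.smul_apply, smul_eq_mul,
    pairMat_zero, pairMat_one, pairMat_two, Fin.sum_univ_two, weight, Matrix.cons_val]
  fin_cases a <;> fin_cases b <;> fin_cases c <;> simp [h1, h2, h3, h4] <;> ring


theorem pairMat_add (s : Fin 3) (φ φ' ψ : Odd) :
    pairMat s (φ + φ') ψ = pairMat s φ ψ + pairMat s φ' ψ := by
  ext a b
  simp only [pairMat, Matrix.of_apply, Matrix.add_apply, ← Finset.sum_add_distrib, Pi.add_apply,
    add_mul]

theorem pairMat_smul (s : Fin 3) (c : ℂ) (φ ψ : Odd) :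
    pairMat s (c • φ) ψ = c • pairMat s φ ψ := by
  ext a b
  simp only [pairMat, Matrix.of_apply, Matrix.smul_apply, Pi.smul_apply, smul_eq_mul,
    Finset.mul_sum, mul_assoc]

theorem pair_symm (α : ℂ) (s : Fin 3) (φ ψ : Odd) : pair α s φ ψ = pair α s ψ φ :=
  Subtype.ext (by simp only [pair, pairMat_symm s φ ψ])

theorem pair_add (α : ℂ) (s : Fin 3) (φ φ' ψ : Odd) :
    pair α s (φ + φ') ψ = pair α s φ ψ + pair α s φ' ψ :=
  Subtype.ext (by simp [pair, pairMat_add])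

theorem pair_smul (α : ℂ) (s : Fin 3) (c : ℂ) (φ ψ : Odd) :
    pair α s (c • φ) ψ = c • pair α s φ ψ :=
  Subtype.ext (by simp [pair, pairMat_smul, smul_comm c])

theorem lie_pair (α : ℂ) (s : Fin 3) (A : Even) (φ ψ : Odd) :
    ⁅A s, pair α s φ ψ⁆ = pair α s (act A φ) ψ + pair α s φ (act A ψ) := by
  refine Subtype.ext ?_
  rw [LieAlgebra.SpecialLinear.sl_bracket]
  simp only [pair, AddMemClass.mk_add_mk, mul_smul_comm, smul_mul_assoc]
  rw [← smul_sub, lie_pairMat, smul_add]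

theorem act_add (A : Even) (φ ψ : Odd) : act A (φ + ψ) = act A φ + act A ψ := by
  funext t
  simp only [act, Pi.add_apply, mul_add, Finset.sum_add_distrib]

theorem act_smul (c : ℂ) (A : Even) (φ : Odd) : act A (c • φ) = c • act A φ := by
  funext t
  simp only [act, Pi.smul_apply, smul_eq_mul, Finset.mul_sum, mul_left_comm]

theorem add_act (A B : Even) (φ : Odd) : act (A + B) φ = act A φ + act B φ := by
  funext t
  have h : ∀ X Y : LieAlgebra.SpecialLinear.sl (Fin 2) ℂ, (X + Y).1 = X.1 + Y.1 :=
    fun _ _ => rfl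
  simp only [act, h, Pi.add_apply, Matrix.add_apply, add_mul, Finset.sum_add_distrib]

theorem smul_act (c : ℂ) (A : Even) (φ : Odd) : act (c • A) φ = c • act A φ := by
  funext t
  have h : ∀ X : LieAlgebra.SpecialLinear.sl (Fin 2) ℂ, (c • X).1 = c • X.1 := fun _ => rfl
  simp only [act, h, Pi.smul_apply, Matrix.smul_apply, smul_eq_mul, Finset.mul_sum, mul_assoc]

/-- The bracket of `D(2,1;α)`. -/
noncomputable def bracket (α : ℂ) : Even × Odd →ₗ[ℂ] Even × Odd →ₗ[ℂ] Even × Odd :=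
  LinearMap.mk₂ ℂ
    (fun x y => (fun s => ⁅x.1 s, y.1 s⁆ + pair α s x.2 y.2, act x.1 y.2 - act y.1 x.2))
    (fun x x' y => by
      refine Prod.ext (funext fun s => ?_) ?_
      · simp only [Prod.fst_add, Prod.snd_add, Pi.add_apply, add_lie, pair_add]; abel
      · simp only [Prod.fst_add, Prod.snd_add, add_act, act_add]; abel)
    (fun c x y => by
      refine Prod.ext (funext fun s => ?_) ?_
      · simp only [Prod.smul_fst, Prod.smul_snd, Pi.smul_apply, smul_lie, pair_smul, smul_add]
      · simp only [Prod.smul_fst, Prod.smul_snd, smul_act, act_smul, smul_sub])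
    (fun x y y' => by
      refine Prod.ext (funext fun s => ?_) ?_
      · simp only [Prod.fst_add, Prod.snd_add, Pi.add_apply, lie_add, pair_symm α s x.2, pair_add]
        abel
      · simp only [Prod.fst_add, Prod.snd_add, add_act, act_add]; abel)
    (fun c x y => by
      refine Prod.ext (funext fun s => ?_) ?_
      · simp only [Prod.smul_fst, Prod.smul_snd, Pi.smul_apply, lie_smul, pair_symm α s x.2,
          pair_smul, smul_add]
      · simp only [Prod.smul_fst, Prod.smul_snd, smul_act, act_smul, smul_sub])

theorem bracket_apply (α : ℂ) (A B : Even) (φ ψ : Odd) : bracket α (A, φ) (B, ψ) =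
    (fun s => ⁅A s, B s⁆ + pair α s φ ψ, act A ψ - act B φ) := rfl

/-- The homogeneous components: `{φ = 0}` and `{A = 0}`. -/
noncomputable def parts (i : ZMod 2) : Submodule ℂ (Even × Odd) :=
  if i = 0 then LinearMap.ker (LinearMap.snd ℂ Even Odd)
  else LinearMap.ker (LinearMap.fst ℂ Even Odd)

theorem mem_parts_zero {x : Even × Odd} : x ∈ parts 0 ↔ x.2 = 0 := by
  simp [parts]

theorem mem_parts_one {x : Even × Odd} : x ∈ parts 1 ↔ x.1 = 0 := by
  simp [parts]

theorem zero_act (φ : Odd) : act 0 φ = 0 := by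
  simpa using smul_act 0 0 φ

theorem act_zero (A : Even) : act A 0 = 0 := by
  simpa using act_smul 0 A 0

theorem zero_pair (α : ℂ) (s : Fin 3) (φ : Odd) : pair α s 0 φ = 0 := by
  simpa using pair_smul α s 0 0 φ

theorem pair_zero (α : ℂ) (s : Fin 3) (φ : Odd) : pair α s φ 0 = 0 := by
  rw [pair_symm, zero_pair]

theorem neg_act (A : Even) (φ : Odd) : act (-A) φ = -act A φ := by
  simpa using smul_act (-1) A φ

theorem act_neg (A : Even) (φ : Odd) : act A (-φ) = -act A φ := by
  simpa using act_smul (-1) A φ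

theorem neg_pair (α : ℂ) (s : Fin 3) (φ ψ : Odd) : pair α s (-φ) ψ = -pair α s φ ψ := by
  simpa using pair_smul α s (-1) φ ψ

theorem pair_neg (α : ℂ) (s : Fin 3) (φ ψ : Odd) : pair α s φ (-ψ) = -pair α s φ ψ := by
  rw [pair_symm, neg_pair, pair_symm]

theorem zmod_two (i : ZMod 2) : i = 0 ∨ i = 1 := by
  revert i; decide

theorem isCompl_parts : IsCompl (parts 0) (parts 1) := by
  constructor
  · rw [Submodule.disjoint_def]
    intro x h0 h1
    exact Prod.ext (mem_parts_one.1 h1) (mem_parts_zero.1 h0)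
  · rw [codisjoint_iff, eq_top_iff]
    rintro ⟨A, φ⟩ -
    exact Submodule.mem_sup.2 ⟨(A, 0), mem_parts_zero.2 rfl, (0, φ), mem_parts_one.2 rfl,
      by simp⟩

theorem bracket_mem (α : ℂ) {i j : ZMod 2} {x y : Even × Odd} (hx : x ∈ parts i)
    (hy : y ∈ parts j) : bracket α x y ∈ parts (i + j) := by
  obtain ⟨A, φ⟩ := x
  obtain ⟨B, ψ⟩ := y
  rw [bracket_apply]
  have h2 : (1 + 1 : ZMod 2) = 0 := by decide
  rcases zmod_two i with rfl | rfl <;> rcases zmod_two j with rfl | rfl <;>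
    simp only [mem_parts_zero, mem_parts_one, add_zero, zero_add, h2] at hx hy ⊢ <;>
    subst hx hy
  · simp [act_zero]
  · funext s; simp [zero_pair]
  · funext s; simp [pair_zero]
  · simp [zero_act]

theorem bracket_skew (α : ℂ) {i j : ZMod 2} {x y : Even × Odd} (hx : x ∈ parts i)
    (hy : y ∈ parts j) : bracket α x y = -(superSign i j • bracket α y x) := by
  obtain ⟨A, φ⟩ := x
  obtain ⟨B, ψ⟩ := y
  rw [bracket_apply, bracket_apply]
  rcases zmod_two i with rfl | rfl <;> rcases zmod_two j with rfl | rfl <;>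
    simp only [mem_parts_zero, mem_parts_one] at hx hy <;>
    subst hx hy <;> refine Prod.ext (funext fun s => ?_) ?_ <;>
    simp [superSign, act_zero, zero_act, pair_zero, zero_pair]
  exact pair_symm α s φ ψ

theorem bracket_jacobi (α : ℂ) {i j : ZMod 2} {x y : Even × Odd} (z : Even × Odd)
    (hx : x ∈ parts i) (hy : y ∈ parts j) :
    bracket α x (bracket α y z) =
      bracket α (bracket α x y) z + superSign i j • bracket α y (bracket α x z) := by
  obtain ⟨A, φ⟩ := x
  obtain ⟨B, ψ⟩ := y
  obtain ⟨C, χ⟩ := z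
  simp only [bracket_apply]
  have h0 : (fun _ => 0 : Even) = 0 := rfl
  rcases zmod_two i with rfl | rfl <;> rcases zmod_two j with rfl | rfl <;>
    simp only [mem_parts_zero, mem_parts_one] at hx hy <;>
    subst hx hy <;> refine Prod.ext (funext fun s => ?_) ?_ <;>
    simp only [superSign, act_zero, zero_act, pair_zero, zero_pair, Pi.zero_apply, lie_zero,
      zero_lie, add_zero, zero_add, sub_zero, zero_sub, sub_self, Prod.fst_add, Prod.snd_add,
      Pi.add_apply, zero_ne_one, false_and, and_false, and_self, ↓reduceIte, one_smul, neg_smul,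
      neg_zero, h0, Pi.neg_apply, Prod.fst_neg, Prod.snd_neg, act_neg, neg_pair, pair_neg]
  · exact leibniz_lie (A s) (B s) (C s)
  · rw [act_lie]; abel
  · exact lie_pair α s A ψ χ
  · rw [act_lie]; abel
  · rw [lie_pair]; abel
  · rw [act_lie]; abel
  · rw [← lie_skew, lie_pair, pair_symm α s (act C φ)]; abel
  · have h := pair_jacobi α φ ψ χ
    simp only [pair_symm α _ χ φ] at h
    rw [neg_neg, neg_eq_iff_add_eq_zero]
    refine Eq.trans ?_ h
    abel

end

end D21

/-- The Lie superalgebra `D(2,1;α)`: its even part is `sl(2) ⊕ sl(2) ⊕ sl(2)`, its odd part is the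
tensor product of the three standard modules, and the bracket of two odd elements has the
components `1`, `α`, `-1 - α` times the equivariant maps to the three summands. It is the deform of `osp(4|2) = D(2,1;1)`. -/
def D21 (_α : ℂ) : Type := D21.Even × D21.Odd

namespace D21

noncomputable instance (α : ℂ) : AddCommGroup (D21 α) := inferInstanceAs (AddCommGroup (Even × Odd))

noncomputable instance (α : ℂ) : Module ℂ (D21 α) := inferInstanceAs (Module ℂ (Even × Odd))

noncomputable instance (α : ℂ) : LieSuperalgebra (D21 α) where
  br := bracket α
  part := parts
  isCompl := isCompl_parts
  br_mem := bracket_mem α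
  br_skew := bracket_skew α
  br_jacobi := bracket_jacobi α


/-- The Cartan matrix of `𝔡(ε)` for a base of odd roots. -/
noncomputable def cartan (ε : ℂ) : Matrix (Fin 3) (Fin 3) ℂ :=
  !![0, 1, ε ^ 2; -1, 0, -ε; ε ^ 2, ε, 0]

/-- The Chevalley generators `X⁺₁, X⁺₂, X⁺₃`: `v₁⊗v₀⊗v₀`, `v₀⊗v₁⊗v₀`, `v₀⊗v₀⊗v₁`. -/
noncomputable def Xp (ε : ℂ) (i : Fin 3) : D21 ε :=
  ((0 : Even), (Pi.single (fun j => if j = i then 1 else 0) 1 : Odd))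

/-- The Chevalley generators `X⁻₁, X⁻₂, X⁻₃`: multiples of `v₀⊗v₁⊗v₁`, `v₁⊗v₀⊗v₁`,
`v₁⊗v₁⊗v₀`. -/
noncomputable def Xm (ε : ℂ) (i : Fin 3) : D21 ε :=
  ((0 : Even), (Pi.single (fun j => if j = i then 0 else 1) (![ε / 2, -ε / 2, ε / 2] i) : Odd))

open LieSuperalgebra

/-- `Y⁺₁ = ε X⁺₁ + ε² X⁺₂ + X⁺₃`. -/
noncomputable def Yp1 (ε : ℂ) : D21 ε := ε • Xp ε 0 + ε ^ 2 • Xp ε 1 + Xp ε 2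

/-- `Y⁺₂ = [X⁻₃, [X⁻₁, X⁻₂]]`. -/
noncomputable def Yp2 (ε : ℂ) : D21 ε := br (Xm ε 2) (br (Xm ε 0) (Xm ε 1))

/-- `Y⁻₁ = ε X⁻₁ + ε² X⁻₂ + X⁻₃`. -/
noncomputable def Ym1 (ε : ℂ) : D21 ε := ε • Xm ε 0 + ε ^ 2 • Xm ε 1 + Xm ε 2

/-- `Y⁻₂ = [X⁺₁, X⁺₂] - [X⁺₁, X⁺₃] + [X⁺₂, X⁺₃]`. -/
noncomputable def Ym2 (ε : ℂ) : D21 ε :=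
  br (Xp ε 0) (Xp ε 1) - br (Xp ε 0) (Xp ε 2) + br (Xp ε 1) (Xp ε 2)

/-- The positive maximal nilpotent subalgebra of the twisted loop superalgebra `𝔡(ε)⁽³⁾` formed
with `σ`: `∑ xₖ tᵏ` with `k ≥ 0`, `σ xₖ = εᵏ xₖ` and `x₀` in the subalgebra generated by the
`X⁺ᵢ`. -/
noncomputable def loopPos (ε : ℂ) (hε : IsPrimitiveRoot ε 3)
    (σ : Hom (D21 ε) (D21 ε)) : Subalg (Loop (D21 ε)) :=
  nilLoop σ ε (hε.ne_zero three_ne_zero) 1 (Subalg.gen (Set.range (Xp ε)))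

/-- The negative maximal nilpotent subalgebra of the twisted loop superalgebra `𝔡(ε)⁽³⁾` formed
with `σ`: `∑ xₖ tᵏ` with `k ≤ 0`, `σ xₖ = εᵏ xₖ` and `x₀` in the subalgebra generated by the
`X⁻ᵢ`. -/
noncomputable def loopNeg (ε : ℂ) (hε : IsPrimitiveRoot ε 3)
    (σ : Hom (D21 ε) (D21 ε)) : Subalg (Loop (D21 ε)) :=
  nilLoop σ ε (hε.ne_zero three_ne_zero) (-1) (Subalg.gen (Set.range (Xm ε)))

end D21

/-! ### The relations -/

namespace LieSuperalgebra

section Relations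

variable {L : Type*} [AddCommGroup L] [Module ℂ L] [LieSuperalgebra L]

/-- The left-hand side of the fourth relation of the positive part. -/
def posFour (y₁ y₂ : L) : L :=
  br (br y₁ y₁) (br (br y₂ (br y₁ y₁)) (br (br y₂ (br y₁ y₁))
    (br (br y₁ y₁) (br y₂ (br y₁ y₁)))))

/-- The left-hand side of the fifth relation of the positive part. -/
def posFive (y₁ y₂ : L) : L :=
  br (br y₁ y₂) (br (br y₂ (br y₁ y₁)) (br (br y₂ (br y₁ y₁))
    (br (br y₁ y₁) (br y₂ (br y₁ y₁)))))

/-- The left-hand side of the fourth relation of the negative part. -/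
def negFour (y₁ y₂ : L) : L :=
  br (br y₁ y₁) (br (br y₂ (br y₁ y₁)) (br (br y₁ y₂) (br y₂ (br y₁ y₁))))

/-- The left-hand side of the fifth relation of the negative part. -/
def negFive (y₁ y₂ : L) : L :=
  br (br y₁ y₂) (br (br y₂ (br y₁ y₁)) (br (br y₁ y₂) (br y₂ (br y₁ y₁))))

end Relations

/-- The three homogeneous relations of the positive part. -/
def PosHom (L : Type) [AddCommGroup L] [Module ℂ L] [LieSuperalgebra L] (y₁ y₂ : L) : Prop :=
  br y₂ y₂ = 0 ∧
  br (br y₁ y₂) (br y₂ (br y₁ y₁)) = 0 ∧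
  br (br y₁ y₁) (br (br y₁ y₁) (br (br y₁ y₁) (br y₁ y₂))) = 0

/-- The five relations of the positive part. -/
def PosRel (L : Type) [AddCommGroup L] [Module ℂ L] [LieSuperalgebra L] (y₁ y₂ : L) : Prop :=
  PosHom L y₁ y₂ ∧ posFour y₁ y₂ = (64 : ℂ) • y₁ ∧ posFive y₁ y₂ = (-96 : ℂ) • y₂

/-- The three homogeneous relations of the negative part. -/
def NegHom (L : Type) [AddCommGroup L] [Module ℂ L] [LieSuperalgebra L] (y₁ y₂ : L) : Prop :=
  br y₂ (br y₂ (br y₂ y₁)) = 0 ∧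
  br (br y₁ y₂) (br y₁ y₂) - (2 : ℂ) • br y₂ (br y₂ (br y₁ y₁)) = 0 ∧
  br (br y₁ y₁) (br (br y₁ y₁) (br y₁ y₂)) = 0

/-- The five relations of the negative part. -/
def NegRel (L : Type) [AddCommGroup L] [Module ℂ L] [LieSuperalgebra L] (y₁ y₂ : L) : Prop :=
  NegHom L y₁ y₂ ∧ negFour y₁ y₂ = (-64 : ℂ) • y₁ ∧ negFive y₁ y₂ = (-64 : ℂ) • y₂

end LieSuperalgebra

/-! Write `A = ad Y₁`, `B = ad Y₂`. Give each root vector of the half loop algebra a height, so that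
`A` raises it by 1 and `B` lowers it by 3 (positive part) or 2 (negative part), while `B` alone
moves one step in the `t`-degree. Each pair of a height and a `t`-degree carries at most one vector.
The half loop algebra is thus a succession of blocks of 17 vectors, one block for each period
`t^{±3}`, and `A` and `B` send each vector to a multiple of another one.

The core of the proof is that relations 1–3 force the same table in every Lie superalgebra `M`: if
two elements satisfy them, then certain words in `A` and `B` give vectors of `M` on which `A` and
`B` act with the same coefficients (`exists_pos_table`, `exists_neg_table`). These vectors may well
be dependent or zero in `M`; only the table matters. Some arrows of the table hold by the definition
of the vectors. Almost all others come by induction over the blocks: since `ad` is a representation,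
each relation is an identity between words in `A` and `B` (`pos_op_two`, `neg_op_two` and their
companions), and evaluating it at a vector already understood yields the next arrow.

One arrow in each block is not obtained that way. It ends in height 0, an imaginary degree, where
two arrows have to give proportional vectors. There one uses an even element `l` of height 0 in the
subalgebra generated by `Y₁` and `Y₂`. Its adjoint action carries vectors `V j` of height 1 and `U
k` of height -1 along the loop. As `l` commutes with the height 0 vectors found so far, the bracket
`[V j, U k]` is affine in `j` for fixed `j + k` (`br_shift`). Comparing the two extreme values of
`j` gives the missing proportionality, multiplied by `3m + 2` or `3m + 4`, which is never zero
(`PosSeq.B_b3_of`, `NegSeq.B_a2_succ`).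

The table then gives the presentation without any count of dimensions. In the half loop algebra the
vectors `u tᵏ` are a basis with this table, so there is a linear map to `M` that respects it. By the
Jacobi identity the elements whose adjoint action is respected are closed under `A` and `B`, and
everything is reached from the two generators; hence the map is a homomorphism (`map_br_of_tables`),
and it is unique (`Hom.eq_of_tables`). For `𝔡(ε)` itself, relations 4 and 5 say that the two
generators of the second block have the same image as those of the first. This equality spreads to
all blocks, and the map descends to `t = 1` (`RootBasis.isPresentedBy_base`).

What remains is explicit: 17 vectors of `𝔡(ε)` in coordinates, with all brackets checked modulo `ε²
+ ε + 1 = 0`. -/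

namespace LieSuperalgebra

/-! ### Sign-free forms of the axioms, and brackets of shifted sequences. -/

section Basic

variable {M : Type*} [AddCommGroup M] [Module ℂ M] [LieSuperalgebra M]

theorem br_br_of_odd {x y : M} (hx : x ∈ part (L := M) 1) (hy : y ∈ part (L := M) 1) (z : M) :
    br (br x y) z = br x (br y z) + br y (br x z) := by
  have h := br_jacobi z hx hy
  simp only [superSign, and_self, if_true] at h
  rw [h]; module

theorem br_br_of_even_left {x y : M} {j : ZMod 2} (hx : x ∈ part (L := M) 0)
    (hy : y ∈ part (L := M) j) (z : M) :
    br (br x y) z = br x (br y z) - br y (br x z) := by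
  have h := br_jacobi z hx hy
  simp only [superSign, zero_ne_one, false_and, if_false] at h
  rw [h]; module

theorem br_br_of_even_right {x y : M} {j : ZMod 2} (hx : x ∈ part (L := M) j)
    (hy : y ∈ part (L := M) 0) (z : M) :
    br (br x y) z = br x (br y z) - br y (br x z) := by
  have h := br_jacobi z hx hy
  simp only [superSign, zero_ne_one, and_false, if_false] at h
  rw [h]; module

theorem br_comm_of_odd {x y : M} (hx : x ∈ part (L := M) 1) (hy : y ∈ part (L := M) 1) :
    br x y = br y x := by
  have h := br_skew hx hy
  simpa [superSign] using h

theorem br_comm_of_even_left {x y : M} {j : ZMod 2} (hx : x ∈ part (L := M) 0)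
    (hy : y ∈ part (L := M) j) : br x y = -br y x := by
  have h := br_skew hx hy
  simpa [superSign] using h

theorem br_comm_of_even_right {x y : M} {j : ZMod 2} (hx : x ∈ part (L := M) j)
    (hy : y ∈ part (L := M) 0) : br x y = -br y x := by
  have h := br_skew hx hy
  simpa [superSign] using h

theorem br_self_of_even {x : M} (hx : x ∈ part (L := M) 0) : br x x = 0 := by
  have h := br_comm_of_even_left hx hx
  have h2 : (2 : ℂ) • br x x = 0 := by linear_combination (norm := module) h
  exact (smul_eq_zero.1 h2).resolve_left (by norm_num)

theorem br_mem_of_odd {x y : M} (hx : x ∈ part (L := M) 1) (hy : y ∈ part (L := M) 1) :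
    br x y ∈ part (L := M) 0 := br_mem hx hy

theorem br_mem_of_even_odd {x y : M} (hx : x ∈ part (L := M) 0) (hy : y ∈ part (L := M) 1) :
    br x y ∈ part (L := M) 1 := br_mem hx hy

theorem br_mem_of_odd_even {x y : M} (hx : x ∈ part (L := M) 1) (hy : y ∈ part (L := M) 0) :
    br x y ∈ part (L := M) 1 := br_mem hx hy

theorem br_mem_of_even {x y : M} (hx : x ∈ part (L := M) 0) (hy : y ∈ part (L := M) 0) :
    br x y ∈ part (L := M) 0 := br_mem hx hy

/-- The Jacobi identity for three copies of an odd element reads `3[x, [x, x]] = 0`. -/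
theorem br_br_self_of_odd {x : M} (hx : x ∈ part (L := M) 1) : br x (br x x) = 0 := by
  have h := br_br_of_odd hx hx x
  have h' := br_comm_of_even_left (br_mem_of_odd hx hx) hx
  have h3 : (3 : ℂ) • br x (br x x) = 0 := by linear_combination (norm := module) h' - h
  exact (smul_eq_zero.1 h3).resolve_left (by norm_num)

/-- If `l` shifts the odd sequences `V` and `-U` and kills the brackets `[V 0, U b]`, `b < n`,
then the bracket `[V j, U k]` is affine in `j` for `j + k = n + 1`. -/
theorem br_shift {l : M} (hl : l ∈ part (L := M) 0) {V U : ℕ → M}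
    (hV : ∀ j, V j ∈ part (L := M) 1) (hVs : ∀ j, br l (V j) = V (j + 1))
    (hUs : ∀ k, br l (U k) = -U (k + 1)) (n : ℕ)
    (hker : ∀ b < n, br l (br (V 0) (U b)) = 0) (j k : ℕ) (hjk : j + k = n + 1) :
    br (V j) (U k) = br (V 0) (U (n + 1)) + (j : ℂ) • br l (br (V 0) (U n)) := by
  have step : ∀ j k, br (V (j + 1)) (U k) = br l (br (V j) (U k)) + br (V j) (U (k + 1)) := by
    intro j k
    rw [← hVs, br_br_of_even_left hl (hV j), hUs, map_neg, sub_neg_eq_add]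
  -- Up to total index `n` the correction terms are `l` applied to `[V 0, U b]` with `b < n`, so
  -- they vanish and the bracket depends on `j + k` only.
  have h1 : ∀ j k, j + k ≤ n → br (V j) (U k) = br (V 0) (U (j + k)) := by
    intro j
    induction j with
    | zero => intro k _; rw [zero_add]
    | succ j ih =>
      intro k hk
      rw [step, ih k (by lia), ih (k + 1) (by lia), hker _ (by lia), zero_add,
        show j + (k + 1) = j + 1 + k by lia]
  -- One index further, each step adds the same element `[l, [V 0, U n]]`, which is not assumed to
  -- be zero.
  have h2 : ∀ j k, j + k = n + 1 →
      br (V j) (U k) = br (V 0) (U (n + 1)) + (j : ℂ) • br l (br (V 0) (U n)) := by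
    intro j
    induction j with
    | zero => intro k hk; rw [← hk]; simp
    | succ j ih =>
      intro k hk
      rw [step, h1 j k (by lia), ih (k + 1) (by lia), show j + k = n by lia]
      push_cast; module
  exact h2 j k hjk

end Basic

end LieSuperalgebra

/-! ### The defining relations as operator identities. -/

namespace LieSuperalgebra

section Pos

variable {M : Type*} [AddCommGroup M] [Module ℂ M] [LieSuperalgebra M] {y₁ y₂ : M}

theorem pos_op_one (h2 : y₂ ∈ part (L := M) 1) (h : br y₂ y₂ = 0) (x : M) :
    br y₂ (br y₂ x) = 0 := by
  have e := br_br_of_odd h2 h2 x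
  rw [h, map_zero, LinearMap.zero_apply] at e
  have h2 : (2 : ℂ) • br y₂ (br y₂ x) = 0 := by linear_combination (norm := module) -e
  exact (smul_eq_zero.1 h2).resolve_left (by norm_num)

theorem br_br_self_of_odd_apply (h1 : y₁ ∈ part (L := M) 1) (x : M) :
    br (br y₁ y₁) x = (2 : ℂ) • br y₁ (br y₁ x) := by
  rw [br_br_of_odd h1 h1]; module

/-- A relation in `M` speaks only of the first block; its image under `ad` can be evaluated at
vectors of every block. Words containing `B²` have been dropped by relation 1. -/
theorem pos_op_two (h1 : y₁ ∈ part (L := M) 1) (h2 : y₂ ∈ part (L := M) 1)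
    (h : br y₂ y₂ = 0) (h' : br (br y₁ y₂) (br y₂ (br y₁ y₁)) = 0) (x : M) :
    br y₂ (br y₁ (br y₂ (br y₁ (br y₁ x)))) - br y₂ (br y₁ (br y₁ (br y₂ (br y₁ x))))
      + br y₁ (br y₁ (br y₂ (br y₁ (br y₂ x)))) - br y₁ (br y₂ (br y₁ (br y₁ (br y₂ x))))
      - (2 : ℂ) • br y₂ (br y₁ (br y₁ (br y₁ (br y₂ x)))) = 0 := by
  have h11 := br_mem_of_odd h1 h1
  have e := br_br_of_even_left (br_mem_of_odd h1 h2) (br_mem_of_odd_even h2 h11) x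
  rw [h', map_zero, LinearMap.zero_apply] at e
  simp only [br_br_of_even_right h2 h11, br_br_of_odd h1 h2, br_br_self_of_odd_apply h1,
    map_add, map_sub, map_smul, pos_op_one h2 h, map_zero, smul_zero] at e
  linear_combination (norm := module) (-1 / 2 : ℂ) • e

/-- Since `ad [y₁, y₁] = 2A²` and `ad [y₁, y₂] = AB + BA`, this is the threefold commutator of `2A²`
with `AB + BA`: binomial coefficients 1, -3, 3, -1 and an overall factor 8. -/
theorem pos_op_three (h1 : y₁ ∈ part (L := M) 1) (h2 : y₂ ∈ part (L := M) 1)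
    (h : br (br y₁ y₁) (br (br y₁ y₁) (br (br y₁ y₁) (br y₁ y₂))) = 0) (x : M) :
    (br y₁)^[7] (br y₂ x) + (br y₁)^[6] (br y₂ (br y₁ x))
      - (3 : ℂ) • (br y₁)^[5] (br y₂ (br y₁ (br y₁ x)))
      - (3 : ℂ) • (br y₁)^[4] (br y₂ ((br y₁)^[3] x))
      + (3 : ℂ) • (br y₁)^[3] (br y₂ ((br y₁)^[4] x))
      + (3 : ℂ) • (br y₁)^[2] (br y₂ ((br y₁)^[5] x))
      - br y₁ (br y₂ ((br y₁)^[6] x)) - br y₂ ((br y₁)^[7] x) = 0 := by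
  have h11 := br_mem_of_odd h1 h1
  have h12 := br_mem_of_odd h1 h2
  have e := br_br_of_even_left h11 (br_mem_of_even h11 (br_mem_of_even h11 h12)) x
  rw [h, map_zero, LinearMap.zero_apply] at e
  simp only [br_br_of_even_left h11 (br_mem_of_even h11 h12), br_br_of_even_left h11 h12] at e
  simp only [br_br_of_odd h1 h2, br_br_self_of_odd_apply h1, map_add, map_sub, map_smul] at e
  simp only [Function.iterate_succ, Function.iterate_zero, Function.comp_apply, id]
  linear_combination (norm := module) (-1 / 8 : ℂ) • e

end Pos

section Neg

variable {M : Type*} [AddCommGroup M] [Module ℂ M] [LieSuperalgebra M] {y₁ y₂ : M}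

/-- As `y₂` is even here, relation 1 is a threefold ordinary commutator of `B` with `A`. -/
theorem neg_op_one (h1 : y₁ ∈ part (L := M) 1) (h2 : y₂ ∈ part (L := M) 0)
    (h : br y₂ (br y₂ (br y₂ y₁)) = 0) (x : M) :
    (br y₂)^[3] (br y₁ x) - (3 : ℂ) • (br y₂)^[2] (br y₁ (br y₂ x))
      + (3 : ℂ) • br y₂ (br y₁ ((br y₂)^[2] x)) - br y₁ ((br y₂)^[3] x) = 0 := by
  have h21 := br_mem_of_even_odd h2 h1
  have e := br_br_of_even_left h2 (br_mem_of_even_odd h2 h21) x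
  rw [h, map_zero, LinearMap.zero_apply] at e
  simp only [br_br_of_even_left h2 h21, br_br_of_even_left h2 h1, map_sub] at e
  simp only [Function.iterate_succ, Function.iterate_zero, Function.comp_apply, id]
  linear_combination (norm := module) -e

theorem neg_op_two (h1 : y₁ ∈ part (L := M) 1) (h2 : y₂ ∈ part (L := M) 0)
    (h : br (br y₁ y₂) (br y₁ y₂) - (2 : ℂ) • br y₂ (br y₂ (br y₁ y₁)) = 0) (x : M) :
    br y₁ (br y₂ (br y₁ (br y₂ x))) - br y₁ (br y₂ (br y₂ (br y₁ x)))
      + (3 : ℂ) • br y₂ (br y₁ (br y₁ (br y₂ x))) + br y₂ (br y₁ (br y₂ (br y₁ x)))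
      - (2 : ℂ) • br y₂ (br y₂ (br y₁ (br y₁ x)))
      - (2 : ℂ) • br y₁ (br y₁ (br y₂ (br y₂ x))) = 0 := by
  have h11 := br_mem_of_odd h1 h1
  have h12 := br_mem_of_odd_even h1 h2
  have e : br (br (br y₁ y₂) (br y₁ y₂) - (2 : ℂ) • br y₂ (br y₂ (br y₁ y₁))) x = 0 := by
    rw [h, map_zero, LinearMap.zero_apply]
  simp only [map_sub, map_smul, LinearMap.sub_apply, LinearMap.smul_apply,
    br_br_of_odd h12 h12, br_br_of_even_left h2 (br_mem_of_even h2 h11),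
    br_br_of_even_left h2 h11] at e
  simp only [map_sub, map_smul, br_br_of_even_right h1 h2, br_br_self_of_odd_apply h1] at e
  linear_combination (norm := module) (1 / 2 : ℂ) • e

/-- The double commutator of `2A²` with `ad [y₁, y₂] = AB - BA`, up to the factor 4. -/
theorem neg_op_three (h1 : y₁ ∈ part (L := M) 1) (h2 : y₂ ∈ part (L := M) 0)
    (h : br (br y₁ y₁) (br (br y₁ y₁) (br y₁ y₂)) = 0) (x : M) :
    (br y₁)^[5] (br y₂ x) - (br y₁)^[4] (br y₂ (br y₁ x))
      - (2 : ℂ) • (br y₁)^[3] (br y₂ ((br y₁)^[2] x))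
      + (2 : ℂ) • (br y₁)^[2] (br y₂ ((br y₁)^[3] x))
      + br y₁ (br y₂ ((br y₁)^[4] x)) - br y₂ ((br y₁)^[5] x) = 0 := by
  have h11 := br_mem_of_odd h1 h1
  have h12 := br_mem_of_odd_even h1 h2
  have e := br_br_of_even_left h11 (br_mem_of_even_odd h11 h12) x
  rw [h, map_zero, LinearMap.zero_apply] at e
  simp only [br_br_of_even_left h11 h12] at e
  simp only [br_br_of_even_right h1 h2, br_br_self_of_odd_apply h1, map_sub, map_smul] at e
  simp only [Function.iterate_succ, Function.iterate_zero, Function.comp_apply, id]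
  linear_combination (norm := module) (-1 / 4 : ℂ) • e

end Neg

end LieSuperalgebra

/-! ### Positive part: passing through one block. -/

namespace LieSuperalgebra

section Pos

variable {M : Type*} [AddCommGroup M] [Module ℂ M]

/-- Root vectors for the positive part, in blocks of `17`: `aᵢ`, `bᵢ`, `cᵢ`, `dᵢ` (with `m` for a
minus sign in the index) stand for height `i` and degrees `3m`, `3m + 1`, `3m + 2`, `3m + 3` in `t`;
`A` and `B` stand for the adjoint actions of the two generators. -/
structure PosSeq (A B : Module.End ℂ M) where
  (a1 a2 bm3 bm2 bm1 b0 b1 b2 b3 cm2 cm1 c0 c1 c2 dm2 dm1 d0 : ℕ → M)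
  A_a1 : ∀ m, A (a1 m) = a2 m
  B_a1 : ∀ m, B (a1 m) = bm2 m
  A_bm2 : ∀ m, A (bm2 m) = bm1 m
  A_bm1 : ∀ m, A (bm1 m) = b0 m
  A_b0 : ∀ m, A (b0 m) = b1 m
  A_b1 : ∀ m, A (b1 m) = b2 m
  A_b2 : ∀ m, A (b2 m) = b3 m
  B_b1 : ∀ m, B (b1 m) = (-2 : ℂ) • cm2 m
  A_cm2 : ∀ m, A (cm2 m) = cm1 m
  A_cm1 : ∀ m, A (cm1 m) = c0 m
  A_c0 : ∀ m, A (c0 m) = c1 m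
  A_c1 : ∀ m, A (c1 m) = c2 m
  B_c1 : ∀ m, B (c1 m) = (2 : ℂ) • dm2 m
  A_dm2 : ∀ m, A (dm2 m) = dm1 m
  A_dm1 : ∀ m, A (dm1 m) = d0 m
  A_d0 : ∀ m, A (d0 m) = a1 (m + 1)
  B_d0 : ∀ m, B (d0 m) = (-3 : ℂ) • bm3 (m + 1)

namespace PosSeq

variable {A B : Module.End ℂ M}

/-- The first relations in a block. -/
structure Entry (S : PosSeq A B) (m : ℕ) : Prop where
  A_a2 : A (S.a2 m) = 0
  A_bm3 : A (S.bm3 m) = S.bm2 m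
  B_a2 : B (S.a2 m) = (-2 : ℂ) • S.bm1 m
  A_b3 : A (S.b3 m) = 0
  B_bm3 : B (S.bm3 m) = 0
  B_b0 : B (S.b0 m) = 0
  B_bm2 : B (S.bm2 m) = 0
  B_bm1 : B (S.bm1 m) = 0
  B_b2 : B (S.b2 m) = S.cm1 m

/-- The remaining relations in a block. -/
structure Full (S : PosSeq A B) (m : ℕ) : Prop extends S.Entry m where
  B_b3 : B (S.b3 m) = (-3 : ℂ) • S.c0 m
  A_c2 : A (S.c2 m) = 0
  B_cm2 : B (S.cm2 m) = 0
  B_cm1 : B (S.cm1 m) = 0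
  B_c0 : B (S.c0 m) = 0
  B_c2 : B (S.c2 m) = (2 : ℂ) • S.dm1 m
  B_dm2 : B (S.dm2 m) = 0
  B_dm1 : B (S.dm1 m) = 0

theorem eq_of_smul {x y : M} {c : ℂ} (hc : c ≠ 0) (h : c • x - c • y = 0) : x = y := by
  rw [← smul_sub] at h
  exact sub_eq_zero.1 ((smul_eq_zero.1 h).resolve_left hc)

theorem eq_zero_of_smul {x : M} {c : ℂ} (hc : c ≠ 0) (h : c • x = 0) : x = 0 :=
  (smul_eq_zero.1 h).resolve_left hc

variable (S : PosSeq A B) (R1 : ∀ x, B (B x) = 0)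
  (R2 : ∀ x, B (A (B (A (A x)))) - B (A (A (B (A x)))) + A (A (B (A (B x))))
    - A (B (A (A (B x)))) - (2 : ℂ) • B (A (A (A (B x)))) = 0)
  (R3 : ∀ x, A^[7] (B x) + A^[6] (B (A x)) - (3 : ℂ) • A^[5] (B (A (A x)))
      - (3 : ℂ) • A^[4] (B (A^[3] x)) + (3 : ℂ) • A^[3] (B (A^[4] x))
      + (3 : ℂ) • A^[2] (B (A^[5] x)) - A (B (A^[6] x)) - B (A^[7] x) = 0)

include R1 R2

/-- The common last step for block 0 and for the induction. A vector in the image of `B` is killed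
by `B`, because `B² = 0`; the arrow from `b2` is the operator form of relation 2 at `a2`. -/
theorem entry_of (m : ℕ) (A_a2 : A (S.a2 m) = 0) (A_bm3 : A (S.bm3 m) = S.bm2 m)
    (B_a2 : B (S.a2 m) = (-2 : ℂ) • S.bm1 m) (A_b3 : A (S.b3 m) = 0) (B_bm3 : B (S.bm3 m) = 0)
    (B_b0 : B (S.b0 m) = 0) : S.Entry m := by
  have B_bm2 : B (S.bm2 m) = 0 := by rw [← S.B_a1, R1]
  have B_bm1 : B (S.bm1 m) = 0 := by
    have h := R1 (S.a2 m)
    rw [B_a2, map_smul] at h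
    exact eq_zero_of_smul (by norm_num) h
  refine ⟨A_a2, A_bm3, B_a2, A_b3, B_bm3, B_b0, B_bm2, B_bm1, ?_⟩
  have h := R2 (S.a2 m)
  simp only [A_a2, B_a2, map_zero, map_smul, S.A_bm1, S.A_b0, S.A_b1, B_b0, S.B_b1,
    S.A_cm2] at h
  refine eq_of_smul (c := 4) (by norm_num) ?_
  linear_combination (norm := module) h

include R3

/-- Granted the height 0 arrow from `b3`, the rest of the block is automatic: relation 3 at `bm1`
ends the `c`-string, relation 2 at `b2` gives the arrow from `c2`, and `B² = 0` does the others. -/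
theorem full_of (m : ℕ) (h : S.Entry m) (B_b3 : B (S.b3 m) = (-3 : ℂ) • S.c0 m) : S.Full m := by
  have A_c2 : A (S.c2 m) = 0 := by
    have e := R3 (S.bm1 m)
    simp only [Function.iterate_succ, Function.iterate_zero, Function.comp_apply, id, S.A_bm1,
      S.A_b0, S.A_b1, S.A_b2, h.A_b3, h.B_b0, h.B_bm1, h.B_b2, S.B_b1, B_b3, map_zero, map_smul,
      S.A_cm2, S.A_cm1, S.A_c0, S.A_c1] at e
    refine eq_zero_of_smul (c := -6) (by norm_num) ?_
    linear_combination (norm := module) e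
  have B_cm2 : B (S.cm2 m) = 0 := by
    have e := R1 (S.b1 m)
    rw [S.B_b1, map_smul] at e
    exact eq_zero_of_smul (by norm_num) e
  have B_cm1 : B (S.cm1 m) = 0 := by rw [← h.B_b2, R1]
  have B_c0 : B (S.c0 m) = 0 := by
    have e := R1 (S.b3 m)
    rw [B_b3, map_smul] at e
    exact eq_zero_of_smul (by norm_num) e
  have B_c2 : B (S.c2 m) = (2 : ℂ) • S.dm1 m := by
    have e := R2 (S.b2 m)
    simp only [S.A_b2, h.A_b3, h.B_b2, B_b3, map_zero, map_smul, S.A_cm1, S.A_c0, S.A_c1, B_c0,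
      S.B_c1, S.A_dm2] at e
    linear_combination (norm := module) e
  refine ⟨h, B_b3, A_c2, B_cm2, B_cm1, B_c0, B_c2, ?_, ?_⟩
  · have e := R1 (S.c1 m)
    rw [S.B_c1, map_smul] at e
    exact eq_zero_of_smul (by norm_num) e
  · have e := R1 (S.c2 m)
    rw [B_c2, map_smul] at e
    exact eq_zero_of_smul (by norm_num) e

/-- Words that start in the second half of block `m` end in block `m + 1`, because `A` and `B` both
leave the block at `d0`. Relations 2 and 3 evaluated there give the first arrows of the next block.
-/
theorem entry_succ (m : ℕ) (h : S.Full m) : S.Entry (m + 1) := by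
  have A_a2 : A (S.a2 (m + 1)) = 0 := by
    have e := R3 (S.cm1 m)
    simp only [Function.iterate_succ, Function.iterate_zero, Function.comp_apply, id, S.A_cm1,
      S.A_c0, S.A_c1, h.A_c2, h.B_cm1, h.B_c0, S.B_c1, h.B_c2, map_zero, map_smul,
      S.A_dm2, S.A_dm1, S.A_d0, S.A_a1] at e
    refine eq_zero_of_smul (c := -12) (by norm_num) ?_
    linear_combination (norm := module) e
  have A_bm3 : A (S.bm3 (m + 1)) = S.bm2 (m + 1) := by
    have e := R2 (S.c1 m)
    simp only [S.A_c1, h.A_c2, S.B_c1, h.B_c2, map_zero, map_smul,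
      S.A_dm2, S.A_dm1, S.A_d0, h.B_dm1, S.B_d0, S.B_a1] at e
    refine eq_of_smul (c := 6) (by norm_num) ?_
    linear_combination (norm := module) e
  have B_a2 : B (S.a2 (m + 1)) = (-2 : ℂ) • S.bm1 (m + 1) := by
    have e := R2 (S.c2 m)
    simp only [h.A_c2, h.B_c2, map_zero, map_smul, A_bm3,
      S.A_dm1, S.A_d0, S.B_d0, S.B_a1, S.A_bm2, S.A_a1] at e
    refine eq_of_smul (c := -4) (by norm_num) ?_
    linear_combination (norm := module) e
  have B_bm2 : B (S.bm2 (m + 1)) = 0 := by rw [← S.B_a1, R1]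
  have B_bm1 : B (S.bm1 (m + 1)) = 0 := by
    have e := R1 (S.a2 (m + 1))
    rw [B_a2, map_smul] at e
    exact eq_zero_of_smul (by norm_num) e
  refine S.entry_of R1 R2 _ A_a2 A_bm3 B_a2 ?_ ?_ ?_
  · have e := R3 (S.d0 m)
    simp only [Function.iterate_succ, Function.iterate_zero, Function.comp_apply, id, S.A_d0,
      S.A_a1, A_a2, S.B_d0, S.B_a1, B_a2, map_zero, map_smul, A_bm3,
      S.A_bm2, S.A_bm1, S.A_b0, S.A_b1, S.A_b2] at e
    refine eq_zero_of_smul (c := 4) (by norm_num) ?_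
    linear_combination (norm := module) e
  · have e := R1 (S.d0 m)
    rw [S.B_d0, map_smul] at e
    exact eq_zero_of_smul (by norm_num) e
  · have e := R2 (S.d0 m)
    simp only [S.A_d0, S.A_a1, S.B_d0, S.B_a1, B_a2, map_zero, map_smul, A_bm3,
      S.A_bm2, S.A_bm1, B_bm2, B_bm1] at e
    refine eq_zero_of_smul (c := 3) (by norm_num) ?_
    linear_combination (norm := module) e

end PosSeq

variable [LieSuperalgebra M] {y₁ y₂ : M}

/-- The element acting here is the height 0 vector `b0` of block 0; its action as a word in `A` and
`B` lets it be computed from the table. -/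
theorem pos_op_shift (h1 : y₁ ∈ part (L := M) 1) (h2 : y₂ ∈ part (L := M) 1) (x : M) :
    br (br y₁ (br y₁ (br y₁ y₂))) x = br y₁ (br y₁ (br y₁ (br y₂ x)))
      - br y₁ (br y₂ (br y₁ (br y₁ x))) + br y₁ (br y₁ (br y₂ (br y₁ x)))
      - br y₂ (br y₁ (br y₁ (br y₁ x))) := by
  have h12 := br_mem_of_odd h1 h2
  rw [br_br_of_odd h1 (br_mem_of_odd_even h1 h12)]
  simp only [br_br_of_even_right h1 h12, br_br_of_odd h1 h2, map_add, map_sub]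
  module

end Pos

end LieSuperalgebra

/-! ### Positive part: induction over the blocks. -/

namespace LieSuperalgebra

section Pos

variable {M : Type} [AddCommGroup M] [Module ℂ M] [LieSuperalgebra M] {y₁ y₂ : M}

/-- The first root vectors of the blocks. -/
noncomputable def posBase (A B : Module.End ℂ M) (y : M) : ℕ → M
  | 0 => y
  | m + 1 => A (A (A ((1 / 2 : ℂ) • B (A (A (A ((-1 / 2 : ℂ) • B (A (A (A (B
      (posBase A B y m))))))))))))

/-- The root vectors generated by `y₁` and `y₂`. -/
noncomputable def posSeq (y₁ y₂ : M) : PosSeq (br y₁) (br y₂) :=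
  let A : Module.End ℂ M := br y₁
  let B : Module.End ℂ M := br y₂
  let a := posBase A B y₁
  let b := fun m => A (A (A (B (a m))))
  -- With the factor -1/2 here and 1/2 in `d`, the same words in `𝔡(ε)` lead from `Y₁` back to `Y₁`
  -- after one block.
  let c := fun m => (-1 / 2 : ℂ) • B (b m)
  let d := fun m => (1 / 2 : ℂ) • B (A (A (A (c m))))
  { a1 := a
    a2 := fun m => A (a m)
    -- In block 0 this vector is the second generator; in later blocks it is reached from `d0` of
    -- the block before.
    bm3 := fun m => Nat.casesOn m y₂ fun m => (-1 / 3 : ℂ) • B (A (A (d m)))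
    bm2 := fun m => B (a m)
    bm1 := fun m => A (B (a m))
    b0 := fun m => A (A (B (a m)))
    b1 := b
    b2 := fun m => A (b m)
    b3 := fun m => A (A (b m))
    cm2 := c
    cm1 := fun m => A (c m)
    c0 := fun m => A (A (c m))
    c1 := fun m => A (A (A (c m)))
    c2 := fun m => A (A (A (A (c m))))
    dm2 := d
    dm1 := fun m => A (d m)
    d0 := fun m => A (A (d m))
    A_a1 := fun _ => rfl
    B_a1 := fun _ => rfl
    A_bm2 := fun _ => rfl
    A_bm1 := fun _ => rfl
    A_b0 := fun _ => rfl
    A_b1 := fun _ => rfl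
    A_b2 := fun _ => rfl
    B_b1 := fun m => by simp only [c, smul_smul]; norm_num; rfl
    A_cm2 := fun _ => rfl
    A_cm1 := fun _ => rfl
    A_c0 := fun _ => rfl
    A_c1 := fun _ => rfl
    B_c1 := fun m => by simp only [d, smul_smul]; norm_num; rfl
    A_dm2 := fun _ => rfl
    A_dm1 := fun _ => rfl
    A_d0 := fun _ => rfl
    B_d0 := fun m => by simp only [smul_smul]; norm_num; rfl }

namespace PosSeq

variable (S : PosSeq (M := M) (br y₁) (br y₂))

/-- In block 0 the relations are used as they stand: up to nonzero factors relation 2 says `B b0 =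
0`, and relation 3 says that the `b`-string ends at `b3`. -/
theorem entry_zero (h1 : y₁ ∈ part (L := M) 1) (h2 : y₂ ∈ part (L := M) 1) (h : PosHom M y₁ y₂)
    (hy1 : S.a1 0 = y₁) (hy2 : S.bm3 0 = y₂) : S.Entry 0 := by
  obtain ⟨r1, r2, r3⟩ := h
  have h11 := br_mem_of_odd h1 h1
  have h12 := br_mem_of_odd h1 h2
  have R1 := pos_op_one h2 r1
  have R2 := pos_op_two h1 h2 r1 r2
  have e1 : S.a2 0 = br y₁ y₁ := by rw [← S.A_a1, hy1]
  have e2 : S.bm2 0 = br y₁ y₂ := by rw [← S.B_a1, hy1, br_comm_of_odd h2 h1]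
  have B_a2 : br y₂ (S.a2 0) = (-2 : ℂ) • S.bm1 0 := by
    rw [← S.A_bm2, e2, e1, br_comm_of_even_right h2 h11, br_br_self_of_odd_apply h1]
    module
  have B_bm1 : br y₂ (S.bm1 0) = 0 := by
    have e := R1 (S.a2 0)
    rw [B_a2, map_smul] at e
    exact eq_zero_of_smul (by norm_num) e
  refine S.entry_of R1 R2 0 ?_ ?_ B_a2 ?_ ?_ ?_
  · rw [e1, br_br_self_of_odd h1]
  · rw [hy2, e2]
  · rw [← e2] at r3
    simp only [br_br_self_of_odd_apply h1, S.A_bm2, S.A_bm1, S.A_b0, S.A_b1, S.A_b2, map_smul,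
      smul_smul] at r3
    exact eq_zero_of_smul (by norm_num) r3
  · rw [hy2, r1]
  · rw [← e1, B_a2, br_br_of_odd h1 h2] at r2
    simp only [map_smul, B_bm1, S.A_bm1, map_zero, smul_zero, zero_add] at r2
    exact eq_zero_of_smul (by norm_num) r2

/-- The bracket relation in an imaginary degree. -/
theorem B_b3_of (h1 : y₁ ∈ part (L := M) 1) (h2 : y₂ ∈ part (L := M) 1)
    (hy1 : S.a1 0 = y₁) (hy2 : S.bm3 0 = y₂) (m : ℕ) (hfull : ∀ k < m, S.Full k)
    (hent : ∀ k ≤ m, S.Entry k) :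
    br y₂ (S.b3 m) = (-3 : ℂ) • S.c0 m := by
  have h11 := br_mem_of_odd h1 h1
  have h12 := br_mem_of_odd h1 h2
  have e0 := hent 0 (Nat.zero_le _)
  have eb : S.bm1 0 = br y₁ (br y₁ y₂) := by
    rw [← S.A_bm2, ← e0.A_bm3, hy2]
  have hbm : S.bm1 0 ∈ part (L := M) 1 := by
    rw [eb]; exact br_mem_of_odd_even h1 h12
  -- The element `l` has height 0 and `t`-degree 1. Its powers move `y₁` through the vectors `a1`,
  -- `b1`, `c1` of height 1, and `bm1` through those of height -1.
  set l := br y₁ (br y₁ (br y₁ y₂)) with hl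
  have hl0 : l ∈ part (L := M) 0 := by
    rw [hl, ← eb]; exact br_mem_of_odd h1 hbm
  have L : ∀ x, br l x = _ := pos_op_shift h1 h2
  set V : ℕ → M := fun j => (br l)^[j] y₁ with hV
  set U : ℕ → M := fun k => (-br l : Module.End ℂ M)^[k] (S.bm1 0) with hU
  have hVs : ∀ j, br l (V j) = V (j + 1) := fun j => (Function.iterate_succ_apply' _ _ _).symm
  have hUs : ∀ k, br l (U k) = -U (k + 1) := fun k => by
    rw [hU]; simp only [Function.iterate_succ_apply']; simp
  have hVm : ∀ j, V j ∈ part (L := M) 1 := fun j => by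
    induction j with
    | zero => exact h1
    | succ j ih => rw [← hVs]; exact br_mem_of_even_odd hl0 ih
  have La : ∀ k ≤ m, br l (S.a1 k) = -S.b1 k := fun k hk => by
    have e := hent k hk
    rw [L]
    simp only [S.A_a1, S.B_a1, e.A_a2, e.B_a2, S.A_bm2, S.A_bm1, S.A_b0, map_smul, map_zero]
    module
  have Lb : ∀ k < m, br l (S.b1 k) = (2 : ℂ) • S.c1 k := fun k hk => by
    have e := hfull k hk
    rw [L]
    simp only [S.A_b1, S.A_b2, S.B_b1, e.A_b3, e.B_b2, e.B_b3, S.A_cm2, S.A_cm1, S.A_c0, map_smul,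
      map_zero]
    module
  have Lc : ∀ k < m, br l (S.c1 k) = (4 : ℂ) • S.a1 (k + 1) := fun k hk => by
    have e := hfull k hk
    rw [L]
    simp only [S.A_c1, S.B_c1, e.A_c2, e.B_c2, S.A_dm2, S.A_dm1, S.A_d0, map_smul,
      map_zero]
    module
  have Lbm : ∀ k ≤ m, br l (S.bm1 k) = S.cm1 k := fun k hk => by
    have e := hent k hk
    rw [L]
    simp only [S.A_bm1, S.A_b0, S.A_b1, e.B_bm1, e.B_b0, S.B_b1, S.A_cm2, e.B_b2, map_smul,
      map_zero]
    module
  have Lcm : ∀ k < m, br l (S.cm1 k) = (-4 : ℂ) • S.dm1 k := fun k hk => by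
    have e := hfull k hk
    rw [L]
    simp only [S.A_cm1, S.A_c0, S.A_c1, S.B_c1, e.B_cm1, e.B_c0, e.B_c2, S.A_dm2, map_smul,
      map_zero]
    module
  have Ldm : ∀ k < m, br l (S.dm1 k) = (-2 : ℂ) • S.bm1 (k + 1) := fun k hk => by
    have e := hfull k hk
    have e' := hent (k + 1) (by lia)
    rw [L]
    simp only [S.A_dm1, S.A_d0, S.A_a1, S.B_a1, S.B_d0, e.B_dm1, e'.B_a2, e'.A_bm3, S.A_bm2,
      map_smul, map_zero]
    module
  -- That `l` commutes with the height 0 vectors is available only for earlier blocks; for `k = m`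
  -- it would need the arrow that is being proved.
  have Lb0 : ∀ k < m, br l (S.b0 k) = 0 := fun k hk => by
    have e := hfull k hk
    rw [L]
    simp only [S.A_b0, S.A_b1, S.A_b2, S.B_b1, e.B_b0, e.B_b2, e.B_b3, S.A_cm2, S.A_cm1, map_smul,
      map_zero]
    module
  have Lc0 : ∀ k < m, br l (S.c0 k) = 0 := fun k hk => by
    have e := hfull k hk
    rw [L]
    simp only [S.A_c0, S.A_c1, S.B_c1, e.A_c2, e.B_c0, e.B_c2, S.A_dm2, S.A_dm1, map_smul,
      map_zero]
    module
  have Ld0 : ∀ k < m, br l (S.d0 k) = 0 := fun k hk => by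
    have e := hfull k hk
    have e' := hent (k + 1) (by lia)
    rw [L]
    simp only [S.A_d0, S.A_a1, S.B_a1, S.B_d0, e'.A_a2, e'.B_a2, e'.A_bm3, S.A_bm2, S.A_bm1,
      map_smul, map_zero]
    module
  -- Three steps cross a block, with factors -1, 2 and 4, so each block contributes -8.
  have V0 : ∀ k ≤ m, V (3 * k) = ((-8 : ℂ) ^ k) • S.a1 k := fun k hk => by
    induction k with
    | zero => simp [hV, hy1]
    | succ k ih =>
      rw [show 3 * (k + 1) = 3 * k + 1 + 1 + 1 by ring, ← hVs, ← hVs, ← hVs, ih (by lia)]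
      simp only [map_smul, map_neg, La k (by lia), Lb k (by lia), Lc k (by lia)]
      module
  -- The factors 1, -4, -2 of `l`, with a sign for each of the three steps, again give -8.
  have U0 : ∀ k ≤ m, U (3 * k) = ((-8 : ℂ) ^ k) • S.bm1 k := fun k hk => by
    have hUs' : ∀ k, U (k + 1) = -br l (U k) := fun k => by rw [hUs, neg_neg]
    induction k with
    | zero => simp [hU]
    | succ k ih =>
      rw [show 3 * (k + 1) = 3 * k + 1 + 1 + 1 by ring, hUs', hUs', hUs', ih (by lia)]
      simp only [map_smul, map_neg, Lbm k (by lia), Lcm k (by lia), Ldm k (by lia)]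
      module
  have U1 : ∀ k ≤ m, U (3 * k + 1) = (-(-8 : ℂ) ^ k) • S.cm1 k := fun k hk => by
    rw [← neg_neg (U (3 * k + 1)), ← hUs, U0 k hk, map_smul, Lbm k hk]; module
  have U2 : ∀ k < m, U (3 * k + 2) = (-4 * (-8 : ℂ) ^ k) • S.dm1 k := fun k hk => by
    rw [← neg_neg (U (3 * k + 2)), ← hUs, U1 k hk.le, map_smul, Lcm k hk]; module
  have hker : ∀ b < 3 * m, br l (br (V 0) (U b)) = 0 := by
    intro b hb
    obtain ⟨k, r, hr, rfl⟩ : ∃ k r, r < 3 ∧ b = 3 * k + r :=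
      ⟨b / 3, b % 3, Nat.mod_lt _ (by norm_num), (Nat.div_add_mod b 3).symm⟩
    change br l (br y₁ _) = 0
    interval_cases r
    · rw [add_zero, U0 k (by lia), map_smul, S.A_bm1, map_smul, Lb0 k (by lia), smul_zero]
    · rw [U1 k (by lia), map_smul, S.A_cm1, map_smul, Lc0 k (by lia), smul_zero]
    · rw [U2 k (by lia), map_smul, S.A_dm1, map_smul, Ld0 k (by lia), smul_zero]
  -- The extreme pair `j = 3m + 1`, `k = 0`. Expanding both sides by the table leaves only `B b3`
  -- and `c0`, and the identity becomes `(-8)^m (3m + 2) (B b3 + 3 c0) = 0`.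
  have key := br_shift hl0 hVm hVs hUs (3 * m) hker (3 * m + 1) 0 rfl
  rw [br_comm_of_odd (hVm _) (show U 0 ∈ _ from hbm), ← hVs, V0 m le_rfl, U0 m le_rfl,
    U1 m le_rfl, map_smul, La m le_rfl] at key
  have e := hent m le_rfl
  change br (S.bm1 0) _ = br y₁ _ + _ • br l (br y₁ _) at key
  rw [eb, br_br_of_even_right h1 h12] at key
  simp only [br_br_of_odd h1 h2, map_smul, map_neg, L, S.A_bm1, S.A_b0, S.A_b1, S.A_b2, S.B_b1,
    e.B_b0, e.B_b2, S.A_cm2, S.A_cm1, map_add, map_zero] at key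
  refine eq_of_smul (c := (-8 : ℂ) ^ m * (3 * m + 2)) (mul_ne_zero (pow_ne_zero _ (by norm_num))
    (by norm_cast)) ?_
  push_cast at key
  linear_combination (norm := module) key

/-- The induction has to be strong, because the height 0 arrow of block `m` uses the complete tables
of all earlier blocks. -/
theorem full (h1 : y₁ ∈ part (L := M) 1) (h2 : y₂ ∈ part (L := M) 1) (h : PosHom M y₁ y₂)
    (hy1 : S.a1 0 = y₁) (hy2 : S.bm3 0 = y₂) (m : ℕ) : S.Full m := by
  have R1 := pos_op_one h2 h.1
  have R2 := pos_op_two h1 h2 h.1 h.2.1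
  have R3 := pos_op_three h1 h2 h.2.2
  induction m using Nat.strong_induction_on with
  | _ m ih =>
    have hent : ∀ k ≤ m, S.Entry k := by
      intro k hk
      cases k with
      | zero => exact S.entry_zero h1 h2 h hy1 hy2
      | succ k => exact S.entry_succ R1 R2 R3 k (ih k (by lia))
    exact S.full_of R1 R2 R3 m (hent m le_rfl) (S.B_b3_of h1 h2 hy1 hy2 m ih hent)

/-- The root vectors of a block as a family. -/
def vec : Fin 17 → ℕ → M :=
  ![S.a1, S.a2, S.bm3, S.bm2, S.bm1, S.b0, S.b1, S.b2, S.b3, S.cm2, S.cm1, S.c0, S.c1, S.c2,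
    S.dm2, S.dm1, S.d0]

end PosSeq

end Pos

/-- The action of `y` on the vectors `x i m`: the vector `x i m` goes to a multiple of
`x (t i) m`, or of `x (t i) (m + 1)` if `i` is the last index. -/
def IsTable {M : Type*} [AddCommGroup M] [Module ℂ M] [LieSuperalgebra M] (c : Fin 17 → ℂ)
    (t : Fin 17 → Fin 17) (d : Fin 17 → ℕ) (y : M) (x : Fin 17 → ℕ → M) : Prop :=
  ∀ i m, br y (x i m) = c i • x (t i) (m + d i)

/-- Indices follow the order of `PosSeq.vec`. The zeros are at the ends `a2`, `b3`, `c2` of the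
`A`-strings; every other arrow of `A` is normalised to 1. -/
noncomputable def posCoef₁ : Fin 17 → ℂ := ![1, 0, 1, 1, 1, 1, 1, 1, 0, 1, 1, 1, 1, 0, 1, 1, 1]

noncomputable def posCoef₂ : Fin 17 → ℂ :=
  ![1, -2, 0, 0, 0, 0, -2, 1, -3, 0, 0, 0, 2, 2, 0, 0, -3]

/-- Strings are listed consecutively, so `A` goes to the next index. The sum wraps from 16 to 0,
which with `posShift` is the passage from `d0` to the next `a1`. -/
def posTo₁ : Fin 17 → Fin 17 := fun i => i + 1

/-- The entries 0 are fillers: the coefficient there is zero. -/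
def posTo₂ : Fin 17 → Fin 17 := ![3, 4, 0, 0, 0, 0, 9, 10, 11, 0, 0, 0, 14, 15, 0, 0, 2]

def posShift : Fin 17 → ℕ := fun i => if i = 16 then 1 else 0

/-- The outcome of the block induction, in the form used later: a model-independent table. Nothing
is claimed about independence of the vectors. -/
theorem exists_pos_table {M : Type} [AddCommGroup M] [Module ℂ M] [LieSuperalgebra M] {y₁ y₂ : M}
    (h1 : y₁ ∈ part (L := M) 1) (h2 : y₂ ∈ part (L := M) 1) (h : PosHom M y₁ y₂) :
    ∃ x : Fin 17 → ℕ → M, x 0 0 = y₁ ∧ x 2 0 = y₂ ∧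
      IsTable posCoef₁ posTo₁ posShift y₁ x ∧ IsTable posCoef₂ posTo₂ posShift y₂ x := by
  set S := posSeq y₁ y₂
  have hf := S.full h1 h2 h rfl rfl
  refine ⟨S.vec, rfl, rfl, fun i m => ?_, fun i m => ?_⟩
  · have f := hf m
    fin_cases i <;>
      simp [PosSeq.vec, posCoef₁, posTo₁, posShift, f.A_a2, f.A_bm3, f.A_b3, f.A_c2, S.A_a1,
        S.A_bm2, S.A_bm1, S.A_b0, S.A_b1, S.A_b2, S.A_cm2, S.A_cm1, S.A_c0, S.A_c1, S.A_dm2,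
        S.A_dm1, S.A_d0]
  · have f := hf m
    fin_cases i <;>
      simp [PosSeq.vec, posCoef₂, posTo₂, posShift, S.B_a1, S.B_b1, S.B_c1, S.B_d0, f.B_a2,
        f.B_bm3, f.B_b0, f.B_bm2, f.B_bm1, f.B_b2, f.B_b3, f.B_cm2, f.B_cm1, f.B_c0, f.B_c2,
        f.B_dm2, f.B_dm1]

end LieSuperalgebra

/-! ### Negative part: passing through one block. -/

namespace LieSuperalgebra

section Neg

variable {M : Type*} [AddCommGroup M] [Module ℂ M]

/-- Root vectors for the negative part, in blocks of `17`, with the conventions of `PosSeq`. -/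
structure NegSeq (A B : Module.End ℂ M) where
  (a1 a2 bm2 bm1 b0 b1 b2 cm3 cm2 cm1 c0 c1 c2 c3 dm2 dm1 d0 : ℕ → M)
  A_a1 : ∀ m, A (a1 m) = a2 m
  B_a1 : ∀ m, B (a1 m) = -bm1 m
  A_bm1 : ∀ m, A (bm1 m) = b0 m
  B_bm1 : ∀ m, B (bm1 m) = (6 : ℂ) • cm3 m
  A_b0 : ∀ m, A (b0 m) = b1 m
  B_b0 : ∀ m, B (b0 m) = (-2 : ℂ) • cm2 m
  A_b1 : ∀ m, A (b1 m) = b2 m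
  A_cm2 : ∀ m, A (cm2 m) = cm1 m
  A_cm1 : ∀ m, A (cm1 m) = c0 m
  A_c0 : ∀ m, A (c0 m) = c1 m
  B_c0 : ∀ m, B (c0 m) = (2 : ℂ) • dm2 m
  A_c1 : ∀ m, A (c1 m) = c2 m
  A_c2 : ∀ m, A (c2 m) = c3 m
  A_dm2 : ∀ m, A (dm2 m) = dm1 m
  A_dm1 : ∀ m, A (dm1 m) = d0 m
  A_d0 : ∀ m, A (d0 m) = a1 (m + 1)
  B_d0 : ∀ m, B (d0 m) = (-2 : ℂ) • bm2 (m + 1)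

namespace NegSeq

open PosSeq (eq_of_smul eq_zero_of_smul)

variable {A B : Module.End ℂ M}

/-- The first relations in a block. -/
structure Entry (S : NegSeq A B) (m : ℕ) : Prop where
  A_a2 : A (S.a2 m) = 0
  A_bm2 : A (S.bm2 m) = S.bm1 m
  B_a2 : B (S.a2 m) = (-2 : ℂ) • S.b0 m
  A_b2 : A (S.b2 m) = 0
  B_bm2 : B (S.bm2 m) = 0
  A_cm3 : A (S.cm3 m) = S.cm2 m
  B_cm3 : B (S.cm3 m) = 0

/-- The remaining relations in a block. -/
structure Full (S : NegSeq A B) (m : ℕ) : Prop extends S.Entry m where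
  B_b1 : B (S.b1 m) = (2 : ℂ) • S.cm1 m
  B_b2 : B (S.b2 m) = (-2 : ℂ) • S.c0 m
  A_c3 : A (S.c3 m) = 0
  B_cm2 : B (S.cm2 m) = 0
  B_cm1 : B (S.cm1 m) = 0
  B_c1 : B (S.c1 m) = (-2 : ℂ) • S.dm1 m
  B_c2 : B (S.c2 m) = (2 : ℂ) • S.d0 m
  B_c3 : B (S.c3 m) = (-6 : ℂ) • S.a1 (m + 1)
  B_dm2 : B (S.dm2 m) = 0
  B_dm1 : B (S.dm1 m) = 0

variable (S : NegSeq A B)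
  (R1 : ∀ x, B^[3] (A x) - (3 : ℂ) • B^[2] (A (B x)) + (3 : ℂ) • B (A (B^[2] x))
    - A (B^[3] x) = 0)
  (R2 : ∀ x, A (B (A (B x))) - A (B (B (A x))) + (3 : ℂ) • B (A (A (B x))) + B (A (B (A x)))
    - (2 : ℂ) • B (B (A (A x))) - (2 : ℂ) • A (A (B (B x))) = 0)
  (R3 : ∀ x, A^[5] (B x) - A^[4] (B (A x)) - (2 : ℂ) • A^[3] (B (A^[2] x))
    + (2 : ℂ) • A^[2] (B (A^[3] x)) + A (B (A^[4] x)) - B (A^[5] x) = 0)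

include R1 R2 R3

/-- In the negative part the exceptional height 0 arrow, from `a2` to `b0`, belongs to the entry of
the block. The other height 0 coincidences, at `c0` and `d0`, already follow from relation 2 at `a2`
and `b2`, so no outside input is needed. -/
theorem full_of (m : ℕ) (h : S.Entry m) : S.Full m := by
  have B_b1 : B (S.b1 m) = (2 : ℂ) • S.cm1 m := by
    have e := R2 (S.a1 m)
    simp only [S.A_a1, S.B_a1, S.A_bm1, S.B_bm1, S.A_b0, S.B_b0, S.A_cm2, h.A_a2, h.B_a2, h.A_cm3,
      map_smul, map_neg, map_zero] at e
    refine eq_of_smul (c := -5) (by norm_num) ?_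
    linear_combination (norm := module) e
  have B_b2 : B (S.b2 m) = (-2 : ℂ) • S.c0 m := by
    have e := R2 (S.a2 m)
    simp only [S.A_b0, S.B_b0, S.A_b1, B_b1, S.A_cm2, S.A_cm1, h.A_a2, h.B_a2,
      map_smul, map_zero] at e
    refine eq_of_smul (c := -6) (by norm_num) ?_
    linear_combination (norm := module) e
  have B_cm2 : B (S.cm2 m) = 0 := by
    have e := R1 (S.a1 m)
    simp only [Function.iterate_succ, Function.iterate_zero, Function.comp_apply, id,
      S.A_a1, S.B_a1, S.A_bm1, S.B_bm1, S.B_b0, h.B_a2, h.A_cm3, h.B_cm3,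
      map_smul, map_neg, map_zero] at e
    refine eq_zero_of_smul (c := -20) (by norm_num) ?_
    linear_combination (norm := module) e
  have B_cm1 : B (S.cm1 m) = 0 := by
    have e := R1 (S.a2 m)
    simp only [Function.iterate_succ, Function.iterate_zero, Function.comp_apply, id,
      S.A_b0, S.B_b0, S.A_cm2, B_cm2, h.A_a2, h.B_a2, B_b1, map_smul, map_zero] at e
    refine eq_zero_of_smul (c := 24) (by norm_num) ?_
    linear_combination (norm := module) e
  have B_c1 : B (S.c1 m) = (-2 : ℂ) • S.dm1 m := by
    have e := R2 (S.b1 m)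
    simp only [S.A_b1, B_b1, S.A_cm1, S.A_c0, S.B_c0, S.A_dm2, h.A_b2, B_b2, B_cm1,
      map_smul, map_zero] at e
    refine eq_of_smul (c := 4) (by norm_num) ?_
    linear_combination (norm := module) e
  have B_c2 : B (S.c2 m) = (2 : ℂ) • S.d0 m := by
    have e := R2 (S.b2 m)
    simp only [S.A_c0, S.B_c0, S.A_c1, B_c1, S.A_dm2, S.A_dm1, h.A_b2, B_b2,
      map_smul, map_zero] at e
    refine eq_of_smul (c := -6) (by norm_num) ?_
    linear_combination (norm := module) e
  have B_dm2 : B (S.dm2 m) = 0 := by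
    have e := R1 (S.b1 m)
    simp only [Function.iterate_succ, Function.iterate_zero, Function.comp_apply, id,
      S.A_b1, B_b1, S.A_cm1, S.B_c0, B_b2, B_cm1, map_smul, map_zero] at e
    refine eq_zero_of_smul (c := -16) (by norm_num) ?_
    linear_combination (norm := module) e
  refine ⟨h, B_b1, B_b2, ?_, B_cm2, B_cm1, B_c1, B_c2, ?_, B_dm2, ?_⟩
  · have e := R3 (S.b1 m)
    simp only [Function.iterate_succ, Function.iterate_zero, Function.comp_apply, id,
      S.A_b1, B_b1, B_b2, h.A_b2, S.A_cm1, S.A_c0, S.A_c1, S.A_c2, map_smul, map_zero] at e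
    refine eq_zero_of_smul (c := 4) (by norm_num) ?_
    linear_combination (norm := module) e
  · have e := R3 (S.cm2 m)
    simp only [Function.iterate_succ, Function.iterate_zero, Function.comp_apply, id,
      S.A_cm2, S.A_cm1, S.A_c0, S.A_c1, S.A_c2, B_cm2, B_cm1, S.B_c0, B_c1, B_c2, S.A_dm2, S.A_dm1,
      S.A_d0, map_smul, map_zero] at e
    linear_combination (norm := module) -e
  · have e := R1 (S.b2 m)
    simp only [Function.iterate_succ, Function.iterate_zero, Function.comp_apply, id,
      h.A_b2, B_b2, S.A_c0, S.B_c0, B_c1, S.A_dm2, B_dm2, map_smul, map_zero] at e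
    refine eq_zero_of_smul (c := -24) (by norm_num) ?_
    linear_combination (norm := module) e

omit R1 R2 in
theorem A_a2_succ (m : ℕ) (h : S.Full m) : A (S.a2 (m + 1)) = 0 := by
  have e := R3 (S.c0 m)
  simp only [Function.iterate_succ, Function.iterate_zero, Function.comp_apply, id,
    S.A_c0, S.A_c1, S.A_c2, h.A_c3, S.B_c0, h.B_c1, h.B_c2, h.B_c3, S.A_dm2, S.A_dm1,
    S.A_d0, S.A_a1, map_smul, map_zero] at e
  refine eq_zero_of_smul (c := -12) (by norm_num) ?_
  linear_combination (norm := module) e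

omit R1 R3 in
-- Isolated from the other entry relations because the proof of the height 0 arrow of the new block
-- already uses it.
theorem A_bm2_succ (m : ℕ) (h : S.Full m) : A (S.bm2 (m + 1)) = S.bm1 (m + 1) := by
  have e := R2 (S.c1 m)
  simp only [S.A_c1, S.A_c2, h.B_c1, h.B_c2, h.B_c3, S.A_dm1, h.B_dm1, S.A_d0, S.B_d0, S.B_a1,
    map_smul, map_zero] at e
  refine eq_of_smul (c := 8) (by norm_num) ?_
  linear_combination (norm := module) e

/-- The hypothesis on `a2` is the exceptional arrow, which needs the shift argument; the rest again
comes from words that start at `dm2` and `d0` and cross into the new block. -/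
theorem entry_succ (m : ℕ) (h : S.Full m)
    (B_a2 : B (S.a2 (m + 1)) = (-2 : ℂ) • S.b0 (m + 1)) : S.Entry (m + 1) := by
  have A_a2 := S.A_a2_succ R3 m h
  have A_bm2 := S.A_bm2_succ R2 m h
  have B_bm2 : B (S.bm2 (m + 1)) = 0 := by
    have e := R2 (S.dm2 m)
    simp only [S.A_dm2, S.A_dm1, h.B_dm2, h.B_dm1, S.B_d0, map_smul, map_zero] at e
    refine eq_zero_of_smul (c := 4) (by norm_num) ?_
    linear_combination (norm := module) e
  refine ⟨A_a2, A_bm2, B_a2, ?_, B_bm2, ?_, ?_⟩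
  · have e := R3 (S.d0 m)
    simp only [Function.iterate_succ, Function.iterate_zero, Function.comp_apply, id,
      S.A_d0, S.A_a1, A_a2, S.B_d0, S.B_a1, B_a2, A_bm2, S.A_bm1, S.A_b0, S.A_b1, map_smul,
      map_neg, map_zero] at e
    refine eq_zero_of_smul (c := 3) (by norm_num) ?_
    linear_combination (norm := module) e
  · have e := R2 (S.d0 m)
    simp only [S.A_d0, S.A_a1, S.B_d0, S.B_a1, B_a2, A_bm2, B_bm2, S.A_bm1, S.B_bm1, S.B_b0,
      map_smul, map_neg, map_zero] at e
    refine eq_of_smul (c := -6) (by norm_num) ?_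
    linear_combination (norm := module) e
  · have e := R1 (S.d0 m)
    simp only [Function.iterate_succ, Function.iterate_zero, Function.comp_apply, id,
      S.A_d0, S.B_d0, S.B_a1, A_bm2, B_bm2, S.B_bm1, map_smul, map_neg, map_zero] at e
    refine eq_zero_of_smul (c := 30) (by norm_num) ?_
    linear_combination (norm := module) e

end NegSeq

variable [LieSuperalgebra M] {y₁ y₂ : M}

theorem neg_op_shift (h1 : y₁ ∈ part (L := M) 1) (h2 : y₂ ∈ part (L := M) 0) (x : M) :
    br (br y₁ (br y₁ y₂)) x = br y₁ (br y₁ (br y₂ x)) - br y₂ (br y₁ (br y₁ x)) := by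
  rw [br_br_of_odd h1 (br_mem_of_odd_even h1 h2)]
  simp only [br_br_of_even_right h1 h2, map_sub]
  module

namespace NegSeq

open PosSeq (eq_of_smul eq_zero_of_smul)

variable (S : NegSeq (M := M) (br y₁) (br y₂))

/-- The bracket relation in an imaginary degree. -/
theorem B_a2_succ (h1 : y₁ ∈ part (L := M) 1) (h2 : y₂ ∈ part (L := M) 0)
    (hy1 : S.a1 0 = y₁) (hy2 : S.bm2 0 = y₂) (m : ℕ) (hfull : ∀ k ≤ m, S.Full k)
    (A_bm2 : br y₁ (S.bm2 (m + 1)) = S.bm1 (m + 1)) :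
    br y₂ (S.a2 (m + 1)) = (-2 : ℂ) • S.b0 (m + 1) := by
  have h12 := br_mem_of_odd_even h1 h2
  have eb : S.bm1 0 = br y₁ y₂ := by rw [← (hfull 0 (Nat.zero_le _)).A_bm2, hy2]
  have hbm : S.bm1 0 ∈ part (L := M) 1 := by rwa [eb]
  -- Here `y₂` has height -2, so two applications of `A` suffice for height 0.
  set l := br y₁ (br y₁ y₂) with hl
  have hl0 : l ∈ part (L := M) 0 := br_mem_of_odd h1 h12
  have L : ∀ x, br l x = _ := neg_op_shift h1 h2
  set V : ℕ → M := fun j => (br l)^[j] y₁ with hV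
  set U : ℕ → M := fun k => (-br l : Module.End ℂ M)^[k] (S.bm1 0) with hU
  have hVs : ∀ j, br l (V j) = V (j + 1) := fun j => (Function.iterate_succ_apply' _ _ _).symm
  have hUs' : ∀ k, U (k + 1) = -br l (U k) := fun k => by
    rw [hU]; simp only [Function.iterate_succ_apply']; simp
  have hUs : ∀ k, br l (U k) = -U (k + 1) := fun k => by rw [hUs', neg_neg]
  have hVm : ∀ j, V j ∈ part (L := M) 1 := fun j => by
    induction j with
    | zero => exact h1
    | succ j ih => rw [← hVs]; exact br_mem_of_even_odd hl0 ih
  have La : ∀ k ≤ m, br l (S.a1 k) = -S.b1 k := fun k hk => by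
    have e := hfull k hk
    rw [L]
    simp only [S.A_a1, S.B_a1, e.A_a2, S.A_bm1, S.A_b0, map_neg, map_zero]
    module
  have Lb : ∀ k ≤ m, br l (S.b1 k) = (2 : ℂ) • S.c1 k := fun k hk => by
    have e := hfull k hk
    rw [L]
    simp only [S.A_b1, e.B_b1, e.A_b2, S.A_cm1, S.A_c0, map_smul, map_zero]
    module
  have Lc : ∀ k ≤ m, br l (S.c1 k) = (4 : ℂ) • S.a1 (k + 1) := fun k hk => by
    have e := hfull k hk
    rw [L]
    simp only [S.A_c1, S.A_c2, e.B_c1, e.B_c3, S.A_dm1, S.A_d0, map_smul]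
    module
  have Lbm : ∀ k ≤ m, br l (S.bm1 k) = (4 : ℂ) • S.cm1 k := fun k hk => by
    have e := hfull k hk
    rw [L]
    simp only [S.A_bm1, S.B_bm1, S.A_b0, e.B_b1, e.A_cm3, S.A_cm2, map_smul]
    module
  have Lcm : ∀ k ≤ m, br l (S.cm1 k) = (2 : ℂ) • S.dm1 k := fun k hk => by
    have e := hfull k hk
    rw [L]
    simp only [S.A_cm1, S.A_c0, e.B_cm1, e.B_c1, map_zero]
    module
  have Ldm : ∀ k ≤ m, br l (S.dm1 k) = S.bm1 (k + 1) := fun k hk => by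
    have e := hfull k hk
    rw [L]
    simp only [S.A_dm1, S.A_d0, S.B_a1, e.B_dm1, map_zero]
    module
  have Lb0 : ∀ k ≤ m, br l (S.b0 k) = 0 := fun k hk => by
    have e := hfull k hk
    rw [L]
    simp only [S.A_b0, S.A_b1, S.B_b0, e.B_b2, S.A_cm2, S.A_cm1, map_smul]
    module
  have Lc0 : ∀ k ≤ m, br l (S.c0 k) = 0 := fun k hk => by
    have e := hfull k hk
    rw [L]
    simp only [S.A_c0, S.A_c1, S.B_c0, e.B_c2, S.A_dm2, S.A_dm1, map_smul]
    module
  -- The vector `d0 m` is excluded: the action of `l` on it involves the unknown `B (a2 (m + 1))`.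
  have Ld0 : ∀ k < m, br l (S.d0 k) = 0 := fun k hk => by
    have e' := hfull (k + 1) (by lia)
    rw [L]
    simp only [S.A_d0, S.A_a1, S.B_d0, e'.B_a2, e'.A_bm2, S.A_bm1, map_smul]
    module
  -- The factors for one block are -1, 2, 4 on `V`, and 4, 2, 1 with three signs on `U`: both give
  -- -8.
  have V0 : ∀ k ≤ m + 1, V (3 * k) = ((-8 : ℂ) ^ k) • S.a1 k := fun k hk => by
    induction k with
    | zero => simp [hV, hy1]
    | succ k ih =>
      rw [show 3 * (k + 1) = 3 * k + 1 + 1 + 1 by ring, ← hVs, ← hVs, ← hVs, ih (by lia)]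
      simp only [map_smul, map_neg, La k (by lia), Lb k (by lia), Lc k (by lia)]
      module
  have U0 : ∀ k ≤ m + 1, U (3 * k) = ((-8 : ℂ) ^ k) • S.bm1 k := fun k hk => by
    induction k with
    | zero => simp [hU]
    | succ k ih =>
      rw [show 3 * (k + 1) = 3 * k + 1 + 1 + 1 by ring, hUs', hUs', hUs', ih (by lia)]
      simp only [map_smul, map_neg, Lbm k (by lia), Lcm k (by lia), Ldm k (by lia)]
      module
  have U1 : ∀ k ≤ m, U (3 * k + 1) = (-4 * (-8 : ℂ) ^ k) • S.cm1 k := fun k hk => by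
    rw [hUs', U0 k (by lia), map_smul, Lbm k hk]; module
  have U2 : ∀ k ≤ m, U (3 * k + 2) = (8 * (-8 : ℂ) ^ k) • S.dm1 k := fun k hk => by
    rw [hUs', U1 k hk, map_smul, Lcm k hk]; module
  have hker : ∀ b < 3 * m + 2, br l (br (V 0) (U b)) = 0 := by
    intro b hb
    obtain ⟨k, r, hr, rfl⟩ : ∃ k r, r < 3 ∧ b = 3 * k + r :=
      ⟨b / 3, b % 3, Nat.mod_lt _ (by norm_num), (Nat.div_add_mod b 3).symm⟩
    change br l (br y₁ _) = 0
    interval_cases r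
    · rw [add_zero, U0 k (by lia), map_smul, S.A_bm1, map_smul, Lb0 k (by lia), smul_zero]
    · rw [U1 k (by lia), map_smul, S.A_cm1, map_smul, Lc0 k (by lia), smul_zero]
    · rw [U2 k (by lia), map_smul, S.A_dm1, map_smul, Ld0 k (by lia), smul_zero]
  -- The extreme pair is now `j = 3(m + 1)`, `k = 0`. Only `B a2` and `b0` of block `m + 1` survive,
  -- and the identity is `B a2 + 2 b0 = 0` multiplied by `-(-8)^(m+1) (3m + 4)`.
  have key := br_shift hl0 hVm hVs hUs (3 * m + 2) hker (3 * (m + 1)) 0 rfl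
  rw [br_comm_of_odd (hVm _) (show U 0 ∈ _ from hbm), V0 _ le_rfl,
    show 3 * m + 2 + 1 = 3 * (m + 1) by ring, U0 _ le_rfl, U2 m le_rfl] at key
  change br (S.bm1 0) _ = br y₁ _ + _ • br l (br y₁ _) at key
  rw [eb, br_br_of_even_right h1 h2] at key
  simp only [map_smul, map_neg, L, S.A_bm1, S.A_dm1, S.A_d0, S.A_a1, S.B_a1, S.B_d0, A_bm2] at key
  refine eq_of_smul (c := -(-8 : ℂ) ^ (m + 1) * (3 * m + 4))
    (mul_ne_zero (neg_ne_zero.2 (pow_ne_zero _ (by norm_num))) (by norm_cast)) ?_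
  push_cast at key
  linear_combination (norm := module) key

end NegSeq

end Neg

end LieSuperalgebra

/-! ### Negative part: induction over the blocks. -/

namespace LieSuperalgebra

section Neg

variable {M : Type} [AddCommGroup M] [Module ℂ M] [LieSuperalgebra M] {y₁ y₂ : M}

/-- The first root vectors of the blocks. -/
noncomputable def negBase (A B : Module.End ℂ M) (y : M) : ℕ → M
  | 0 => y
  | m + 1 => A (A (A ((1 / 2 : ℂ) • B (A (A ((-1 / 2 : ℂ) • B (A (-B (negBase A B y m)))))))))

/-- The root vectors generated by `y₁` and `y₂`. -/
noncomputable def negSeq (y₁ y₂ : M) : NegSeq (br y₁) (br y₂) :=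
  let A : Module.End ℂ M := br y₁
  let B : Module.End ℂ M := br y₂
  let a := negBase A B y₁
  let b := fun m => -B (a m)
  let c := fun m => (-1 / 2 : ℂ) • B (A (b m))
  let d := fun m => (1 / 2 : ℂ) • B (A (A (c m)))
  { a1 := a
    a2 := fun m => A (a m)
    bm2 := fun m => Nat.casesOn m y₂ fun m => (-1 / 2 : ℂ) • B (A (A (d m)))
    bm1 := b
    b0 := fun m => A (b m)
    b1 := fun m => A (A (b m))
    b2 := fun m => A (A (A (b m)))
    -- The factor 1/6 is the one for which `A cm3 = cm2` exactly.
    cm3 := fun m => (1 / 6 : ℂ) • B (b m)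
    cm2 := c
    cm1 := fun m => A (c m)
    c0 := fun m => A (A (c m))
    c1 := fun m => A (A (A (c m)))
    c2 := fun m => A (A (A (A (c m))))
    c3 := fun m => A (A (A (A (A (c m)))))
    dm2 := d
    dm1 := fun m => A (d m)
    d0 := fun m => A (A (d m))
    A_a1 := fun _ => rfl
    B_a1 := fun m => by simp only [b, neg_neg]; rfl
    A_bm1 := fun _ => rfl
    B_bm1 := fun m => by simp only [smul_smul]; norm_num; rfl
    A_b0 := fun _ => rfl
    B_b0 := fun m => by simp only [c, smul_smul]; norm_num; rfl
    A_b1 := fun _ => rfl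
    A_cm2 := fun _ => rfl
    A_cm1 := fun _ => rfl
    A_c0 := fun _ => rfl
    B_c0 := fun m => by simp only [d, smul_smul]; norm_num; rfl
    A_c1 := fun _ => rfl
    A_c2 := fun _ => rfl
    A_dm2 := fun _ => rfl
    A_dm1 := fun _ => rfl
    A_d0 := fun _ => rfl
    B_d0 := fun m => by simp only [smul_smul]; norm_num; rfl }

namespace NegSeq

open PosSeq (eq_of_smul eq_zero_of_smul)

variable (S : NegSeq (M := M) (br y₁) (br y₂))

/-- Each relation is one arrow of block 0: relation 1 is `B cm3 = 0`, relation 2 is `A cm3 = cm2`,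
and relation 3 ends the `b`-string at `b2`. -/
theorem entry_zero (h1 : y₁ ∈ part (L := M) 1) (h2 : y₂ ∈ part (L := M) 0) (h : NegHom M y₁ y₂)
    (hy1 : S.a1 0 = y₁) (hy2 : S.bm2 0 = y₂) : S.Entry 0 := by
  obtain ⟨r1, r2, r3⟩ := h
  have h11 := br_mem_of_odd h1 h1
  have h12 := br_mem_of_odd_even h1 h2
  have e1 : S.a2 0 = br y₁ y₁ := by rw [← S.A_a1, hy1]
  have e2 : S.bm1 0 = br y₁ y₂ := by
    rw [← neg_neg (S.bm1 0), ← S.B_a1, hy1, br_comm_of_even_left h2 h1, neg_neg]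
  have B_a2 : br y₂ (S.a2 0) = (-2 : ℂ) • S.b0 0 := by
    rw [← S.A_bm1, e2, e1, br_comm_of_even_right h2 h11, br_br_self_of_odd_apply h1]
    module
  refine ⟨?_, ?_, B_a2, ?_, ?_, ?_, ?_⟩
  · rw [e1, br_br_self_of_odd h1]
  · rw [hy2, e2]
  · rw [← e2] at r3
    simp only [br_br_self_of_odd_apply h1, S.A_bm1, S.A_b0, S.A_b1, map_smul, smul_smul] at r3
    exact eq_zero_of_smul (by norm_num) r3
  · rw [hy2, br_self_of_even h2]
  · rw [← e1, B_a2, br_br_of_even_right h1 h2, ← e2] at r2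
    simp only [map_smul, S.A_bm1, S.B_bm1, S.B_b0] at r2
    refine eq_of_smul (c := 6) (by norm_num) ?_
    linear_combination (norm := module) r2
  · rw [← hy1, S.B_a1, map_neg, S.B_bm1, map_neg, map_smul, neg_eq_zero] at r1
    exact eq_zero_of_smul (by norm_num) r1

theorem full (h1 : y₁ ∈ part (L := M) 1) (h2 : y₂ ∈ part (L := M) 0) (h : NegHom M y₁ y₂)
    (hy1 : S.a1 0 = y₁) (hy2 : S.bm2 0 = y₂) (m : ℕ) : S.Full m := by
  have R1 := neg_op_one h1 h2 h.1
  have R2 := neg_op_two h1 h2 h.2.1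
  have R3 := neg_op_three h1 h2 h.2.2
  induction m using Nat.strong_induction_on with
  | _ m ih =>
    refine S.full_of R1 R2 R3 m ?_
    cases m with
    | zero => exact S.entry_zero h1 h2 h hy1 hy2
    | succ m =>
      exact S.entry_succ R1 R2 R3 m (ih m (by lia)) (S.B_a2_succ h1 h2 hy1 hy2 m
        (fun k hk => ih k (by lia)) (S.A_bm2_succ R2 m (ih m (by lia))))

/-- The root vectors of a block as a family. -/
def vec : Fin 17 → ℕ → M :=
  ![S.a1, S.a2, S.bm2, S.bm1, S.b0, S.b1, S.b2, S.cm3, S.cm2, S.cm1, S.c0, S.c1, S.c2, S.c3,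
    S.dm2, S.dm1, S.d0]

end NegSeq

end Neg

noncomputable def negCoef₁ : Fin 17 → ℂ := ![1, 0, 1, 1, 1, 1, 0, 1, 1, 1, 1, 1, 1, 0, 1, 1, 1]

noncomputable def negCoef₂ : Fin 17 → ℂ :=
  ![-1, -2, 0, 6, -2, 2, -2, 0, 0, 0, 2, -2, 2, -6, 0, 0, -2]

def negTo₁ : Fin 17 → Fin 17 := fun i => i + 1

def negTo₂ : Fin 17 → Fin 17 := ![3, 4, 0, 7, 8, 9, 10, 0, 0, 0, 14, 15, 16, 0, 0, 0, 2]

def negShift₁ : Fin 17 → ℕ := fun i => if i = 16 then 1 else 0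

/-- Besides `d0`, the vector `c3` leaves the block under `B`: it goes to a multiple of the next
`a1`. -/
def negShift₂ : Fin 17 → ℕ := fun i => if i = 13 ∨ i = 16 then 1 else 0

theorem exists_neg_table {M : Type} [AddCommGroup M] [Module ℂ M] [LieSuperalgebra M] {y₁ y₂ : M}
    (h1 : y₁ ∈ part (L := M) 1) (h2 : y₂ ∈ part (L := M) 0) (h : NegHom M y₁ y₂) :
    ∃ x : Fin 17 → ℕ → M, x 0 0 = y₁ ∧ x 2 0 = y₂ ∧
      IsTable negCoef₁ negTo₁ negShift₁ y₁ x ∧ IsTable negCoef₂ negTo₂ negShift₂ y₂ x := by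
  set S := negSeq y₁ y₂
  have hf := S.full h1 h2 h rfl rfl
  refine ⟨S.vec, rfl, rfl, fun i m => ?_, fun i m => ?_⟩
  · have f := hf m
    fin_cases i <;>
      simp [NegSeq.vec, negCoef₁, negTo₁, negShift₁, f.A_a2, f.A_bm2, f.A_b2, f.A_cm3, f.A_c3,
        S.A_a1, S.A_bm1, S.A_b0, S.A_b1, S.A_cm2, S.A_cm1, S.A_c0, S.A_c1, S.A_c2, S.A_dm2,
        S.A_dm1, S.A_d0]
  · have f := hf m
    fin_cases i <;>
      simp [NegSeq.vec, negCoef₂, negTo₂, negShift₂, S.B_a1, S.B_bm1, S.B_b0, S.B_c0, S.B_d0,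
        f.B_a2, f.B_bm2, f.B_b1, f.B_b2, f.B_cm3, f.B_cm2, f.B_cm1, f.B_c1, f.B_c2, f.B_c3,
        f.B_dm2, f.B_dm1]

end LieSuperalgebra

/-! ### From equal tables to homomorphisms. -/

namespace LieSuperalgebra

/-- The set `ι` is reached from `a` and `b` by the steps `t₁`, `t₂`, where a step is allowed if its
coefficient `c₁ i`, `c₂ i` is not zero. -/
def Reaches {ι : Type*} (a b : ι) (c₁ c₂ : ι → ℂ) (t₁ t₂ : ι → ι) : Prop :=
  ∀ P : ι → Prop, P a → P b → (∀ i, c₁ i ≠ 0 → P i → P (t₁ i)) →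
    (∀ i, c₂ i ≠ 0 → P i → P (t₂ i)) → ∀ i, P i

section Tables

variable {K M : Type*} [AddCommGroup K] [Module ℂ K] [LieSuperalgebra K]
  [AddCommGroup M] [Module ℂ M] [LieSuperalgebra M] {ι : Type*} {e : ι → K} {X : ι → M}
  {pr : ι → ZMod 2} {a b : ι} {c₁ c₂ : ι → ℂ} {t₁ t₂ : ι → ι}

/-- Parity travels along the arrows with nonzero coefficient, since one may divide by the
coefficient. -/
theorem mem_part_of_tables (hr : Reaches a b c₁ c₂ t₁ t₂)
    (p₁ : ∀ i, c₁ i ≠ 0 → pr (t₁ i) = pr a + pr i) (p₂ : ∀ i, c₂ i ≠ 0 → pr (t₂ i) = pr b + pr i)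
    (ha : X a ∈ part (L := M) (pr a)) (hb : X b ∈ part (L := M) (pr b))
    (X₁ : ∀ i, br (X a) (X i) = c₁ i • X (t₁ i)) (X₂ : ∀ i, br (X b) (X i) = c₂ i • X (t₂ i))
    (i : ι) : X i ∈ part (L := M) (pr i) := by
  refine hr (fun i => X i ∈ part (L := M) (pr i)) ha hb (fun i hc hi => ?_) (fun i hc hi => ?_) i
  · have h := br_mem ha hi
    rw [X₁] at h
    rw [p₁ i hc]
    exact (Submodule.smul_mem_iff _ hc).1 h
  · have h := br_mem hb hi
    rw [X₂] at h
    rw [p₂ i hc]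
    exact (Submodule.smul_mem_iff _ hc).1 h

/-- It is enough that `f` intertwines the actions of the two generators, which the tables give.
Compatibility with `ad (e i)` passes along every allowed arrow by the Jacobi identity, so it holds
for all `i`. -/
theorem map_br_of_tables (f : K →ₗ[ℂ] M) (hf : ∀ i, f (e i) = X i)
    (hspan : Submodule.span ℂ (Set.range e) = ⊤) (hr : Reaches a b c₁ c₂ t₁ t₂)
    (p₁ : ∀ i, c₁ i ≠ 0 → pr (t₁ i) = pr a + pr i) (p₂ : ∀ i, c₂ i ≠ 0 → pr (t₂ i) = pr b + pr i)
    (he : ∀ i, e i ∈ part (L := K) (pr i))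
    (ha : X a ∈ part (L := M) (pr a)) (hb : X b ∈ part (L := M) (pr b))
    (e₁ : ∀ i, br (e a) (e i) = c₁ i • e (t₁ i)) (e₂ : ∀ i, br (e b) (e i) = c₂ i • e (t₂ i))
    (X₁ : ∀ i, br (X a) (X i) = c₁ i • X (t₁ i)) (X₂ : ∀ i, br (X b) (X i) = c₂ i • X (t₂ i))
    (x y : K) : f (br x y) = br (f x) (f y) := by
  have hX := mem_part_of_tables hr p₁ p₂ ha hb X₁ X₂
  have gen : ∀ (g : ι) (c : ι → ℂ) (t : ι → ι), (∀ i, br (e g) (e i) = c i • e (t i)) →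
      (∀ i, br (X g) (X i) = c i • X (t i)) → ∀ w, f (br (e g) w) = br (X g) (f w) := by
    intro g c t h h' w
    have hw : w ∈ Submodule.span ℂ (Set.range e) := by rw [hspan]; trivial
    induction hw using Submodule.span_induction with
    | mem w hw => obtain ⟨i, rfl⟩ := hw; rw [h, map_smul, hf, hf, h']
    | zero => simp
    | add u v _ _ hu hv => simp only [map_add, hu, hv]
    | smul k u _ hu => simp only [map_smul, hu]
  -- If `f` respects `ad (e g)` and `ad (e i)`, then comparing the Jacobi identities in the two
  -- algebras shows that it respects the adjoint action of their bracket, which is a nonzero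
  -- multiple of the target of the arrow.
  have step : ∀ (g : ι) (c : ι → ℂ) (t : ι → ι), (∀ i, br (e g) (e i) = c i • e (t i)) →
      (∀ i, br (X g) (X i) = c i • X (t i)) → ∀ i, c i ≠ 0 →
      (∀ w, f (br (e i) w) = br (X i) (f w)) → ∀ w, f (br (e (t i)) w) = br (X (t i)) (f w) := by
    intro g c t h h' i hc hi w
    have hg := gen g c t h h'
    have j1 := br_jacobi w (he g) (he i)
    have j2 := br_jacobi (f w) (hX g) (hX i)
    have k1 := congrArg f j1
    rw [hg, hi, map_add, map_smul, hi, hg, h, map_smul, LinearMap.smul_apply, map_smul, j2, h',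
      map_smul, LinearMap.smul_apply] at k1
    exact (smul_right_injective M hc (add_right_cancel k1)).symm
  have main : ∀ i, ∀ w, f (br (e i) w) = br (X i) (f w) :=
    hr _ (gen a c₁ t₁ e₁ X₁) (gen b c₂ t₂ e₂ X₂) (step a c₁ t₁ e₁ X₁) (step b c₂ t₂ e₂ X₂)
  have hx : x ∈ Submodule.span ℂ (Set.range e) := by rw [hspan]; trivial
  induction hx using Submodule.span_induction with
  | mem x hx => obtain ⟨i, rfl⟩ := hx; rw [main, hf]
  | zero => simp
  | add u v _ _ hu hv => simp only [map_add, LinearMap.add_apply, hu, hv]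
  | smul k u _ hu => simp only [map_smul, LinearMap.smul_apply, hu]

/-- A homogeneous spanning family splits every element into two components whose images have the
right parity; for homogeneous `x` the wrong component vanishes because the parts are disjoint. -/
theorem map_part_of_span (f : K →ₗ[ℂ] M) (hspan : Submodule.span ℂ (Set.range e) = ⊤)
    (he : ∀ i, e i ∈ part (L := K) (pr i)) (hf : ∀ i, f (e i) ∈ part (L := M) (pr i))
    (p : ZMod 2) (x : K) (hx : x ∈ part (L := K) p) : f x ∈ part (L := M) p := by
  have dec : ∀ x : K, ∃ y z, y ∈ part (L := K) 0 ∧ z ∈ part (L := K) 1 ∧ x = y + z ∧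
      f y ∈ part (L := M) 0 ∧ f z ∈ part (L := M) 1 := by
    intro x
    have h : x ∈ Submodule.span ℂ (Set.range e) := by rw [hspan]; trivial
    induction h using Submodule.span_induction with
    | mem x h =>
      obtain ⟨i, rfl⟩ := h
      have h1 := he i
      have h2 := hf i
      rcases D21.zmod_two (pr i) with h | h <;> rw [h] at h1 h2
      · exact ⟨e i, 0, h1, zero_mem _, by simp, h2, by simp⟩
      · exact ⟨0, e i, zero_mem _, h1, by simp, by simp, h2⟩
    | zero => exact ⟨0, 0, zero_mem _, zero_mem _, by simp, by simp, by simp⟩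
    | add u v _ _ hu hv =>
      obtain ⟨y, z, hy, hz, rfl, hy', hz'⟩ := hu
      obtain ⟨y', z', hw, hw', rfl, hv, hv'⟩ := hv
      refine ⟨y + y', z + z', add_mem hy hw, add_mem hz hw', by abel, ?_, ?_⟩ <;> rw [map_add]
      exacts [add_mem hy' hv, add_mem hz' hv']
    | smul k u _ hu =>
      obtain ⟨y, z, hy, hz, rfl, hy', hz'⟩ := hu
      refine ⟨k • y, k • z, Submodule.smul_mem _ _ hy, Submodule.smul_mem _ _ hz, smul_add _ _ _,
        ?_, ?_⟩ <;> rw [map_smul]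
      exacts [Submodule.smul_mem _ _ hy', Submodule.smul_mem _ _ hz']
  have disj := Submodule.disjoint_def.1 (isCompl (L := K)).disjoint
  obtain ⟨y, z, hy, hz, rfl, hy', hz'⟩ := dec x
  rcases D21.zmod_two p with rfl | rfl
  · have h : z = 0 := disj z (by simpa using sub_mem hx hy) hz
    subst h; simpa using hy'
  · have h : y = 0 := disj y hy (by simpa using sub_mem hx hz)
    subst h; simpa using hz'

theorem Hom.eq_of_tables (hspan : Submodule.span ℂ (Set.range e) = ⊤)
    (hr : Reaches a b c₁ c₂ t₁ t₂)
    (e₁ : ∀ i, br (e a) (e i) = c₁ i • e (t₁ i)) (e₂ : ∀ i, br (e b) (e i) = c₂ i • e (t₂ i))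
    (f g : Hom K M) (ha : f (e a) = g (e a)) (hb : f (e b) = g (e b)) : f = g := by
  have hfm : ∀ x y, f (br x y) = br (f x) (f y) := f.map_br
  have hgm : ∀ x y, g (br x y) = br (g x) (g y) := g.map_br
  have main : ∀ i, f (e i) = g (e i) := by
    refine hr _ ha hb (fun i hc hi => ?_) (fun i hc hi => ?_)
    · have h := hfm (e a) (e i)
      rw [ha, hi, ← hgm, e₁, map_smul, map_smul] at h
      exact smul_right_injective M hc h
    · have h := hfm (e b) (e i)
      rw [hb, hi, ← hgm, e₂, map_smul, map_smul] at h
      exact smul_right_injective M hc h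
  have h : f.toLinearMap = g.toLinearMap := by
    refine LinearMap.ext_on_range hspan main
  cases f; cases g; congr

end Tables

end LieSuperalgebra

/-! ### Root bases of half loop algebras, and the abstract presentation theorems. -/

namespace LieSuperalgebra

/-- A basis of `L` that consists of root vectors `u i` of degree `deg i` in `t` and parity `pr i`,
on which the two generators `u 0` and `u 2` act by the given coefficients. -/
structure RootBasis {L : Type*} [AddCommGroup L] [Module ℂ L] [LieSuperalgebra L]
    (σ : Hom L L) (ω : ℂ) (s : ℤˣ) (𝔫 : Subalg L) (deg : Fin 17 → ℕ) (pr : Fin 17 → ZMod 2)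
    (c₁ c₂ : Fin 17 → ℂ) (t₁ t₂ : Fin 17 → Fin 17) (d₁ d₂ : Fin 17 → ℕ) (u : Fin 17 → L) where
  isPrimitiveRoot : IsPrimitiveRoot ω 3
  coord : Fin 17 → L →ₗ[ℂ] ℂ
  sum_coord : ∀ v, ∑ i, coord i v • u i = v
  coord_u : ∀ i j, coord i (u j) = if i = j then 1 else 0
  map_u : ∀ i, σ (u i) = ω ^ ((s : ℤ) * deg i) • u i
  u_mem : ∀ i, u i ∈ part (L := L) (pr i)
  deg_le : ∀ i, deg i ≤ 3
  deg_zero : deg 0 = 0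
  deg_two : deg 2 = 1
  coord_n : ∀ v ∈ 𝔫.toSubmodule, ∀ i, deg i = 3 → coord i v = 0
  u_mem_n : ∀ i, deg i = 0 → u i ∈ 𝔫.toSubmodule
  table₁ : ∀ i, br (u 0) (u i) = c₁ i • u (t₁ i)
  table₂ : ∀ i, br (u 2) (u i) = c₂ i • u (t₂ i)
  deg₁ : ∀ i, c₁ i ≠ 0 → deg (t₁ i) + 3 * d₁ i = deg i
  deg₂ : ∀ i, c₂ i ≠ 0 → deg (t₂ i) + 3 * d₂ i = deg i + 1
  pr₁ : ∀ i, c₁ i ≠ 0 → pr (t₁ i) = pr 0 + pr i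
  pr₂ : ∀ i, c₂ i ≠ 0 → pr (t₂ i) = pr 2 + pr i
  reaches : Reaches (ι := Fin 17 × ℕ) (0, 0) (2, 0) (fun i => c₁ i.1) (fun i => c₂ i.1)
    (fun i => (t₁ i.1, i.2 + d₁ i.1)) (fun i => (t₂ i.1, i.2 + d₂ i.1))

namespace RootBasis

variable {L : Type} [AddCommGroup L] [Module ℂ L] [LieSuperalgebra L]
    {σ : Hom L L} {ω : ℂ} {s : ℤˣ} {𝔫 : Subalg L} {deg : Fin 17 → ℕ} {pr : Fin 17 → ZMod 2}
    {c₁ c₂ : Fin 17 → ℂ} {t₁ t₂ : Fin 17 → Fin 17} {d₁ d₂ : Fin 17 → ℕ} {u : Fin 17 → L}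
    (T : RootBasis σ ω s 𝔫 deg pr c₁ c₂ t₁ t₂ d₁ d₂ u) (hω : ω ≠ 0)

theorem unit_mul_self (s : ℤˣ) : (s : ℤ) * s = 1 := by
  rw [← Units.val_mul, Int.units_mul_self, Units.val_one]

theorem mem_nilLoop {x : Loop L} : x ∈ (nilLoop σ ω hω s 𝔫).toSubmodule ↔
    (∀ k, σ (x k) = ω ^ k • x k) ∧ (∀ k : ℤ, (s : ℤ) * k < 0 → x k = 0) ∧ x 0 ∈ 𝔫.toSubmodule :=
  Iff.rfl

include T

theorem single_mem (i : Fin 17) (m : ℕ) :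
    Finsupp.single ((s : ℤ) * (deg i + 3 * m)) (u i) ∈ (nilLoop σ ω hω s 𝔫).toSubmodule := by
  have hs := unit_mul_self s
  refine (mem_nilLoop hω).2 ⟨fun k => ?_, fun k hk => ?_, ?_⟩ <;> rw [Finsupp.single_apply]
  · split_ifs with h
    · subst h
      have h3 : ω ^ ((s : ℤ) * (3 * m)) = 1 :=
        (T.isPrimitiveRoot.zpow_eq_one_iff_dvd _).2 ⟨s * m, by push_cast; ring⟩
      rw [T.map_u, mul_add, zpow_add₀ hω, h3, mul_one]
    · simp
  · rw [if_neg]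
    rintro rfl
    rw [← mul_assoc, hs] at hk
    lia
  · split_ifs with h
    · refine T.u_mem_n i ?_
      have h' : (deg i : ℤ) + 3 * m = 0 := by simpa using h
      lia
    · exact zero_mem _

/-- The root vectors `u i ⊗ tᵏ` of the loop superalgebra. -/
noncomputable def loopVec (i : Fin 17 × ℕ) : (nilLoop σ ω hω s 𝔫).toSubmodule :=
  ⟨Finsupp.single ((s : ℤ) * (deg i.1 + 3 * i.2)) (u i.1), T.single_mem hω i.1 i.2⟩

/-- The eigenvalue condition of the twist fixes `k` modulo 3; the half-loop condition then leaves
only the exponents of root vectors. -/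
theorem exists_of_coord_ne_zero {x : Loop L}
    (hx : x ∈ (nilLoop σ ω hω s 𝔫).toSubmodule) (k : ℤ) (i : Fin 17) (h : T.coord i (x k) ≠ 0) :
    ∃ m : ℕ, k = (s : ℤ) * (deg i + 3 * m) := by
  obtain ⟨h1, h2, h3⟩ := (mem_nilLoop hω).1 hx
  have hs := unit_mul_self s
  have hcσ : ∀ v, T.coord i (σ v) = ω ^ ((s : ℤ) * deg i) * T.coord i v := by
    intro v
    conv_lhs => rw [← T.sum_coord v]
    simp [map_sum, T.map_u, T.coord_u, mul_comm]
  have e := hcσ (x k)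
  rw [h1, map_smul, smul_eq_mul] at e
  have e2 : ω ^ (k - s * deg i) = 1 := by
    rw [zpow_sub₀ hω, mul_right_cancel₀ h e, div_self (zpow_ne_zero _ hω)]
  obtain ⟨q, hq⟩ := (T.isPrimitiveRoot.zpow_eq_one_iff_dvd _).1 e2
  have hk : 0 ≤ (s : ℤ) * k := by
    by_contra! hc
    exact h (by rw [h2 k hc, map_zero])
  have hsk : (s : ℤ) * k = deg i + 3 * (s * q) := by
    linear_combination (s : ℤ) * hq + (deg i : ℤ) * hs
  -- A negative quotient could occur only for `deg i = 3` and `k = 0`. The condition that the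
  -- constant term lies in `𝔫` rules this out, which is why the `d` vectors have degree 3 and not 0.
  have hsq : 0 ≤ (s : ℤ) * q := by
    by_contra! hc
    have hd := T.deg_le i
    have h0 : (s : ℤ) * k = 0 := by lia
    have hd3 : deg i = 3 := by lia
    have hk0 : k = 0 := by simpa using h0
    subst hk0
    exact h (T.coord_n _ h3 i hd3)
  refine ⟨((s : ℤ) * q).toNat, ?_⟩
  rw [Int.toNat_of_nonneg hsq, ← hsk, ← mul_assoc, hs, one_mul]

theorem span_loopVec :
    Submodule.span ℂ (Set.range (T.loopVec hω)) = ⊤ := by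
  set N := (nilLoop σ ω hω s 𝔫).toSubmodule
  have hmap : Submodule.map N.subtype (Submodule.span ℂ (Set.range (T.loopVec hω))) =
      Submodule.span ℂ (Set.range fun i => (T.loopVec hω i : Loop L)) := by
    rw [Submodule.map_span, ← Set.range_comp]; rfl
  rw [eq_top_iff]
  rintro x -
  have hx : (x : Loop L) ∈ Submodule.span ℂ (Set.range fun i => (T.loopVec hω i : Loop L)) := by
    rw [← x.1.sum_single]
    refine Submodule.sum_mem _ fun k _ => ?_
    rw [← T.sum_coord (x.1 k), ← Finsupp.singleAddHom_apply, map_sum]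
    refine Submodule.sum_mem _ fun i _ => ?_
    rw [Finsupp.singleAddHom_apply, ← Finsupp.smul_single]
    by_cases h : T.coord i (x.1 k) = 0
    · rw [h, zero_smul]; exact zero_mem _
    · obtain ⟨m, rfl⟩ := T.exists_of_coord_ne_zero hω x.2 k i h
      exact Submodule.smul_mem _ _ (Submodule.subset_span ⟨(i, m), rfl⟩)
  rw [← hmap] at hx
  obtain ⟨y, hy, hyx⟩ := hx
  rwa [← Subtype.ext hyx]

theorem loopVec_table₁ (i : Fin 17 × ℕ) : br (T.loopVec hω (0, 0)) (T.loopVec hω i) =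
    c₁ i.1 • T.loopVec hω (t₁ i.1, i.2 + d₁ i.1) := by
  refine Subtype.ext ?_
  change loopBr (Finsupp.single _ _) (Finsupp.single _ _) = c₁ i.1 • Finsupp.single _ _
  rw [loopBr_single, T.table₁, Finsupp.smul_single]
  by_cases h : c₁ i.1 = 0
  · simp [h]
  · congr 1
    have := T.deg₁ _ h
    simp only [T.deg_zero]
    rw [← this]; push_cast; ring

theorem loopVec_table₂ (i : Fin 17 × ℕ) : br (T.loopVec hω (2, 0)) (T.loopVec hω i) =
    c₂ i.1 • T.loopVec hω (t₂ i.1, i.2 + d₂ i.1) := by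
  refine Subtype.ext ?_
  change loopBr (Finsupp.single _ _) (Finsupp.single _ _) = c₂ i.1 • Finsupp.single _ _
  rw [loopBr_single, T.table₂, Finsupp.smul_single]
  by_cases h : c₂ i.1 = 0
  · simp [h]
  · congr 1
    have := T.deg₂ _ h
    have h' : (deg (t₂ i.1) : ℤ) + 3 * d₂ i.1 = deg i.1 + 1 := by exact_mod_cast this
    simp only [T.deg_two]
    push_cast; linear_combination (-s : ℤ) * h'

theorem loopVec_mem (i : Fin 17 × ℕ) :
    T.loopVec hω i ∈ part (L := (nilLoop σ ω hω s 𝔫).toSubmodule) (pr i.1) :=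
  single_mem_loopPart (L := L) _ (T.u_mem i.1)

/-- The linear map with given values on the root vectors. -/
noncomputable def lift {M : Type} [AddCommGroup M] [Module ℂ M] (X : Fin 17 × ℕ → M) :
    Loop L →ₗ[ℂ] M :=
  -- Division with rounding and `toNat` give arbitrary values off the half loop algebra; only the
  -- exponents of `loopVec`, where the quotient is exact, matter.
  Finsupp.lsum ℂ fun k => ∑ i, (T.coord i).smulRight (X (i, ((s * k - deg i) / 3).toNat))

theorem lift_loopVec {M : Type} [AddCommGroup M] [Module ℂ M] (X : Fin 17 × ℕ → M)
    (i : Fin 17 × ℕ) : T.lift X (T.loopVec hω i) = X i := by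
  have hs := unit_mul_self s
  have h : ((s : ℤ) * (s * (deg i.1 + 3 * i.2)) - deg i.1) / 3 = i.2 := by
    rw [← mul_assoc, hs, one_mul, add_sub_cancel_left]
    exact Int.mul_ediv_cancel_left _ (by norm_num)
  simp [lift, loopVec, T.coord_u, h]

/-- The homomorphism with given values on the root vectors. -/
theorem exists_hom {M : Type} [AddCommGroup M] [Module ℂ M]
    [LieSuperalgebra M] (X : Fin 17 → ℕ → M) (h1 : X 0 0 ∈ part (L := M) (pr 0))
    (h2 : X 2 0 ∈ part (L := M) (pr 2)) (X₁ : IsTable c₁ t₁ d₁ (X 0 0) X)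
    (X₂ : IsTable c₂ t₂ d₂ (X 2 0) X) :
    ∃ f : Hom (nilLoop σ ω hω s 𝔫).toSubmodule M, ∀ i m, f (T.loopVec hω (i, m)) = X i m := by
  have hX := mem_part_of_tables (X := fun i : Fin 17 × ℕ => X i.1 i.2) (pr := fun i => pr i.1)
    T.reaches (fun i => T.pr₁ i.1) (fun i => T.pr₂ i.1) h1 h2
    (fun i => X₁ i.1 i.2) (fun i => X₂ i.1 i.2)
  set f := (T.lift fun i => X i.1 i.2) ∘ₗ (nilLoop σ ω hω s 𝔫).toSubmodule.subtype
  have hf : ∀ i, f (T.loopVec hω i) = X i.1 i.2 := T.lift_loopVec hω fun i => X i.1 i.2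
  refine ⟨⟨f, ?_, ?_⟩, fun i m => hf (i, m)⟩
  · exact map_br_of_tables (X := fun i : Fin 17 × ℕ => X i.1 i.2) (pr := fun i => pr i.1) f hf
      (T.span_loopVec hω) T.reaches (fun i => T.pr₁ i.1) (fun i => T.pr₂ i.1)
      (T.loopVec_mem hω) h1 h2 (T.loopVec_table₁ hω) (T.loopVec_table₂ hω)
      (fun i => X₁ i.1 i.2) (fun i => X₂ i.1 i.2)
  · exact map_part_of_span f (T.span_loopVec hω) (T.loopVec_mem hω)
      (fun i => by rw [hf]; exact hX i)

/-- Existence comes from transporting the table, uniqueness from generation by the two root vectors;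
the relations enter only through the existence of a table in `M`. -/
theorem isPresentedBy_loop
    (R : ∀ (M : Type) [AddCommGroup M] [Module ℂ M] [LieSuperalgebra M], M → M → Prop)
    (hR : R (nilLoop σ ω hω s 𝔫).toSubmodule (T.loopVec hω (0, 0)) (T.loopVec hω (2, 0)))
    (hX : ∀ (M : Type) [AddCommGroup M] [Module ℂ M] [LieSuperalgebra M],
      ∀ m₁ ∈ part (L := M) (pr 0), ∀ m₂ ∈ part (L := M) (pr 2), R M m₁ m₂ →
      ∃ X : Fin 17 → ℕ → M, X 0 0 = m₁ ∧ X 2 0 = m₂ ∧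
        IsTable c₁ t₁ d₁ m₁ X ∧ IsTable c₂ t₂ d₂ m₂ X) :
    IsPresentedBy (pr 0) (pr 2) R (T.loopVec hω (0, 0)) (T.loopVec hω (2, 0)) := by
  refine ⟨T.loopVec_mem hω (0, 0), T.loopVec_mem hω (2, 0), hR, ?_⟩
  intro M _ _ _ m₁ h₁ m₂ h₂ h
  obtain ⟨X, rfl, rfl, X₁, X₂⟩ := hX M m₁ h₁ m₂ h₂ h
  obtain ⟨f, hf⟩ := T.exists_hom hω X h₁ h₂ X₁ X₂
  refine ⟨f, ⟨hf 0 0, hf 2 0⟩, fun g hg => ?_⟩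
  exact Hom.eq_of_tables (T.span_loopVec hω) T.reaches (T.loopVec_table₁ hω)
    (T.loopVec_table₂ hω) g f (by rw [hg.1, hf]) (by rw [hg.2, hf])

omit T [LieSuperalgebra L] in
theorem _root_.LieSuperalgebra.span_of_sum_coord {coord : Fin 17 → L →ₗ[ℂ] ℂ}
    (h : ∀ v, ∑ i, coord i v • u i = v) : Submodule.span ℂ (Set.range u) = ⊤ := by
  rw [eq_top_iff]
  rintro v -
  rw [← h v]
  exact Submodule.sum_mem _ fun i _ => Submodule.smul_mem _ _ (Submodule.subset_span ⟨i, rfl⟩)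

/-- Forgetting the block number turns a path in the loop algebra into one in the finite table. -/
theorem reaches_fin : Reaches (ι := Fin 17) 0 2 c₁ c₂ t₁ t₂ := by
  intro P h0 h2 h₁ h₂ i
  exact T.reaches (fun i => P i.1) h0 h2 (fun i => h₁ i.1) (fun i => h₂ i.1) (i, 0)

/-- The hypothesis `hper` is what relations 4 and 5 provide: the generators of block 1 have the same
image as those of block 0. -/
theorem isPresentedBy_base
    (R : ∀ (M : Type) [AddCommGroup M] [Module ℂ M] [LieSuperalgebra M], M → M → Prop)
    (hR : R L (u 0) (u 2))
    (hX : ∀ (M : Type) [AddCommGroup M] [Module ℂ M] [LieSuperalgebra M],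
      ∀ m₁ ∈ part (L := M) (pr 0), ∀ m₂ ∈ part (L := M) (pr 2), R M m₁ m₂ →
      ∃ X : Fin 17 → ℕ → M, X 0 0 = m₁ ∧ X 2 0 = m₂ ∧
        IsTable c₁ t₁ d₁ m₁ X ∧ IsTable c₂ t₂ d₂ m₂ X)
    (hper : ∀ (M : Type) [AddCommGroup M] [Module ℂ M] [LieSuperalgebra M],
      ∀ m₁ m₂ : M, R M m₁ m₂ → ∀ f : Hom (nilLoop σ ω hω s 𝔫).toSubmodule M,
      f (T.loopVec hω (0, 0)) = m₁ → f (T.loopVec hω (2, 0)) = m₂ →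
      f (T.loopVec hω (0, 1)) = m₁ ∧ f (T.loopVec hω (2, 1)) = m₂) :
    IsPresentedBy (pr 0) (pr 2) R (u 0) (u 2) := by
  refine ⟨T.u_mem 0, T.u_mem 2, hR, ?_⟩
  intro M _ _ _ m₁ h₁ m₂ h₂ h
  obtain ⟨X, rfl, rfl, X₁, X₂⟩ := hX M m₁ h₁ m₂ h₂ h
  obtain ⟨f, hf⟩ := T.exists_hom hω X h₁ h₂ X₁ X₂
  obtain ⟨q₁, q₂⟩ := hper M _ _ h f (hf 0 0) (hf 2 0)
  rw [hf] at q₁ q₂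
  -- Block independence holds at the two generators and passes along arrows, because source and
  -- target shift together; hence all the vectors are periodic and the table collapses to 17
  -- indices.
  have per : ∀ i m, X i (m + 1) = X i m := by
    have H := T.reaches (fun i => X i.1 (i.2 + 1) = X i.1 i.2) q₁ q₂
      (fun i hc hi => ?_) (fun i hc hi => ?_)
    · exact fun i m => H (i, m)
    · have e := X₁ i.1 (i.2 + 1)
      rw [hi, X₁ i.1 i.2] at e
      have e' := smul_right_injective M hc e
      simp only at e' ⊢
      rw [e', add_right_comm]
    · have e := X₂ i.1 (i.2 + 1)
      rw [hi, X₂ i.1 i.2] at e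
      have e' := smul_right_injective M hc e
      simp only at e' ⊢
      rw [e', add_right_comm]
  have per' : ∀ i m, X i m = X i 0 := fun i m => by
    induction m with
    | zero => rfl
    | succ m ih => rw [per, ih]
  have Y₁ : ∀ i, br (X 0 0) (X i 0) = c₁ i • X (t₁ i) 0 := fun i => by rw [X₁ i 0, per']
  have Y₂ : ∀ i, br (X 2 0) (X i 0) = c₂ i • X (t₂ i) 0 := fun i => by rw [X₂ i 0, per']
  have hm := mem_part_of_tables (X := fun i => X i 0) T.reaches_fin T.pr₁ T.pr₂ h₁ h₂ Y₁ Y₂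
  have hspan := span_of_sum_coord T.sum_coord
  set g : L →ₗ[ℂ] M := ∑ i, (T.coord i).smulRight (X i 0) with hg
  have hgu : ∀ i, g (u i) = X i 0 := fun i => by simp [hg, T.coord_u]
  refine ⟨⟨g, ?_, ?_⟩, ⟨hgu 0, hgu 2⟩, fun g' hg' => ?_⟩
  · exact map_br_of_tables (X := fun i => X i 0) g hgu hspan T.reaches_fin T.pr₁ T.pr₂ T.u_mem
      h₁ h₂ T.table₁ T.table₂ Y₁ Y₂
  · exact map_part_of_span g hspan T.u_mem (fun i => by rw [hgu]; exact hm i)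
  · exact Hom.eq_of_tables hspan T.reaches_fin T.table₁ T.table₂ _ _
      (hg'.1.trans (hgu 0).symm) (hg'.2.trans (hgu 2).symm)

end RootBasis

end LieSuperalgebra

/-! ### Coordinates on `D(2,1;α)`. -/

namespace D21

section

attribute [local instance] LieRing.ofAssociativeRing LieAlgebra.ofAssociativeAlgebra

/-- The matrix `(a b; c -a)`. -/
noncomputable def slMat (a b c : ℂ) : LieAlgebra.SpecialLinear.sl (Fin 2) ℂ :=
  ⟨!![a, b; c, -a], by
    change !![a, b; c, -a] ∈ LinearMap.ker (Matrix.traceLinearMap (Fin 2) ℂ ℂ)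
    simp [Matrix.trace_fin_two]⟩

/-- An odd element in coordinates. -/
def odd (x000 x001 x010 x011 x100 x101 x110 x111 : ℂ) : Odd := fun t =>
  ![![![x000, x001], ![x010, x011]], ![![x100, x101], ![x110, x111]]] (t 0) (t 1) (t 2)

/-- An element of `D(2,1;α)` in coordinates. -/
noncomputable def mk (α : ℂ) (a0 b0 c0 a1 b1 c1 a2 b2 c2
    x000 x001 x010 x011 x100 x101 x110 x111 : ℂ) : D21 α :=
  ((![slMat a0 b0 c0, slMat a1 b1 c1, slMat a2 b2 c2] : Even), odd x000 x001 x010 x011 x100 x101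
        x110 x111)

theorem slMat_self (X : LieAlgebra.SpecialLinear.sl (Fin 2) ℂ) :
    slMat (X.1 0 0) (X.1 0 1) (X.1 1 0) = X := by
  refine Subtype.ext ?_
  ext i j
  fin_cases i <;> fin_cases j <;> simp [slMat, sl_trace]

theorem ext_sl {X Y : LieAlgebra.SpecialLinear.sl (Fin 2) ℂ} (h1 : X.1 0 0 = Y.1 0 0)
    (h2 : X.1 0 1 = Y.1 0 1) (h3 : X.1 1 0 = Y.1 1 0) : X = Y := by
  rw [← slMat_self X, ← slMat_self Y, h1, h2, h3]

theorem ext_odd {φ ψ : Odd} (h : ∀ a b c, φ ![a, b, c] = ψ ![a, b, c]) : φ = ψ := by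
  funext t
  obtain ⟨a, b, c, rfl⟩ := exists_tri t
  exact h a b c

theorem exists_mk {α : ℂ} (v : D21 α) : ∃ a0 b0 c0 a1 b1 c1 a2 b2 c2 x000 x001 x010 x011 x100
        x101 x110 x111, v = mk α
    a0 b0 c0 a1 b1 c1 a2 b2 c2 x000 x001 x010 x011 x100 x101 x110 x111 := by
  obtain ⟨A, φ⟩ := v
  refine ⟨(A 0).1 0 0, (A 0).1 0 1, (A 0).1 1 0, (A 1).1 0 0, (A 1).1 0 1, (A 1).1 1 0,
    (A 2).1 0 0, (A 2).1 0 1, (A 2).1 1 0, φ ![0, 0, 0], φ ![0, 0, 1], φ ![0, 1, 0], φ ![0, 1, 1],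
    φ ![1, 0, 0], φ ![1, 0, 1], φ ![1, 1, 0], φ ![1, 1, 1], Prod.ext (funext fun s => ?_)
    (ext_odd fun a b c => ?_)⟩
  · fin_cases s <;> simp [mk, slMat_self]
  · fin_cases a <;> fin_cases b <;> fin_cases c <;> simp [mk, odd]

theorem fst_add {α : ℂ} (v w : D21 α) : (v + w).1 = (v.1 + w.1 : Even) := rfl

theorem snd_add {α : ℂ} (v w : D21 α) : (v + w).2 = (v.2 + w.2 : Odd) := rfl

theorem fst_smul {α : ℂ} (k : ℂ) (v : D21 α) : (k • v).1 = (k • v.1 : Even) := rfl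

theorem snd_smul {α : ℂ} (k : ℂ) (v : D21 α) : (k • v).2 = (k • v.2 : Odd) := rfl

theorem fst_zero {α : ℂ} : (0 : D21 α).1 = (0 : Even) := rfl

theorem snd_zero {α : ℂ} : (0 : D21 α).2 = (0 : Odd) := rfl

theorem mk_add (α : ℂ) (a0 b0 c0 a1 b1 c1 a2 b2 c2 x000 x001 x010 x011 x100 x101 x110 x111
    a0' b0' c0' a1' b1' c1' a2' b2' c2' x000' x001' x010' x011' x100' x101' x110' x111' : ℂ) :
    mk α a0 b0 c0 a1 b1 c1 a2 b2 c2 x000 x001 x010 x011 x100 x101 x110 x111 +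
      mk α a0' b0' c0' a1' b1' c1' a2' b2' c2'
        x000' x001' x010' x011' x100' x101' x110' x111' =
    mk α (a0 + a0') (b0 + b0') (c0 + c0') (a1 + a1') (b1 + b1') (c1 + c1') (a2 + a2') (b2 + b2')
        (c2 + c2')
      (x000 + x000') (x001 + x001') (x010 + x010') (x011 + x011') (x100 + x100') (x101
        + x101') (x110 + x110') (x111 + x111') := by
  refine Prod.ext (funext fun s => ?_) (ext_odd fun a b c => ?_)
  · rw [fst_add]
    fin_cases s <;> refine ext_sl ?_ ?_ ?_ <;> simp [mk, slMat]
  · rw [snd_add]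
    fin_cases a <;> fin_cases b <;> fin_cases c <;> simp [mk, odd]

theorem smul_mk (α k : ℂ) (a0 b0 c0 a1 b1 c1 a2 b2 c2 x000 x001 x010 x011 x100 x101 x110 x111 :
        ℂ) :
    k • mk α a0 b0 c0 a1 b1 c1 a2 b2 c2 x000 x001 x010 x011 x100 x101 x110 x111 =
    mk α (k * a0) (k * b0) (k * c0) (k * a1) (k * b1) (k * c1) (k * a2) (k * b2) (k * c2)
      (k * x000) (k * x001) (k * x010) (k * x011) (k * x100) (k * x101) (k * x110) (k * x111) :=
        by
  refine Prod.ext (funext fun s => ?_) (ext_odd fun a b c => ?_)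
  · rw [fst_smul]
    fin_cases s <;> refine ext_sl ?_ ?_ ?_ <;> simp [mk, slMat]
  · rw [snd_smul]
    fin_cases a <;> fin_cases b <;> fin_cases c <;> simp [mk, odd]

theorem mk_zero (α : ℂ) : mk α 0 0 0 0 0 0 0 0 0 0 0 0 0 0 0 0 0 = 0 := by
  refine Prod.ext (funext fun s => ?_) (ext_odd fun a b c => ?_)
  · rw [fst_zero]
    fin_cases s <;> refine ext_sl ?_ ?_ ?_ <;> simp [mk, slMat]
  · rw [snd_zero]
    fin_cases a <;> fin_cases b <;> fin_cases c <;> simp [mk, odd]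

theorem br_mk (α : ℂ) (a0 b0 c0 a1 b1 c1 a2 b2 c2 x000 x001 x010 x011 x100 x101 x110 x111
    a0' b0' c0' a1' b1' c1' a2' b2' c2' x000' x001' x010' x011' x100' x101' x110' x111' : ℂ) :
    LieSuperalgebra.br (mk α a0 b0 c0 a1 b1 c1 a2 b2 c2 x000 x001 x010 x011 x100 x101 x110 x111)
      (mk α a0' b0' c0' a1' b1' c1' a2' b2' c2'
        x000' x001' x010' x011' x100' x101' x110' x111') =
    mk α
      (b0 * c0' - c0 * b0' + (-x000 * x111' + x001 * x110' + x010 * x101' - x011 * x100'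
        - x100 * x011' + x101 * x010' + x110 * x001' - x111 * x000'))
      (2 * a0 * b0' - 2 * b0 * a0' + (2 * x000 * x011' - 2 * x001 * x010' - 2 * x010 * x001'
        + 2 * x011 * x000'))
      (2 * c0 * a0' - 2 * a0 * c0' + (-2 * x100 * x111' + 2 * x101 * x110' + 2 * x110 * x101'
        - 2 * x111 * x100'))
      (b1 * c1' - c1 * b1' +
        α * (-x000 * x111' + x001 * x110' - x010 * x101' + x011 * x100' + x100 * x011'
        - x101 * x010' + x110 * x001' - x111 * x000'))
      (2 * a1 * b1' - 2 * b1 * a1' +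
        α * (2 * x000 * x101' - 2 * x001 * x100' - 2 * x100 * x001' + 2 * x101 * x000'))
      (2 * c1 * a1' - 2 * a1 * c1' +
        α * (-2 * x010 * x111' + 2 * x011 * x110' + 2 * x110 * x011' - 2 * x111 * x010'))
      (b2 * c2' - c2 * b2' +
        (-1 - α) * (-x000 * x111' - x001 * x110' + x010 * x101' + x011 * x100' + x100 * x011'
        + x101 * x010' - x110 * x001' - x111 * x000'))
      (2 * a2 * b2' - 2 * b2 * a2' +
        (-1 - α) * (2 * x000 * x110' - 2 * x010 * x100' - 2 * x100 * x010' + 2 * x110 * x000'))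
      (2 * c2 * a2' - 2 * a2 * c2' +
        (-1 - α) * (-2 * x001 * x111' + 2 * x011 * x101' + 2 * x101 * x011' - 2 * x111 * x001'))
      (a0 * x000' - x000 * a0' + b0 * x100' - x100 * b0' + a1 * x000' - x000 * a1' + b1 * x010'
        - x010 * b1' + a2 * x000' - x000 * a2' + b2 * x001' - x001 * b2')
      (a0 * x001' - x001 * a0' + b0 * x101' - x101 * b0' + a1 * x001' - x001 * a1' + b1 * x011'
        - x011 * b1' + c2 * x000' - x000 * c2' - a2 * x001' + x001 * a2')
      (a0 * x010' - x010 * a0' + b0 * x110' - x110 * b0' + c1 * x000' - x000 * c1' - a1 * x010'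
        + x010 * a1' + a2 * x010' - x010 * a2' + b2 * x011' - x011 * b2')
      (a0 * x011' - x011 * a0' + b0 * x111' - x111 * b0' + c1 * x001' - x001 * c1' - a1 * x011'
        + x011 * a1' + c2 * x010' - x010 * c2' - a2 * x011' + x011 * a2')
      (c0 * x000' - x000 * c0' - a0 * x100' + x100 * a0' + a1 * x100' - x100 * a1' + b1 * x110'
        - x110 * b1' + a2 * x100' - x100 * a2' + b2 * x101' - x101 * b2')
      (c0 * x001' - x001 * c0' - a0 * x101' + x101 * a0' + a1 * x101' - x101 * a1' + b1 * x111'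
        - x111 * b1' + c2 * x100' - x100 * c2' - a2 * x101' + x101 * a2')
      (c0 * x010' - x010 * c0' - a0 * x110' + x110 * a0' + c1 * x100' - x100 * c1' - a1 * x110'
        + x110 * a1' + a2 * x110' - x110 * a2' + b2 * x111' - x111 * b2')
      (c0 * x011' - x011 * c0' - a0 * x111' + x111 * a0' + c1 * x101' - x101 * c1' - a1 * x111'
        + x111 * a1' + c2 * x110' - x110 * c2' - a2 * x111' + x111 * a2') := by
  change bracket α (_, _) (_, _) = _
  rw [bracket_apply]
  obtain ⟨h1, h2, h3, h4⟩ := J_eval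
  refine Prod.ext (funext fun s => ?_) (ext_odd fun a b c => ?_)
  · fin_cases s <;> refine ext_sl ?_ ?_ ?_ <;>
      simp [mk, slMat, odd, pair, weight, pairMat_zero, pairMat_one, pairMat_two, h1, h2, h3, h4,
        Ring.lie_def, Fin.sum_univ_two] <;> ring
  · fin_cases a <;> fin_cases b <;> fin_cases c <;>
      simp [mk, slMat, odd, act_tri] <;> ring

end

end D21

/-! ### The automorphisms `σ₊`, `σ₋` and `τ`. -/

namespace D21

open LieSuperalgebra

section

attribute [local instance] LieRing.ofAssociativeRing LieAlgebra.ofAssociativeAlgebra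

theorem mk_congr {α a0 b0 c0 a1 b1 c1 a2 b2 c2 x000 x001 x010 x011 x100 x101 x110 x111
    a0' b0' c0' a1' b1' c1' a2' b2' c2' x000' x001' x010' x011' x100' x101' x110' x111' : ℂ}
    (h1 : a0 = a0') (h2 : b0 = b0') (h3 : c0 = c0') (h4 : a1 = a1') (h5 : b1 = b1') (h6 : c1 = c1')
    (h7 : a2 = a2') (h8 : b2 = b2') (h9 : c2 = c2') (h10 : x000 = x000') (h11 : x001 = x001')
    (h12 : x010 = x010') (h13 : x011 = x011') (h14 : x100 = x100') (h15 : x101 = x101')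
    (h16 : x110 = x110') (h17 : x111 = x111') :
    mk α a0 b0 c0 a1 b1 c1 a2 b2 c2 x000 x001 x010 x011 x100 x101 x110 x111 =
      mk α a0' b0' c0' a1' b1' c1' a2' b2' c2' x000' x001' x010' x011' x100' x101' x110' x111' := by
  subst_vars; rfl

/-- The cyclic permutation of the tensor factors, times `ε`. -/
noncomputable def rotLin (ε : ℂ) : D21 ε →ₗ[ℂ] D21 ε where
  toFun v := ((fun s => v.1 (s + 2) : Even), (fun t => ε * v.2 (fun j => t (j + 1)) : Odd))
  map_add' _ _ := Prod.ext rfl (funext fun _ => mul_add _ _ _)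
  map_smul' _ _ := Prod.ext rfl (funext fun _ => mul_left_comm _ _ _)

theorem rotLin_mk (ε a0 b0 c0 a1 b1 c1 a2 b2 c2 x000 x001 x010 x011 x100 x101 x110 x111 : ℂ) :
    rotLin ε (mk ε a0 b0 c0 a1 b1 c1 a2 b2 c2 x000 x001 x010 x011 x100 x101 x110 x111) =
    mk ε a2 b2 c2 a0 b0 c0 a1 b1 c1 (ε * x000) (ε * x010) (ε * x100) (ε * x110) (ε * x001)
      (ε * x011) (ε * x101) (ε * x111) := by
  refine Prod.ext (funext fun s => ?_) (ext_odd fun a b c => ?_)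
  · fin_cases s <;> rfl
  · fin_cases a <;> fin_cases b <;> fin_cases c <;> rfl

/-- Conjugation by a diagonal matrix of determinant `-1`. -/
noncomputable def slFlip (X : LieAlgebra.SpecialLinear.sl (Fin 2) ℂ) :
    LieAlgebra.SpecialLinear.sl (Fin 2) ℂ := slMat (X.1 0 0) (-X.1 0 1) (-X.1 1 0)

/-- The even part of the change of sign of `X⁺₂` and `X⁻₂`. -/
noncomputable def flipEven : Even →ₗ[ℂ] Even where
  toFun A := ![slFlip (A 0), A 1, slFlip (A 2)]
  map_add' A B := funext fun s => by
    fin_cases s <;> refine ext_sl ?_ ?_ ?_ <;> simp [slFlip, slMat] <;> ring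
  map_smul' k A := funext fun s => by
    fin_cases s <;> refine ext_sl ?_ ?_ ?_ <;> simp [slFlip, slMat]

/-- The odd part of the change of sign of `X⁺₂` and `X⁻₂`. -/
def flipOdd : Odd →ₗ[ℂ] Odd where
  toFun φ t := if t 0 = t 2 then -φ t else φ t
  map_add' φ ψ := funext fun t => by
    by_cases h : t 0 = t 2 <;> simp [h]; ring
  map_smul' k φ := funext fun t => by
    by_cases h : t 0 = t 2 <;> simp [h]

/-- The change of sign of `X⁺₂` and `X⁻₂`. -/
noncomputable def flipLin (ε : ℂ) : D21 ε →ₗ[ℂ] D21 ε where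
  toFun v := (flipEven v.1, flipOdd v.2)
  map_add' v w := Prod.ext (map_add flipEven v.1 w.1) (map_add flipOdd v.2 w.2)
  map_smul' k v := Prod.ext (map_smul flipEven k v.1) (map_smul flipOdd k v.2)

theorem flipLin_mk (ε a0 b0 c0 a1 b1 c1 a2 b2 c2 x000 x001 x010 x011 x100 x101 x110 x111 : ℂ) :
    flipLin ε (mk ε a0 b0 c0 a1 b1 c1 a2 b2 c2 x000 x001 x010 x011 x100 x101 x110 x111) =
    mk ε a0 (-b0) (-c0) a1 b1 c1 a2 (-b2) (-c2) (-x000) x001 (-x010) x011 x100 (-x101)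
      x110 (-x111) := by
  refine Prod.ext (funext fun s => ?_) (ext_odd fun a b c => ?_)
  · change flipEven ![slMat a0 b0 c0, slMat a1 b1 c1, slMat a2 b2 c2] s =
      (![slMat a0 (-b0) (-c0), slMat a1 b1 c1, slMat a2 (-b2) (-c2)] : Even) s
    fin_cases s <;> refine ext_sl ?_ ?_ ?_ <;> simp [flipEven, slFlip, slMat]
  · change flipOdd (odd x000 x001 x010 x011 x100 x101 x110 x111) ![a, b, c] =
      odd (-x000) x001 (-x010) x011 x100 (-x101) x110 (-x111) ![a, b, c]
    fin_cases a <;> fin_cases b <;> fin_cases c <;> simp [flipOdd, odd]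

theorem Xp_zero (ε : ℂ) : Xp ε 0 = mk ε 0 0 0 0 0 0 0 0 0 0 0 0 0 1 0 0 0 := by
  refine Prod.ext (funext fun s => ?_) (ext_odd fun a b c => ?_)
  · fin_cases s <;> refine ext_sl ?_ ?_ ?_ <;> simp [Xp, mk, slMat]
  · fin_cases a <;> fin_cases b <;> fin_cases c <;>
      simp [Xp, mk, odd, Pi.single_apply, funext_iff, Fin.forall_fin_succ]

theorem Xp_one (ε : ℂ) : Xp ε 1 = mk ε 0 0 0 0 0 0 0 0 0 0 0 1 0 0 0 0 0 := by
  refine Prod.ext (funext fun s => ?_) (ext_odd fun a b c => ?_)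
  · fin_cases s <;> refine ext_sl ?_ ?_ ?_ <;> simp [Xp, mk, slMat]
  · fin_cases a <;> fin_cases b <;> fin_cases c <;>
      simp [Xp, mk, odd, Pi.single_apply, funext_iff, Fin.forall_fin_succ]

theorem Xp_two (ε : ℂ) : Xp ε 2 = mk ε 0 0 0 0 0 0 0 0 0 0 1 0 0 0 0 0 0 := by
  refine Prod.ext (funext fun s => ?_) (ext_odd fun a b c => ?_)
  · fin_cases s <;> refine ext_sl ?_ ?_ ?_ <;> simp [Xp, mk, slMat]
  · fin_cases a <;> fin_cases b <;> fin_cases c <;>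
      simp [Xp, mk, odd, Pi.single_apply, funext_iff, Fin.forall_fin_succ]

theorem Xm_zero (ε : ℂ) : Xm ε 0 = mk ε 0 0 0 0 0 0 0 0 0 0 0 0 (ε / 2) 0 0 0 0 := by
  refine Prod.ext (funext fun s => ?_) (ext_odd fun a b c => ?_)
  · fin_cases s <;> refine ext_sl ?_ ?_ ?_ <;> simp [Xm, mk, slMat]
  · fin_cases a <;> fin_cases b <;> fin_cases c <;>
      simp [Xm, mk, odd, Pi.single_apply, funext_iff, Fin.forall_fin_succ]

theorem Xm_one (ε : ℂ) : Xm ε 1 = mk ε 0 0 0 0 0 0 0 0 0 0 0 0 0 0 (-ε / 2) 0 0 := by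
  refine Prod.ext (funext fun s => ?_) (ext_odd fun a b c => ?_)
  · fin_cases s <;> refine ext_sl ?_ ?_ ?_ <;> simp [Xm, mk, slMat]
  · fin_cases a <;> fin_cases b <;> fin_cases c <;>
      simp [Xm, mk, odd, Pi.single_apply, funext_iff, Fin.forall_fin_succ]

theorem Xm_two (ε : ℂ) : Xm ε 2 = mk ε 0 0 0 0 0 0 0 0 0 0 0 0 0 0 0 (ε / 2) 0 := by
  refine Prod.ext (funext fun s => ?_) (ext_odd fun a b c => ?_)
  · fin_cases s <;> refine ext_sl ?_ ?_ ?_ <;> simp [Xm, mk, slMat]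
  · fin_cases a <;> fin_cases b <;> fin_cases c <;>
      simp [Xm, mk, odd, Pi.single_apply, funext_iff, Fin.forall_fin_succ]

theorem mem_part_zero {α : ℂ} {v : D21 α} : v ∈ part (L := D21 α) 0 ↔ v.2 = 0 := mem_parts_zero

theorem mem_part_one {α : ℂ} {v : D21 α} : v ∈ part (L := D21 α) 1 ↔ v.1 = 0 := mem_parts_one

theorem sq_add_add_one {ε : ℂ} (hε : IsPrimitiveRoot ε 3) : ε ^ 2 + ε + 1 = 0 := by
  have h1 : ε ≠ 1 := hε.ne_one (by norm_num)
  have h3 := hε.pow_eq_one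
  refine (mul_eq_zero.1 (?_ : (ε - 1) * (ε ^ 2 + ε + 1) = 0)).resolve_left (sub_ne_zero.2 h1)
  linear_combination h3

/-- The automorphism `σ₊`. -/
noncomputable def rot (ε : ℂ) (hε : IsPrimitiveRoot ε 3) : Hom (D21 ε) (D21 ε) where
  toLinearMap := rotLin ε
  -- The scalar `ε` on the odd part multiplies odd brackets by `ε²`. The structure constants are `1,
  -- ε, ε²`, so this factor exactly undoes their cyclic permutation.
  map_br x y := by
    have h := sq_add_add_one hε
    have h3 := hε.pow_eq_one
    obtain ⟨a0, b0, c0, a1, b1, c1, a2, b2, c2, x000, x001, x010, x011, x100, x101, x110, x111,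
      rfl⟩ := exists_mk x
    obtain ⟨a0', b0', c0', a1', b1', c1', a2', b2', c2', x000', x001', x010', x011', x100', x101',
      x110', x111', rfl⟩ := exists_mk y
    change rotLin ε _ = br (rotLin ε _) (rotLin ε _)
    rw [rotLin_mk, rotLin_mk, br_mk, br_mk, rotLin_mk]
    refine mk_congr ?_ ?_ ?_ ?_ ?_ ?_ ?_ ?_ ?_ ?_ ?_ ?_ ?_ ?_ ?_ ?_ ?_ <;> first | ring1 | grind
  map_part i x hx := by
    rcases zmod_two i with rfl | rfl
    · rw [mem_part_zero] at hx ⊢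
      refine funext fun t => ?_
      change ε * x.2 _ = 0
      rw [hx, Pi.zero_apply, mul_zero]
    · rw [mem_part_one] at hx ⊢
      refine funext fun s => ?_
      change x.1 _ = 0
      rw [hx, Pi.zero_apply]

/-- The automorphism `τ`. -/
noncomputable def flip (ε : ℂ) : Hom (D21 ε) (D21 ε) where
  toLinearMap := flipLin ε
  map_br x y := by
    obtain ⟨a0, b0, c0, a1, b1, c1, a2, b2, c2, x000, x001, x010, x011, x100, x101, x110, x111,
      rfl⟩ := exists_mk x
    obtain ⟨a0', b0', c0', a1', b1', c1', a2', b2', c2', x000', x001', x010', x011', x100', x101',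
      x110', x111', rfl⟩ := exists_mk y
    change flipLin ε _ = br (flipLin ε _) (flipLin ε _)
    rw [flipLin_mk, flipLin_mk, br_mk, br_mk, flipLin_mk]
    refine mk_congr ?_ ?_ ?_ ?_ ?_ ?_ ?_ ?_ ?_ ?_ ?_ ?_ ?_ ?_ ?_ ?_ ?_ <;> ring
  map_part i x hx := by
    rcases zmod_two i with rfl | rfl
    · rw [mem_part_zero] at hx ⊢
      change flipOdd x.2 = 0
      rw [hx, map_zero]
    · rw [mem_part_one] at hx ⊢
      change flipEven x.1 = 0
      rw [hx, map_zero]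

theorem flip_flip (ε : ℂ) (x : D21 ε) : flip ε (flip ε x) = x := by
  obtain ⟨a0, b0, c0, a1, b1, c1, a2, b2, c2, x000, x001, x010, x011, x100, x101, x110, x111,
      rfl⟩ := exists_mk x
  change flipLin ε (flipLin ε _) = _
  rw [flipLin_mk, flipLin_mk]
  simp only [neg_neg]

/-- The automorphism `σ₋ = τ σ₊ τ`. -/
noncomputable def rotFlip (ε : ℂ) (hε : IsPrimitiveRoot ε 3) : Hom (D21 ε) (D21 ε) where
  toLinearMap := flipLin ε ∘ₗ rotLin ε ∘ₗ flipLin ε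
  map_br x y := by
    change flip ε (rot ε hε (flip ε _)) = br (flip ε (rot ε hε (flip ε _)))
      (flip ε (rot ε hε (flip ε _)))
    rw [show ∀ x y, flip ε (br x y) = br (flip ε x) (flip ε y) from (flip ε).map_br,
      show ∀ x y, rot ε hε (br x y) = br (rot ε hε x) (rot ε hε y) from (rot ε hε).map_br,
      show ∀ x y, flip ε (br x y) = br (flip ε x) (flip ε y) from (flip ε).map_br]
  map_part i x hx := (flip ε).map_part i _ ((rot ε hε).map_part i _ ((flip ε).map_part i _ hx))

variable {ε : ℂ} (hε : IsPrimitiveRoot ε 3)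

theorem rot_rot_rot (x : D21 ε) : rot ε hε (rot ε hε (rot ε hε x)) = x := by
  have h3 := hε.pow_eq_one
  obtain ⟨a0, b0, c0, a1, b1, c1, a2, b2, c2, x000, x001, x010, x011, x100, x101, x110, x111,
      rfl⟩ := exists_mk x
  change rotLin ε (rotLin ε (rotLin ε _)) = _
  rw [rotLin_mk, rotLin_mk, rotLin_mk]
  have key : ∀ z : ℂ, ε * (ε * (ε * z)) = z := fun z => by linear_combination z * h3
  simp only [key]

theorem rotFlip_eq (x : D21 ε) : rotFlip ε hε x = flip ε (rot ε hε (flip ε x)) := rfl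

theorem rotFlip_cube (x : D21 ε) : rotFlip ε hε (rotFlip ε hε (rotFlip ε hε x)) = x := by
  simp only [rotFlip_eq, flip_flip, rot_rot_rot]

theorem rotFlip_flip (x : D21 ε) : rotFlip ε hε (flip ε x) = flip ε (rot ε hε x) := by
  rw [rotFlip_eq, flip_flip]

theorem flip_Xp (i : Fin 3) : flip ε (Xp ε i) = (if i = 1 then (-1 : ℂ) else 1) • Xp ε i := by
  change flipLin ε _ = _
  fin_cases i <;> simp only [Fin.reduceFinMk, Fin.zero_eta, Xp_zero, Xp_one, Xp_two, flipLin_mk,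
      smul_mk] <;>
    refine mk_congr ?_ ?_ ?_ ?_ ?_ ?_ ?_ ?_ ?_ ?_ ?_ ?_ ?_ ?_ ?_ ?_ ?_ <;> simp

theorem flip_Xm (i : Fin 3) : flip ε (Xm ε i) = (if i = 1 then (-1 : ℂ) else 1) • Xm ε i := by
  change flipLin ε _ = _
  fin_cases i <;> simp only [Fin.reduceFinMk, Fin.zero_eta, Xm_zero, Xm_one, Xm_two, flipLin_mk,
      smul_mk] <;>
    refine mk_congr ?_ ?_ ?_ ?_ ?_ ?_ ?_ ?_ ?_ ?_ ?_ ?_ ?_ ?_ ?_ ?_ ?_ <;> simp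

theorem rot_Xp (i : Fin 3) : rot ε hε (Xp ε i) = ε • Xp ε (i + 1) := by
  change rotLin ε _ = _
  fin_cases i <;> simp only [Fin.reduceFinMk, Fin.zero_eta, Fin.reduceAdd, zero_add, Xp_zero,
      Xp_one, Xp_two,
    rotLin_mk, smul_mk] <;>
    refine mk_congr ?_ ?_ ?_ ?_ ?_ ?_ ?_ ?_ ?_ ?_ ?_ ?_ ?_ ?_ ?_ ?_ ?_ <;> simp

theorem rotFlip_Xm (i : Fin 3) : rotFlip ε hε (Xm ε i) = ε • Xm ε (i + 1) := by
  change flipLin ε (rotLin ε (flipLin ε _)) = _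
  fin_cases i <;> simp only [Fin.reduceFinMk, Fin.zero_eta, Fin.reduceAdd, zero_add, Xm_zero,
      Xm_one, Xm_two,
    rotLin_mk, flipLin_mk, smul_mk] <;>
    refine mk_congr ?_ ?_ ?_ ?_ ?_ ?_ ?_ ?_ ?_ ?_ ?_ ?_ ?_ ?_ ?_ ?_ ?_ <;> first | simp; done |
        ring1

end

end D21

/-! ### The automorphisms of order three are outer. -/

namespace LieSuperalgebra

/-- Each `exp (ad x)` is a polynomial in `ad x`, so it preserves every subspace stable under the
even part. -/
theorem inner_mem_of_br_mem {L : Type*} [AddCommGroup L] [Module ℂ L] [LieSuperalgebra L]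
    {W : Submodule ℂ L} (hW : ∀ x ∈ part (L := L) 0, ∀ v ∈ W, br x v ∈ W)
    {φ : Module.End ℂ L} (hφ : φ ∈ inner L) : ∀ v ∈ W, φ v ∈ W := by
  induction hφ using Submonoid.closure_induction with
  | mem φ h =>
    obtain ⟨x, hx, n, -, rfl⟩ := h
    intro v hv
    have hpow : ∀ k, ((br x : Module.End ℂ L) ^ k) v ∈ W := by
      intro k
      induction k with
      | zero => exact hv
      | succ k ih => rw [pow_succ']; exact hW x hx _ ih
    rw [LinearMap.sum_apply]
    exact Submodule.sum_mem _ fun k _ => Submodule.smul_mem _ _ (hpow k)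
  | one => exact fun v hv => hv
  | mul φ ψ _ _ h1 h2 => exact fun v hv => h1 _ (h2 v hv)

end LieSuperalgebra

namespace D21

open LieSuperalgebra

section

attribute [local instance] LieRing.ofAssociativeRing LieAlgebra.ofAssociativeAlgebra

/-- The first summand `sl(2)` of the even part. -/
def firstSummand (α : ℂ) : Submodule ℂ (D21 α) where
  carrier := {v | v.2 = 0 ∧ v.1 1 = 0 ∧ v.1 2 = 0}
  add_mem' {v w} hv hw := by
    refine ⟨?_, ?_, ?_⟩
    · rw [snd_add, hv.1, hw.1, add_zero]
    · rw [fst_add, Pi.add_apply, hv.2.1, hw.2.1, add_zero]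
    · rw [fst_add, Pi.add_apply, hv.2.2, hw.2.2, add_zero]
  zero_mem' := ⟨rfl, rfl, rfl⟩
  smul_mem' k v hv := by
    refine ⟨?_, ?_, ?_⟩
    · rw [snd_smul, hv.1, smul_zero]
    · rw [fst_smul, Pi.smul_apply, hv.2.1, smul_zero]
    · rw [fst_smul, Pi.smul_apply, hv.2.2, smul_zero]

theorem br_mem_firstSummand {α : ℂ} {x v : D21 α} (hx : x ∈ part (L := D21 α) 0)
    (hv : v ∈ firstSummand α) : br x v ∈ firstSummand α := by
  obtain ⟨A, φ⟩ := x
  obtain ⟨B, ψ⟩ := v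
  obtain rfl : φ = 0 := mem_part_zero.1 hx
  obtain ⟨h1, h2, h3⟩ := hv
  change ψ = 0 at h1
  change B 1 = 0 at h2
  change B 2 = 0 at h3
  subst h1
  change bracket α (A, 0) (B, 0) ∈ firstSummand α
  rw [bracket_apply]
  refine ⟨?_, ?_, ?_⟩
  · simp [act_zero]
  · simp [pair_zero, h2]
  · simp [pair_zero, h3]

theorem inner_mem_firstSummand {α : ℂ} {φ : Module.End ℂ (D21 α)} (hφ : φ ∈ inner (D21 α)) :
    ∀ v ∈ firstSummand α, φ v ∈ firstSummand α :=
  inner_mem_of_br_mem (fun _ hx _ hv => br_mem_firstSummand hx hv) hφ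

theorem mk_mem_firstSummand (α a b c : ℂ) :
    mk α a b c 0 0 0 0 0 0 0 0 0 0 0 0 0 0 ∈ firstSummand α := by
  refine ⟨ext_odd fun i j k => ?_, ext_sl ?_ ?_ ?_, ext_sl ?_ ?_ ?_⟩ <;>
    try simp [mk, slMat]
  fin_cases i <;> fin_cases j <;> fin_cases k <;> rfl

variable {ε : ℂ} (hε : IsPrimitiveRoot ε 3)

/-- Inner automorphisms preserve each of the three `sl(2)` summands, while `σ₊` permutes them
cyclically; a diagonal element of the first one is a witness. -/
theorem isOuterOfOrderThree_rot : IsOuterOfOrderThree (rot ε hε) where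
  cube := rot_rot_rot hε
  outer h := by
    have h1 := inner_mem_firstSummand h _ (mk_mem_firstSummand ε 1 0 0)
    change rotLin ε _ ∈ _ at h1
    rw [rotLin_mk] at h1
    have h2 : (slMat 1 0 0).1 0 0 = 0 := by
      rw [show slMat 1 0 0 = 0 from h1.2.1]; rfl
    simp [slMat] at h2

theorem isOuterOfOrderThree_rotFlip : IsOuterOfOrderThree (rotFlip ε hε) where
  cube := rotFlip_cube hε
  outer h := by
    have h1 := inner_mem_firstSummand h _ (mk_mem_firstSummand ε 1 0 0)
    change flipLin ε (rotLin ε (flipLin ε _)) ∈ _ at h1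
    rw [flipLin_mk, rotLin_mk, flipLin_mk] at h1
    have h2 : (slMat 1 (-0) (-0)).1 0 0 = 0 := by
      have := h1.2.1
      change slMat 1 (-0) (-0) = 0 at this
      rw [this]; rfl
    simp [slMat] at h2

end

end D21

/-! ### The explicit root vectors and their tables. -/

namespace D21

open LieSuperalgebra

section

attribute [local instance] LieRing.ofAssociativeRing LieAlgebra.ofAssociativeAlgebra

theorem coe_add (X Y : LieAlgebra.SpecialLinear.sl (Fin 2) ℂ) (i j : Fin 2) :
    (X + Y).1 i j = X.1 i j + Y.1 i j := rfl

theorem coe_smul (k : ℂ) (X : LieAlgebra.SpecialLinear.sl (Fin 2) ℂ) (i j : Fin 2) :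
    (k • X).1 i j = k * X.1 i j := rfl

/-- A linear form in coordinates. -/
def form (α : ℂ) (a0 b0 c0 a1 b1 c1 a2 b2 c2 x000 x001 x010 x011 x100 x101 x110 x111 : ℂ) :
    D21 α →ₗ[ℂ] ℂ where
  toFun v := a0 * (v.1 0).1 0 0 + b0 * (v.1 0).1 0 1 + c0 * (v.1 0).1 1 0 +
    a1 * (v.1 1).1 0 0 + b1 * (v.1 1).1 0 1 + c1 * (v.1 1).1 1 0 +
    a2 * (v.1 2).1 0 0 + b2 * (v.1 2).1 0 1 + c2 * (v.1 2).1 1 0 +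
    x000 * v.2 ![0, 0, 0] + x001 * v.2 ![0, 0, 1] + x010 * v.2 ![0, 1, 0] +
    x011 * v.2 ![0, 1, 1] + x100 * v.2 ![1, 0, 0] + x101 * v.2 ![1, 0, 1] +
    x110 * v.2 ![1, 1, 0] + x111 * v.2 ![1, 1, 1]
  map_add' v w := by
    rw [fst_add, snd_add]
    simp only [Pi.add_apply, coe_add]
    ring
  map_smul' k v := by
    rw [fst_smul, snd_smul]
    simp only [Pi.smul_apply, coe_smul, smul_eq_mul, RingHom.id_apply]
    ring

theorem form_mk (α a0 b0 c0 a1 b1 c1 a2 b2 c2 x000 x001 x010 x011 x100 x101 x110 x111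
    a0' b0' c0' a1' b1' c1' a2' b2' c2' x000' x001' x010' x011' x100' x101' x110' x111' : ℂ) :
    form α a0 b0 c0 a1 b1 c1 a2 b2 c2 x000 x001 x010 x011 x100 x101 x110 x111
      (mk α a0' b0' c0' a1' b1' c1' a2' b2' c2' x000' x001' x010' x011' x100' x101' x110' x111') =
    a0 * a0' + b0 * b0' + c0 * c0' + a1 * a1' + b1 * b1' + c1 * c1' + a2 * a2' + b2 * b2' +
      c2 * c2' + x000 * x000' + x001 * x001' + x010 * x010' + x011 * x011' + x100 * x100' +
      x101 * x101' + x110 * x110' + x111 * x111' := rfl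

theorem mk_eq_zero {α a0 b0 c0 a1 b1 c1 a2 b2 c2 x000 x001 x010 x011 x100 x101 x110 x111 : ℂ}
    (h : mk α a0 b0 c0 a1 b1 c1 a2 b2 c2 x000 x001 x010 x011 x100 x101 x110 x111 = 0) :
    a0 = 0 ∧ b0 = 0 ∧ c0 = 0 ∧ a1 = 0 ∧ b1 = 0 ∧ c1 = 0 ∧ a2 = 0 ∧ b2 = 0 ∧ c2 = 0 ∧ x000 = 0 ∧
      x001 = 0 ∧ x010 = 0 ∧ x011 = 0 ∧ x100 = 0 ∧ x101 = 0 ∧ x110 = 0 ∧ x111 = 0 :=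
  ⟨congrArg (fun v : D21 α => (v.1 0).1 0 0) h,
    congrArg (fun v : D21 α => (v.1 0).1 0 1) h,
    congrArg (fun v : D21 α => (v.1 0).1 1 0) h,
    congrArg (fun v : D21 α => (v.1 1).1 0 0) h,
    congrArg (fun v : D21 α => (v.1 1).1 0 1) h,
    congrArg (fun v : D21 α => (v.1 1).1 1 0) h,
    congrArg (fun v : D21 α => (v.1 2).1 0 0) h,
    congrArg (fun v : D21 α => (v.1 2).1 0 1) h,
    congrArg (fun v : D21 α => (v.1 2).1 1 0) h,
    congrArg (fun v : D21 α => v.2 ![0, 0, 0]) h,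
    congrArg (fun v : D21 α => v.2 ![0, 0, 1]) h,
    congrArg (fun v : D21 α => v.2 ![0, 1, 0]) h,
    congrArg (fun v : D21 α => v.2 ![0, 1, 1]) h,
    congrArg (fun v : D21 α => v.2 ![1, 0, 0]) h,
    congrArg (fun v : D21 α => v.2 ![1, 0, 1]) h,
    congrArg (fun v : D21 α => v.2 ![1, 1, 0]) h,
    congrArg (fun v : D21 α => v.2 ![1, 1, 1]) h⟩

/-- The elements of `D(2,1;α)` with given coordinates. -/
noncomputable def mkLin (α : ℂ) : (Fin 17 → ℂ) →ₗ[ℂ] D21 α where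
  toFun c := mk α (c 0) (c 1) (c 2) (c 3) (c 4) (c 5) (c 6) (c 7) (c 8) (c 9) (c 10) (c 11) (c 12)
    (c 13) (c 14) (c 15) (c 16)
  map_add' _ _ := (mk_add ..).symm
  map_smul' _ _ := (smul_mk ..).symm

theorem mkLin_injective (α : ℂ) : Function.Injective (mkLin α) := by
  refine (injective_iff_map_eq_zero _).2 fun c hc => ?_
  obtain ⟨h0, h1, h2, h3, h4, h5, h6, h7, h8, h9, h10, h11, h12, h13, h14, h15, h16⟩ :=
    mk_eq_zero hc
  funext i
  fin_cases i
  exacts [h0, h1, h2, h3, h4, h5, h6, h7, h8, h9, h10, h11, h12, h13, h14, h15, h16]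

/-- Duality comes by counting: the coordinates are injective on a space containing `ℂ¹⁷`, so every
tuple of coordinates occurs. The element with coordinates `δⱼ` is then `u j` by the reconstruction
formula. -/
theorem coord_apply_eq {α : ℂ} {coord : Fin 17 → D21 α →ₗ[ℂ] ℂ} {u : Fin 17 → D21 α}
    (h : ∀ v, ∑ i, coord i v • u i = v) (i j : Fin 17) :
    coord i (u j) = if i = j then 1 else 0 := by
  have hinj : Function.Injective (LinearMap.pi coord) := by
    refine (injective_iff_map_eq_zero _).2 fun v hv => ?_
    rw [← h v]
    exact Finset.sum_eq_zero fun i _ => by rw [show coord i v = 0 from congrFun hv i, zero_smul]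
  have hsurj : Function.Surjective (LinearMap.pi coord ∘ₗ mkLin α) :=
    LinearMap.injective_iff_surjective.1 (hinj.comp (mkLin_injective α))
  obtain ⟨c, hc⟩ := hsurj (Pi.single j 1)
  have hc' : ∀ i, coord i (mkLin α c) = if i = j then 1 else 0 := fun i => by
    rw [← Pi.single_apply]; exact congrFun hc i
  have e := h (mkLin α c)
  simp only [hc', ite_smul, one_smul, zero_smul, Finset.sum_ite_eq', Finset.mem_univ,
    if_true] at e
  rw [e, hc']

/-- The root vectors of the positive part. -/
noncomputable def posVec (ε : ℂ) : Fin 17 → D21 ε :=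
  ![
    mk ε 0 0 0 0 0 0 0 0 0 0 1 (-1 - ε) 0 ε 0 0 0,
    mk ε 0 (4 + 4 * ε) 0 0 (4 + 4 * ε) 0 0 (4 + 4 * ε) 0 0 0 0 0 0 0 0 0,
    mk ε 0 0 0 0 0 0 0 0 0 0 0 0 0 0 0 0 (-1 / 4 - ε / 4),
    mk ε 0 0 (-1 / 2) 0 0 (1 / 2 + ε / 2) 0 0 (-ε / 2) 0 0 0 0 0 0 0 0,
    mk ε 0 0 0 0 0 0 0 0 0 0 0 0 (-ε / 2) 0 (-ε / 2) (-ε / 2) 0,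
    mk ε (-1 - ε) 0 0 ε 0 0 1 0 0 0 0 0 0 0 0 0 0,
    mk ε 0 0 0 0 0 0 0 0 0 0 2 2 0 2 0 0 0,
    mk ε 0 (4 * ε) 0 0 4 0 0 (-4 - 4 * ε) 0 0 0 0 0 0 0 0 0,
    mk ε 0 0 0 0 0 0 0 0 0 (12 + 12 * ε) 0 0 0 0 0 0 0,
    mk ε 0 0 (-1 / 2 - ε / 2) 0 0 (1 / 2) 0 0 (ε / 2) 0 0 0 0 0 0 0 0,
    mk ε 0 0 0 0 0 0 0 0 0 0 0 0 (-1) 0 (1 + ε) (-ε) 0,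
    mk ε (-ε) 0 0 (1 + ε) 0 0 (-1) 0 0 0 0 0 0 0 0 0 0,
    mk ε 0 0 0 0 0 0 0 0 0 0 (-2) (-2 * ε) 0 (2 + 2 * ε) 0 0 0,
    mk ε 0 (-4) 0 0 (-4 * ε) 0 0 (4 + 4 * ε) 0 0 0 0 0 0 0 0 0,
    mk ε 0 0 (ε / 2) 0 0 (ε / 2) 0 0 (ε / 2) 0 0 0 0 0 0 0 0,
    mk ε 0 0 0 0 0 0 0 0 0 0 0 0 (-1 / 2 - ε / 2) 0 (1 / 2) (ε / 2) 0,
    mk ε (-1) 0 0 (-1) 0 0 (-1) 0 0 0 0 0 0 0 0 0 0]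

/-- The coordinates in the basis of the root vectors of the positive part. -/
noncomputable def posCoord (ε : ℂ) : Fin 17 → D21 ε →ₗ[ℂ] ℂ :=
  ![
    form ε 0 0 0 0 0 0 0 0 0 0 (1 / 3) (ε / 3) 0 (-1 / 3 - ε / 3) 0 0 0,
    form ε 0 (-ε / 12) 0 0 (-ε / 12) 0 0 (-ε / 12) 0 0 0 0 0 0 0 0 0,
    form ε 0 0 0 0 0 0 0 0 0 0 0 0 0 0 0 0 (4 * ε),
    form ε 0 0 (-2 / 3) 0 0 (-2 * ε / 3) 0 0 (2 / 3 + 2 * ε / 3) 0 0 0 0 0 0 0 0,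
    form ε 0 0 0 0 0 0 0 0 0 0 0 0 (2 / 3 + 2 * ε / 3) 0 (2 / 3 + 2 * ε / 3) (2 / 3 + 2 * ε / 3) 0,
    form ε (ε / 3) 0 0 (-1 / 3 - ε / 3) 0 0 (1 / 3) 0 0 0 0 0 0 0 0 0 0,
    form ε 0 0 0 0 0 0 0 0 0 0 (1 / 6) (1 / 6) 0 (1 / 6) 0 0 0,
    form ε 0 (-1 / 12 - ε / 12) 0 0 (1 / 12) 0 0 (ε / 12) 0 0 0 0 0 0 0 0 0,
    form ε 0 0 0 0 0 0 0 0 0 (-ε / 12) 0 0 0 0 0 0 0,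
    form ε 0 0 (2 * ε / 3) 0 0 (2 / 3) 0 0 (-2 / 3 - 2 * ε / 3) 0 0 0 0 0 0 0 0,
    form ε 0 0 0 0 0 0 0 0 0 0 0 0 (-1 / 3) 0 (-ε / 3) (1 / 3 + ε / 3) 0,
    form ε (1 / 3 + ε / 3) 0 0 (-ε / 3) 0 0 (-1 / 3) 0 0 0 0 0 0 0 0 0 0,
    form ε 0 0 0 0 0 0 0 0 0 0 (-1 / 6) (1 / 6 + ε / 6) 0 (-ε / 6) 0 0 0,
    form ε 0 (-1 / 12) 0 0 (1 / 12 + ε / 12) 0 0 (-ε / 12) 0 0 0 0 0 0 0 0 0,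
    form ε 0 0 (-2 / 3 - 2 * ε / 3) 0 0 (-2 / 3 - 2 * ε / 3) 0 0 (-2 / 3 - 2 * ε / 3) 0 0 0 0 0 0
      0 0,
    form ε 0 0 0 0 0 0 0 0 0 0 0 0 (2 * ε / 3) 0 (2 / 3) (-2 / 3 - 2 * ε / 3) 0,
    form ε (-1 / 3) 0 0 (-1 / 3) 0 0 (-1 / 3) 0 0 0 0 0 0 0 0 0 0]

/-- The root vectors of the negative part. -/
noncomputable def negVec (ε : ℂ) : Fin 17 → D21 ε :=
  ![
    mk ε 0 0 0 0 0 0 0 0 0 0 0 0 (-1 / 2 - ε / 2) 0 (-1 / 2) (ε / 2) 0,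
    mk ε 0 0 (-ε) 0 0 ε 0 0 (-ε) 0 0 0 0 0 0 0 0,
    mk ε 0 (-2) 0 0 (2 * ε) 0 0 (2 + 2 * ε) 0 0 0 0 0 0 0 0 0,
    mk ε 0 0 0 0 0 0 0 0 0 0 (-2) (2 * ε) 0 (2 + 2 * ε) 0 0 0,
    mk ε (-ε) 0 0 (1 + ε) 0 0 (-1) 0 0 0 0 0 0 0 0 0 0,
    mk ε 0 0 0 0 0 0 0 0 0 0 0 0 1 0 (1 + ε) ε 0,
    mk ε 0 0 (-1 - ε) 0 0 (-1) 0 0 ε 0 0 0 0 0 0 0 0,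
    mk ε 0 0 0 0 0 0 0 0 0 (-2 - 2 * ε) 0 0 0 0 0 0 0,
    mk ε 0 (2 * ε) 0 0 (-2) 0 0 (-2 - 2 * ε) 0 0 0 0 0 0 0 0 0,
    mk ε 0 0 0 0 0 0 0 0 0 0 (-1) 1 0 (-1) 0 0 0,
    mk ε (-1 - ε) 0 0 ε 0 0 1 0 0 0 0 0 0 0 0 0 0,
    mk ε 0 0 0 0 0 0 0 0 0 0 0 0 (-ε) 0 ε (-ε) 0,
    mk ε 0 0 (-1) 0 0 (-1 - ε) 0 0 (-ε) 0 0 0 0 0 0 0 0,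
    mk ε 0 0 0 0 0 0 0 0 0 0 0 0 0 0 0 0 (-3 / 2 - 3 * ε / 2),
    mk ε 0 (-2 - 2 * ε) 0 0 (2 + 2 * ε) 0 0 (-2 - 2 * ε) 0 0 0 0 0 0 0 0 0,
    mk ε 0 0 0 0 0 0 0 0 0 0 (-1) (-1 - ε) 0 (-ε) 0 0 0,
    mk ε 1 0 0 1 0 0 1 0 0 0 0 0 0 0 0 0 0]

/-- The coordinates in the basis of the root vectors of the negative part. -/
noncomputable def negCoord (ε : ℂ) : Fin 17 → D21 ε →ₗ[ℂ] ℂ :=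
  ![
    form ε 0 0 0 0 0 0 0 0 0 0 0 0 (2 * ε / 3) 0 (-2 / 3) (-2 / 3 - 2 * ε / 3) 0,
    form ε 0 0 (1 / 3 + ε / 3) 0 0 (-1 / 3 - ε / 3) 0 0 (1 / 3 + ε / 3) 0 0 0 0 0 0 0 0,
    form ε 0 (-1 / 6) 0 0 (-1 / 6 - ε / 6) 0 0 (-ε / 6) 0 0 0 0 0 0 0 0 0,
    form ε 0 0 0 0 0 0 0 0 0 0 (-1 / 6) (-1 / 6 - ε / 6) 0 (-ε / 6) 0 0 0,
    form ε (1 / 3 + ε / 3) 0 0 (-ε / 3) 0 0 (-1 / 3) 0 0 0 0 0 0 0 0 0 0,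
    form ε 0 0 0 0 0 0 0 0 0 0 0 0 (1 / 3) 0 (-ε / 3) (-1 / 3 - ε / 3) 0,
    form ε 0 0 (ε / 3) 0 0 (-1 / 3) 0 0 (-1 / 3 - ε / 3) 0 0 0 0 0 0 0 0,
    form ε 0 0 0 0 0 0 0 0 0 (ε / 2) 0 0 0 0 0 0 0,
    form ε 0 (-1 / 6 - ε / 6) 0 0 (-1 / 6) 0 0 (ε / 6) 0 0 0 0 0 0 0 0 0,
    form ε 0 0 0 0 0 0 0 0 0 0 (-1 / 3) (1 / 3) 0 (-1 / 3) 0 0 0,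
    form ε (ε / 3) 0 0 (-1 / 3 - ε / 3) 0 0 (1 / 3) 0 0 0 0 0 0 0 0 0 0,
    form ε 0 0 0 0 0 0 0 0 0 0 0 0 (1 / 3 + ε / 3) 0 (-1 / 3 - ε / 3) (1 / 3 + ε / 3) 0,
    form ε 0 0 (-1 / 3) 0 0 (ε / 3) 0 0 (1 / 3 + ε / 3) 0 0 0 0 0 0 0 0,
    form ε 0 0 0 0 0 0 0 0 0 0 0 0 0 0 0 0 (2 * ε / 3),
    form ε 0 (ε / 6) 0 0 (-ε / 6) 0 0 (ε / 6) 0 0 0 0 0 0 0 0 0,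
    form ε 0 0 0 0 0 0 0 0 0 0 (-1 / 3) (ε / 3) 0 (1 / 3 + ε / 3) 0 0 0,
    form ε (1 / 3) 0 0 (1 / 3) 0 0 (1 / 3) 0 0 0 0 0 0 0 0 0 0]

variable {ε : ℂ} (hε : IsPrimitiveRoot ε 3)

include hε

theorem sum_posCoord (v : D21 ε) : ∑ i, posCoord ε i v • posVec ε i = v := by
  have h := sq_add_add_one hε
  obtain ⟨a0, b0, c0, a1, b1, c1, a2, b2, c2, x000, x001, x010, x011, x100, x101, x110, x111,
      rfl⟩ := exists_mk v
  simp only [posCoord, posVec, Fin.sum_univ_succ, Fin.sum_univ_zero, Matrix.cons_val_zero,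
    Matrix.cons_val_succ, form_mk, zero_mul, add_zero, zero_add, smul_mk, mk_add, mul_zero, mul_one]
  refine mk_congr ?_ ?_ ?_ ?_ ?_ ?_ ?_ ?_ ?_ ?_ ?_ ?_ ?_ ?_ ?_ ?_ ?_ <;> grind

theorem posVec_table₁ (i : Fin 17) :
    br (posVec ε 0) (posVec ε i) = posCoef₁ i • posVec ε (posTo₁ i) := by
  have h := sq_add_add_one hε
  -- The lemmas on zero and negative multiples are disabled so that both sides stay in the form `mk`
  -- and can be compared coordinate by coordinate modulo `ε² + ε + 1`.
  fin_cases i <;> simp [posCoef₁, posTo₁, posVec, smul_mk, br_mk, -zero_smul, -neg_smul] <;>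
    refine mk_congr ?_ ?_ ?_ ?_ ?_ ?_ ?_ ?_ ?_ ?_ ?_ ?_ ?_ ?_ ?_ ?_ ?_ <;> grind

theorem posVec_table₂ (i : Fin 17) :
    br (posVec ε 2) (posVec ε i) = posCoef₂ i • posVec ε (posTo₂ i) := by
  have h := sq_add_add_one hε
  fin_cases i <;> simp [posCoef₂, posTo₂, posVec, smul_mk, br_mk, -zero_smul, -neg_smul] <;>
    refine mk_congr ?_ ?_ ?_ ?_ ?_ ?_ ?_ ?_ ?_ ?_ ?_ ?_ ?_ ?_ ?_ ?_ ?_ <;> grind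

theorem sum_negCoord (v : D21 ε) : ∑ i, negCoord ε i v • negVec ε i = v := by
  have h := sq_add_add_one hε
  obtain ⟨a0, b0, c0, a1, b1, c1, a2, b2, c2, x000, x001, x010, x011, x100, x101, x110, x111,
      rfl⟩ := exists_mk v
  simp only [negCoord, negVec, Fin.sum_univ_succ, Fin.sum_univ_zero, Matrix.cons_val_zero,
    Matrix.cons_val_succ, form_mk, zero_mul, add_zero, zero_add, smul_mk, mk_add, mul_zero, mul_one]
  refine mk_congr ?_ ?_ ?_ ?_ ?_ ?_ ?_ ?_ ?_ ?_ ?_ ?_ ?_ ?_ ?_ ?_ ?_ <;> grind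

theorem negVec_table₁ (i : Fin 17) :
    br (negVec ε 0) (negVec ε i) = negCoef₁ i • negVec ε (negTo₁ i) := by
  have h := sq_add_add_one hε
  fin_cases i <;> simp [negCoef₁, negTo₁, negVec, smul_mk, br_mk, -zero_smul, -neg_smul] <;>
    refine mk_congr ?_ ?_ ?_ ?_ ?_ ?_ ?_ ?_ ?_ ?_ ?_ ?_ ?_ ?_ ?_ ?_ ?_ <;> grind

theorem negVec_table₂ (i : Fin 17) :
    br (negVec ε 2) (negVec ε i) = negCoef₂ i • negVec ε (negTo₂ i) := by
  have h := sq_add_add_one hε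
  fin_cases i <;> simp [negCoef₂, negTo₂, negVec, smul_mk, br_mk, -zero_smul, -neg_smul] <;>
    refine mk_congr ?_ ?_ ?_ ?_ ?_ ?_ ?_ ?_ ?_ ?_ ?_ ?_ ?_ ?_ ?_ ?_ ?_ <;> grind

end

end D21

/-! ### The root vectors form root bases of the two half loop algebras. -/

namespace LieSuperalgebra

section Gen

variable {L : Type*} [AddCommGroup L] [Module ℂ L] [LieSuperalgebra L]

theorem subset_gen (s : Set L) : s ⊆ (Subalg.gen s).toSubmodule := by
  intro x hx
  change x ∈ ⨅ (S : Subalg L) (_ : s ⊆ S.toSubmodule), S.toSubmodule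
  simp only [Submodule.mem_iInf]
  exact fun S hS => hS hx

theorem gen_le {s : Set L} {S : Subalg L} (h : s ⊆ S.toSubmodule) :
    (Subalg.gen s).toSubmodule ≤ S.toSubmodule :=
  iInf₂_le S h

end Gen

end LieSuperalgebra

namespace D21

open LieSuperalgebra

section

attribute [local instance] LieRing.ofAssociativeRing LieAlgebra.ofAssociativeAlgebra

theorem even_eq_mk {α a0 b0 c0 a1 b1 c1 a2 b2 c2 x000 x001 x010 x011 x100 x101 x110 x111 : ℂ}
    {v w : D21 α} (hv : v ∈ part (L := D21 α) 0) (hw : w ∈ part (L := D21 α) 1)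
    (h : v + w = mk α a0 b0 c0 a1 b1 c1 a2 b2 c2 x000 x001 x010 x011 x100 x101 x110 x111) :
    v = mk α a0 b0 c0 a1 b1 c1 a2 b2 c2 0 0 0 0 0 0 0 0 := by
  have h1 : (v + w).1 = v.1 := by rw [fst_add, mem_part_one.1 hw, add_zero]
  refine Prod.ext ?_ ?_
  · rw [← h1, h]; rfl
  · rw [mem_part_zero.1 hv, ← snd_zero (α := α), ← mk_zero]; rfl

theorem mk_mem_part_zero (α a0 b0 c0 a1 b1 c1 a2 b2 c2 : ℂ) :
    mk α a0 b0 c0 a1 b1 c1 a2 b2 c2 0 0 0 0 0 0 0 0 ∈ part (L := D21 α) 0 := by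
  rw [mem_part_zero, ← snd_zero (α := α), ← mk_zero]; rfl

theorem mk_mem_part_one (α x000 x001 x010 x011 x100 x101 x110 x111 : ℂ) :
    mk α 0 0 0 0 0 0 0 0 0 x000 x001 x010 x011 x100 x101 x110 x111 ∈ part (L := D21 α) 1 := by
  rw [mem_part_one, ← fst_zero (α := α), ← mk_zero]; rfl

/-- The sum of the positive root spaces. -/
noncomputable def posRoots (α : ℂ) : Subalg (D21 α) where
  carrier := {v | ∃ b0 b1 b2 x000 x001 x010 x100,
    v = mk α 0 b0 0 0 b1 0 0 b2 0 x000 x001 x010 0 x100 0 0 0}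
  add_mem' := by
    rintro _ _ ⟨b0, b1, b2, x000, x001, x010, x100, rfl⟩ ⟨b0', b1', b2', x000', x001', x010',
        x100', rfl⟩
    rw [mk_add]
    exact ⟨_, _, _, _, _, _, _, mk_congr (by ring) rfl (by ring) (by ring) rfl (by ring) (by ring)
        rfl (by ring) rfl
      rfl rfl (by ring) rfl (by ring) (by ring) (by ring)⟩
  zero_mem' := ⟨0, 0, 0, 0, 0, 0, 0, (mk_zero α).symm⟩
  smul_mem' := by
    rintro k _ ⟨b0, b1, b2, x000, x001, x010, x100, rfl⟩
    rw [smul_mk]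
    exact ⟨_, _, _, _, _, _, _, mk_congr (by ring) rfl (by ring) (by ring) rfl (by ring) (by ring)
        rfl (by ring) rfl
      rfl rfl (by ring) rfl (by ring) (by ring) (by ring)⟩
  br_mem' := by
    rintro _ ⟨b0, b1, b2, x000, x001, x010, x100, rfl⟩ _ ⟨b0', b1', b2', x000', x001', x010',
        x100', rfl⟩
    rw [br_mk]
    exact ⟨_, _, _, _, _, _, _, mk_congr (by ring) rfl (by ring) (by ring) rfl (by ring) (by ring)
        rfl (by ring) rfl
      rfl rfl (by ring) rfl (by ring) (by ring) (by ring)⟩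
  graded' v hv w hw h := by
    obtain ⟨b0, b1, b2, x000, x001, x010, x100, h⟩ := h
    exact ⟨b0, b1, b2, 0, 0, 0, 0, even_eq_mk hv hw h⟩

/-- The sum of the negative root spaces. -/
noncomputable def negRoots (α : ℂ) : Subalg (D21 α) where
  carrier := {v | ∃ c0 c1 c2 x011 x101 x110 x111,
    v = mk α 0 0 c0 0 0 c1 0 0 c2 0 0 0 x011 0 x101 x110 x111}
  add_mem' := by
    rintro _ _ ⟨c0, c1, c2, x011, x101, x110, x111, rfl⟩ ⟨c0', c1', c2', x011', x101', x110',
        x111', rfl⟩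
    rw [mk_add]
    exact ⟨_, _, _, _, _, _, _, mk_congr (by ring) (by ring) rfl (by ring) (by ring) rfl (by ring)
        (by ring) rfl
      (by ring) (by ring) (by ring) rfl (by ring) rfl rfl rfl⟩
  zero_mem' := ⟨0, 0, 0, 0, 0, 0, 0, (mk_zero α).symm⟩
  smul_mem' := by
    rintro k _ ⟨c0, c1, c2, x011, x101, x110, x111, rfl⟩
    rw [smul_mk]
    exact ⟨_, _, _, _, _, _, _, mk_congr (by ring) (by ring) rfl (by ring) (by ring) rfl (by ring)
        (by ring) rfl
      (by ring) (by ring) (by ring) rfl (by ring) rfl rfl rfl⟩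
  br_mem' := by
    rintro _ ⟨c0, c1, c2, x011, x101, x110, x111, rfl⟩ _ ⟨c0', c1', c2', x011', x101', x110',
        x111', rfl⟩
    rw [br_mk]
    exact ⟨_, _, _, _, _, _, _, mk_congr (by ring) (by ring) rfl (by ring) (by ring) rfl (by ring)
        (by ring) rfl
      (by ring) (by ring) (by ring) rfl (by ring) rfl rfl rfl⟩
  graded' v hv w hw h := by
    obtain ⟨c0, c1, c2, x011, x101, x110, x111, h⟩ := h
    exact ⟨c0, c1, c2, 0, 0, 0, 0, even_eq_mk hv hw h⟩

/-- One inclusion is enough: it shows that the coordinates of the `d` vectors vanish on the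
subalgebra generated by the `X⁺ᵢ`. -/
theorem gen_Xp_le (ε : ℂ) :
    (Subalg.gen (Set.range (Xp ε))).toSubmodule ≤ (posRoots ε).toSubmodule := by
  refine gen_le ?_
  rintro _ ⟨i, rfl⟩
  fin_cases i
  exacts [⟨0, 0, 0, 0, 0, 0, 1, Xp_zero ε⟩, ⟨0, 0, 0, 0, 0, 1, 0, Xp_one ε⟩,
    ⟨0, 0, 0, 0, 1, 0, 0, Xp_two ε⟩]

theorem gen_Xm_le (ε : ℂ) :
    (Subalg.gen (Set.range (Xm ε))).toSubmodule ≤ (negRoots ε).toSubmodule := by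
  refine gen_le ?_
  rintro _ ⟨i, rfl⟩
  fin_cases i
  exacts [⟨0, 0, 0, ε / 2, 0, 0, 0, Xm_zero ε⟩, ⟨0, 0, 0, 0, -ε / 2, 0, 0, Xm_one ε⟩,
    ⟨0, 0, 0, 0, 0, ε / 2, 0, Xm_two ε⟩]

/-- The degrees of the root vectors of the positive part. -/
def posDeg : Fin 17 → ℕ := ![0, 0, 1, 1, 1, 1, 1, 1, 1, 2, 2, 2, 2, 2, 3, 3, 3]

/-- The parities of the root vectors of the positive part. -/
def posPar : Fin 17 → ZMod 2 := ![1, 0, 1, 0, 1, 0, 1, 0, 1, 0, 1, 0, 1, 0, 0, 1, 0]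

/-- The degrees of the root vectors of the negative part. -/
def negDeg : Fin 17 → ℕ := ![0, 0, 1, 1, 1, 1, 1, 2, 2, 2, 2, 2, 2, 2, 3, 3, 3]

/-- The parities of the root vectors of the negative part. -/
def negPar : Fin 17 → ZMod 2 := ![1, 0, 0, 1, 0, 1, 0, 1, 0, 1, 0, 1, 0, 1, 0, 1, 0]

/-- Within a block every vector but `bm3` is reached from `a1`. The vector `bm3` is carried along in
the induction: `d0` leads under `A` to the next `a1` and under `B` to the next `bm3`. -/
theorem pos_reaches : Reaches (ι := Fin 17 × ℕ) (0, 0) (2, 0) (fun i => posCoef₁ i.1)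
    (fun i => posCoef₂ i.1) (fun i => (posTo₁ i.1, i.2 + posShift i.1))
    (fun i => (posTo₂ i.1, i.2 + posShift i.1)) := by
  rintro P h0 h2 hA hB ⟨i, m⟩
  have main : ∀ m, P (0, m) → P (2, m) → (∀ i, P (i, m)) ∧ P (0, m + 1) ∧ P (2, m + 1) := by
    intro m h0 h2
    have h1 := hA (0, m) (by simp [posCoef₁]) h0
    have h3 := hB (0, m) (by simp [posCoef₂]) h0
    have h4 := hA (3, m) (by simp [posCoef₁]) h3
    have h5 := hA (4, m) (by simp [posCoef₁]) h4
    have h6 := hA (5, m) (by simp [posCoef₁]) h5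
    have h7 := hA (6, m) (by simp [posCoef₁]) h6
    have h8 := hA (7, m) (by simp [posCoef₁]) h7
    have h9 := hB (6, m) (by simp [posCoef₂]) h6
    have h10 := hA (9, m) (by simp [posCoef₁]) h9
    have h11 := hA (10, m) (by simp [posCoef₁]) h10
    have h12 := hA (11, m) (by simp [posCoef₁]) h11
    have h13 := hA (12, m) (by simp [posCoef₁]) h12
    have h14 := hB (12, m) (by simp [posCoef₂]) h12
    have h15 := hA (14, m) (by simp [posCoef₁]) h14
    have h16 := hA (15, m) (by simp [posCoef₁]) h15
    refine ⟨fun i => ?_, hA (16, m) (by simp [posCoef₁]) h16,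
      hB (16, m) (by simp [posCoef₂]) h16⟩
    fin_cases i
    exacts [h0, h1, h2, h3, h4, h5, h6, h7, h8, h9, h10, h11, h12, h13, h14, h15, h16]
  have all : ∀ m, P (0, m) ∧ P (2, m) := by
    intro m
    induction m with
    | zero => exact ⟨h0, h2⟩
    | succ m ih => exact (main m ih.1 ih.2).2
  exact (main m (all m).1 (all m).2).1 i

theorem neg_reaches : Reaches (ι := Fin 17 × ℕ) (0, 0) (2, 0) (fun i => negCoef₁ i.1)
    (fun i => negCoef₂ i.1) (fun i => (negTo₁ i.1, i.2 + negShift₁ i.1))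
    (fun i => (negTo₂ i.1, i.2 + negShift₂ i.1)) := by
  rintro P h0 h2 hA hB ⟨i, m⟩
  have main : ∀ m, P (0, m) → P (2, m) → (∀ i, P (i, m)) ∧ P (0, m + 1) ∧ P (2, m + 1) := by
    intro m h0 h2
    have h1 := hA (0, m) (by simp [negCoef₁]) h0
    have h3 := hB (0, m) (by simp [negCoef₂]) h0
    have h4 := hA (3, m) (by simp [negCoef₁]) h3
    have h5 := hA (4, m) (by simp [negCoef₁]) h4
    have h6 := hA (5, m) (by simp [negCoef₁]) h5
    have h7 := hB (3, m) (by simp [negCoef₂]) h3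
    have h8 := hB (4, m) (by simp [negCoef₂]) h4
    have h9 := hA (8, m) (by simp [negCoef₁]) h8
    have h10 := hA (9, m) (by simp [negCoef₁]) h9
    have h11 := hA (10, m) (by simp [negCoef₁]) h10
    have h12 := hA (11, m) (by simp [negCoef₁]) h11
    have h13 := hA (12, m) (by simp [negCoef₁]) h12
    have h14 := hB (10, m) (by simp [negCoef₂]) h10
    have h15 := hA (14, m) (by simp [negCoef₁]) h14
    have h16 := hA (15, m) (by simp [negCoef₁]) h15
    refine ⟨fun i => ?_, hA (16, m) (by simp [negCoef₁]) h16,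
      hB (16, m) (by simp [negCoef₂]) h16⟩
    fin_cases i
    exacts [h0, h1, h2, h3, h4, h5, h6, h7, h8, h9, h10, h11, h12, h13, h14, h15, h16]
  have all : ∀ m, P (0, m) ∧ P (2, m) := by
    intro m
    induction m with
    | zero => exact ⟨h0, h2⟩
    | succ m ih => exact (main m ih.1 ih.2).2
  exact (main m (all m).1 (all m).2).1 i

variable {ε : ℂ} (hε : IsPrimitiveRoot ε 3)

include hε

theorem posVec_zero : posVec ε 0 = Yp1 ε := by
  have h := sq_add_add_one hε
  rw [Yp1, Xp_zero, Xp_one, Xp_two]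
  simp only [posVec, Matrix.cons_val_zero, smul_mk, mk_add]
  refine mk_congr ?_ ?_ ?_ ?_ ?_ ?_ ?_ ?_ ?_ ?_ ?_ ?_ ?_ ?_ ?_ ?_ ?_ <;> grind

theorem posVec_two : posVec ε 2 = Yp2 ε := by
  have h := sq_add_add_one hε
  rw [Yp2, Xm_zero, Xm_one, Xm_two, br_mk, br_mk]
  simp only [posVec, Matrix.cons_val]
  refine mk_congr ?_ ?_ ?_ ?_ ?_ ?_ ?_ ?_ ?_ ?_ ?_ ?_ ?_ ?_ ?_ ?_ ?_ <;> grind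

theorem negVec_zero : negVec ε 0 = Ym1 ε := by
  have h := sq_add_add_one hε
  rw [Ym1, Xm_zero, Xm_one, Xm_two]
  simp only [negVec, Matrix.cons_val_zero, smul_mk, mk_add]
  refine mk_congr ?_ ?_ ?_ ?_ ?_ ?_ ?_ ?_ ?_ ?_ ?_ ?_ ?_ ?_ ?_ ?_ ?_ <;> grind

theorem negVec_two : negVec ε 2 = Ym2 ε := by
  have h := sq_add_add_one hε
  have e : ∀ x y z : D21 ε, x - y + z = x + (-1 : ℂ) • y + z := fun x y z => by module
  rw [Ym2, e, Xp_zero, Xp_one, Xp_two, br_mk, br_mk, br_mk, smul_mk, mk_add, mk_add]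
  simp only [negVec, Matrix.cons_val]
  refine mk_congr ?_ ?_ ?_ ?_ ?_ ?_ ?_ ?_ ?_ ?_ ?_ ?_ ?_ ?_ ?_ ?_ ?_ <;> grind

theorem rot_posVec (i : Fin 17) : rot ε hε (posVec ε i) =
    ε ^ (((1 : ℤˣ) : ℤ) * posDeg i) • posVec ε i := by
  have h := sq_add_add_one hε
  have e : ((1 : ℤˣ) : ℤ) * posDeg i = (posDeg i : ℕ) := by simp
  rw [e, zpow_natCast]
  change rotLin ε _ = _
  fin_cases i <;> simp [posDeg, posVec, smul_mk, rotLin_mk, -one_smul] <;>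
    refine mk_congr ?_ ?_ ?_ ?_ ?_ ?_ ?_ ?_ ?_ ?_ ?_ ?_ ?_ ?_ ?_ ?_ ?_ <;> grind

theorem rotFlip_negVec (i : Fin 17) : rotFlip ε hε (negVec ε i) =
    ε ^ (((-1 : ℤˣ) : ℤ) * negDeg i) • negVec ε i := by
  have h := sq_add_add_one hε
  -- The exponents are negative, and `ε⁻¹ = ε²` turns them into natural powers.
  have e : ε ^ (((-1 : ℤˣ) : ℤ) * negDeg i) = (ε ^ 2) ^ negDeg i := by
    have h1 : ε ^ 2 = ε⁻¹ := eq_inv_of_mul_eq_one_left (by rw [← pow_succ]; exact hε.pow_eq_one)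
    rw [h1, inv_pow, Units.val_neg, Units.val_one, neg_one_mul, zpow_neg, zpow_natCast]
  rw [e]
  change flipLin ε (rotLin ε (flipLin ε _)) = _
  fin_cases i <;> simp [negDeg, negVec, smul_mk, rotLin_mk, flipLin_mk, -one_smul] <;>
    refine mk_congr ?_ ?_ ?_ ?_ ?_ ?_ ?_ ?_ ?_ ?_ ?_ ?_ ?_ ?_ ?_ ?_ ?_ <;> grind

/-- The root vectors of the positive part form a root basis. -/
noncomputable def posBasis : RootBasis (rot ε hε) ε 1 (Subalg.gen (Set.range (Xp ε))) posDeg posPar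
    posCoef₁ posCoef₂ posTo₁ posTo₂ posShift posShift (posVec ε) where
  isPrimitiveRoot := hε
  coord := posCoord ε
  sum_coord := sum_posCoord hε
  coord_u := coord_apply_eq (sum_posCoord hε)
  map_u := rot_posVec hε
  u_mem i := by
    fin_cases i
    all_goals first | exact mk_mem_part_zero .. | exact mk_mem_part_one ..
  deg_le := by decide
  deg_zero := rfl
  deg_two := rfl
  coord_n v hv i hi := by
    obtain ⟨b0, b1, b2, x000, x001, x010, x100, rfl⟩ := gen_Xp_le ε hv
    have hi' : i = 14 ∨ i = 15 ∨ i = 16 := by revert i; decide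
    rcases hi' with rfl | rfl | rfl <;> simp [posCoord, form_mk]
  u_mem_n i hi := by
    have h0 : posVec ε 0 ∈ (Subalg.gen (Set.range (Xp ε))).toSubmodule := by
      rw [posVec_zero hε]
      have hX : ∀ i, Xp ε i ∈ (Subalg.gen (Set.range (Xp ε))).toSubmodule :=
        fun i => subset_gen _ ⟨i, rfl⟩
      exact add_mem (add_mem (Submodule.smul_mem _ _ (hX 0)) (Submodule.smul_mem _ _ (hX 1))) (hX 2)
    have h1 : posVec ε 1 = br (posVec ε 0) (posVec ε 0) := by
      rw [posVec_table₁ hε]; simp [posCoef₁, posTo₁]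
    have hi' : i = 0 ∨ i = 1 := by revert i; decide
    rcases hi' with rfl | rfl
    · exact h0
    · rw [h1]; exact Subalg.br_mem' _ _ h0 _ h0
  table₁ := posVec_table₁ hε
  table₂ := posVec_table₂ hε
  deg₁ i := by fin_cases i <;> simp [posCoef₁, posTo₁, posShift, posDeg]
  deg₂ i := by fin_cases i <;> simp [posCoef₂, posTo₂, posShift, posDeg]
  pr₁ i := by fin_cases i <;> simp [posCoef₁, posTo₁, posPar] <;> decide
  pr₂ i := by fin_cases i <;> simp [posCoef₂, posTo₂, posPar] <;> decide
  reaches := pos_reaches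

/-- The root vectors of the negative part form a root basis. -/
noncomputable def negBasis : RootBasis (rotFlip ε hε) ε (-1) (Subalg.gen (Set.range (Xm ε))) negDeg
    negPar negCoef₁ negCoef₂ negTo₁ negTo₂ negShift₁ negShift₂ (negVec ε) where
  isPrimitiveRoot := hε
  coord := negCoord ε
  sum_coord := sum_negCoord hε
  coord_u := coord_apply_eq (sum_negCoord hε)
  map_u := rotFlip_negVec hε
  u_mem i := by
    fin_cases i
    all_goals first | exact mk_mem_part_zero .. | exact mk_mem_part_one ..
  deg_le := by decide
  deg_zero := rfl
  deg_two := rfl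
  coord_n v hv i hi := by
    obtain ⟨c0, c1, c2, x011, x101, x110, x111, rfl⟩ := gen_Xm_le ε hv
    have hi' : i = 14 ∨ i = 15 ∨ i = 16 := by revert i; decide
    rcases hi' with rfl | rfl | rfl <;> simp [negCoord, form_mk]
  u_mem_n i hi := by
    have h0 : negVec ε 0 ∈ (Subalg.gen (Set.range (Xm ε))).toSubmodule := by
      rw [negVec_zero hε]
      have hX : ∀ i, Xm ε i ∈ (Subalg.gen (Set.range (Xm ε))).toSubmodule :=
        fun i => subset_gen _ ⟨i, rfl⟩
      exact add_mem (add_mem (Submodule.smul_mem _ _ (hX 0)) (Submodule.smul_mem _ _ (hX 1))) (hX 2)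
    have h1 : negVec ε 1 = br (negVec ε 0) (negVec ε 0) := by
      rw [negVec_table₁ hε]; simp [negCoef₁, negTo₁]
    have hi' : i = 0 ∨ i = 1 := by revert i; decide
    rcases hi' with rfl | rfl
    · exact h0
    · rw [h1]; exact Subalg.br_mem' _ _ h0 _ h0
  table₁ := negVec_table₁ hε
  table₂ := negVec_table₂ hε
  deg₁ i := by fin_cases i <;> simp [negCoef₁, negTo₁, negShift₁, negDeg]
  deg₂ i := by fin_cases i <;> simp [negCoef₂, negTo₂, negShift₂, negDeg]
  pr₁ i := by fin_cases i <;> simp [negCoef₁, negTo₁, negPar] <;> decide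
  pr₂ i := by fin_cases i <;> simp [negCoef₂, negTo₂, negPar]
  reaches := neg_reaches

end

end D21

/-! ### Transport of the relations between an algebra and its loops. -/

namespace LieSuperalgebra

section Relations

variable {K L : Type} [AddCommGroup K] [Module ℂ K] [LieSuperalgebra K]
  [AddCommGroup L] [Module ℂ L] [LieSuperalgebra L]

theorem Hom.map_br' (f : Hom K L) (x y : K) : f (br x y) = br (f x) (f y) := f.map_br x y

theorem Hom.map_posFour (f : Hom K L) (x y : K) : f (posFour x y) = posFour (f x) (f y) := by
  simp only [posFour, Hom.map_br']

theorem Hom.map_posFive (f : Hom K L) (x y : K) : f (posFive x y) = posFive (f x) (f y) := by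
  simp only [posFive, Hom.map_br']

theorem Hom.map_negFour (f : Hom K L) (x y : K) : f (negFour x y) = negFour (f x) (f y) := by
  simp only [negFour, Hom.map_br']

theorem Hom.map_negFive (f : Hom K L) (x y : K) : f (negFive x y) = negFive (f x) (f y) := by
  simp only [negFive, Hom.map_br']

/-- Used for the inclusion into the full loop algebra, where brackets of monomials are explicit. -/
theorem PosHom.of_injective (f : Hom K L) (hf : Function.Injective f) {x y : K}
    (h : PosHom L (f x) (f y)) : PosHom K x y := by
  have h0 : f 0 = 0 := map_zero f.toLinearMap
  simp only [PosHom, ← Hom.map_br', ← h0, hf.eq_iff] at h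
  exact h

theorem NegHom.of_injective (f : Hom K L) (hf : Function.Injective f) {x y : K}
    (h : NegHom L (f x) (f y)) : NegHom K x y := by
  have h0 : f 0 = 0 := map_zero f.toLinearMap
  have hs : ∀ u v, f (u - (2 : ℂ) • v) = f u - (2 : ℂ) • f v := fun u v => by
    rw [map_sub, map_smul]
  simp only [NegHom, ← Hom.map_br', ← hs, ← h0, hf.eq_iff] at h
  exact h

/-- The inclusion of a graded subalgebra. -/
def Subalg.incl (S : Subalg L) : Hom S.toSubmodule L where
  toLinearMap := S.toSubmodule.subtype
  map_br _ _ := rfl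
  map_part _ _ h := h

theorem Subalg.incl_injective (S : Subalg L) : Function.Injective S.incl := Subtype.val_injective

theorem RootBasis.incl_loopVec {σ : Hom L L} {ω : ℂ} {s : ℤˣ} {𝔫 : Subalg L} {deg : Fin 17 → ℕ}
    {pr : Fin 17 → ZMod 2} {c₁ c₂ : Fin 17 → ℂ} {t₁ t₂ : Fin 17 → Fin 17} {d₁ d₂ : Fin 17 → ℕ}
    {u : Fin 17 → L} (T : RootBasis σ ω s 𝔫 deg pr c₁ c₂ t₁ t₂ d₁ d₂ u) (hω : ω ≠ 0) {i : Fin 17}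
    {m : ℕ} {k : ℤ} (h : (s : ℤ) * (deg i + 3 * m) = k) :
    (nilLoop σ ω hω s 𝔫).incl (T.loopVec hω (i, m)) = Finsupp.single k (u i) := by
  subst h; rfl

theorem br_single (i j : ℤ) (x y : L) :
    br (Finsupp.single i x) (Finsupp.single j y) = Finsupp.single (i + j) (br x y) :=
  loopBr_single i j x y

theorem PosHom.single {x y : L} (h : PosHom L x y) (i j : ℤ) :
    PosHom (Loop L) (Finsupp.single i x) (Finsupp.single j y) := by
  simp only [PosHom, br_single, h.1, h.2.1, h.2.2, Finsupp.single_zero, and_self]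

theorem NegHom.single {x y : L} (h : NegHom L x y) (i j : ℤ) :
    NegHom (Loop L) (Finsupp.single i x) (Finsupp.single j y) := by
  -- Both terms of relation 2 have the same `t`-degree, so their difference is again a monomial.
  have e : i + j + (i + j) = j + (j + (i + i)) := by ring
  simp only [NegHom, br_single, e, Finsupp.smul_single, ← Finsupp.single_sub, h.1, h.2.1, h.2.2,
    Finsupp.single_zero, and_self]

/-- Only the occurrences of `y₂` carry a power of `t`: three in the fourth relation and four in the
fifth. -/
theorem posFour_single (j : ℤ) (x y : L) :
    posFour (Finsupp.single 0 x : Loop L) (Finsupp.single j y) =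
      Finsupp.single (3 * j) (posFour x y) := by
  simp only [posFour, br_single]
  congr 1; ring

theorem posFive_single (j : ℤ) (x y : L) :
    posFive (Finsupp.single 0 x : Loop L) (Finsupp.single j y) =
      Finsupp.single (4 * j) (posFive x y) := by
  simp only [posFive, br_single]
  congr 1; ring

theorem negFour_single (j : ℤ) (x y : L) :
    negFour (Finsupp.single 0 x : Loop L) (Finsupp.single j y) =
      Finsupp.single (3 * j) (negFour x y) := by
  simp only [negFour, br_single]
  congr 1; ring

theorem negFive_single (j : ℤ) (x y : L) :
    negFive (Finsupp.single 0 x : Loop L) (Finsupp.single j y) =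
      Finsupp.single (4 * j) (negFive x y) := by
  simp only [negFive, br_single]
  congr 1; ring

end Relations

end LieSuperalgebra

/-! ### The five relations in `𝔡(ε)`, and the four presentations. -/

namespace D21

open LieSuperalgebra

theorem neg_exp₀ : ((-1 : ℤˣ) : ℤ) * (negDeg 0 + 3 * (0 : ℕ)) = 0 := by decide

theorem neg_exp₂ : ((-1 : ℤˣ) : ℤ) * (negDeg 2 + 3 * (0 : ℕ)) = -1 := by decide

theorem neg_exp₀' : ((-1 : ℤˣ) : ℤ) * (negDeg 0 + 3 * (1 : ℕ)) = -3 := by decide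

theorem neg_exp₂' : ((-1 : ℤˣ) : ℤ) * (negDeg 2 + 3 * (1 : ℕ)) = -4 := by decide

variable {ε : ℂ} (hε : IsPrimitiveRoot ε 3)

include hε

/-- These are the brackets outside the two generator tables that occur when the relations are
evaluated from the inside outwards. -/
theorem br_posVec :
    br (posVec ε 1) (posVec ε 3) = (2 : ℂ) • posVec ε 5 ∧
    br (posVec ε 1) (posVec ε 5) = (2 : ℂ) • posVec ε 7 ∧
    br (posVec ε 1) (posVec ε 7) = 0 ∧
    br (posVec ε 3) (posVec ε 4) = 0 ∧
    br (posVec ε 1) (posVec ε 4) = (2 : ℂ) • posVec ε 6 ∧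
    br (posVec ε 4) (posVec ε 6) = (1 : ℂ) • posVec ε 11 ∧
    br (posVec ε 4) (posVec ε 11) = (-2 : ℂ) • posVec ε 15 ∧
    br (posVec ε 1) (posVec ε 15) = (2 : ℂ) • posVec ε 0 ∧
    br (posVec ε 3) (posVec ε 15) = (-3 : ℂ) • posVec ε 2 := by
  have h := sq_add_add_one hε
  rw [← zero_smul ℂ (posVec ε 0)]
  refine ⟨?_, ?_, ?_, ?_, ?_, ?_, ?_, ?_, ?_⟩ <;>
    simp [posVec, smul_mk, br_mk, -zero_smul, -neg_smul, -one_smul] <;>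
    refine mk_congr ?_ ?_ ?_ ?_ ?_ ?_ ?_ ?_ ?_ ?_ ?_ ?_ ?_ ?_ ?_ ?_ ?_ <;> grind

/-- The part common to relations 4 and 5 is 32 times the vector with index 15; the outer brackets
contribute 2 and -3, which gives 64 and -96. -/
theorem posRel : PosRel (D21 ε) (posVec ε 0) (posVec ε 2) := by
  obtain ⟨h13, h15, h17, h34, h14, h46, h411, h115, h315⟩ := br_posVec hε
  have h00 : br (posVec ε 0) (posVec ε 0) = posVec ε 1 := by
    rw [posVec_table₁ hε]; simp [posCoef₁, posTo₁]
  have h02 : br (posVec ε 0) (posVec ε 2) = posVec ε 3 := by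
    rw [posVec_table₁ hε]; simp [posCoef₁, posTo₁]
  have h22 : br (posVec ε 2) (posVec ε 2) = 0 := by
    rw [posVec_table₂ hε]; simp [posCoef₂]
  have h21 : br (posVec ε 2) (posVec ε 1) = (-2 : ℂ) • posVec ε 4 := by
    rw [posVec_table₂ hε]; simp [posCoef₂, posTo₂]
  simp only [PosRel, PosHom, posFour, posFive, h00, h02, h22, h21, map_smul, LinearMap.smul_apply,
    h13, h15, h17, h34, h14, h46, h411, h115, h315, smul_smul, smul_zero, true_and]
  norm_num

theorem br_negVec :
    br (negVec ε 3) (negVec ε 3) = (8 : ℂ) • negVec ε 8 ∧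
    br (negVec ε 1) (negVec ε 3) = (2 : ℂ) • negVec ε 5 ∧
    br (negVec ε 1) (negVec ε 5) = 0 ∧
    br (negVec ε 3) (negVec ε 4) = (-4 : ℂ) • negVec ε 9 ∧
    br (negVec ε 4) (negVec ε 9) = (2 : ℂ) • negVec ε 15 ∧
    br (negVec ε 1) (negVec ε 15) = (2 : ℂ) • negVec ε 0 ∧
    br (negVec ε 3) (negVec ε 15) = (2 : ℂ) • negVec ε 2 := by
  have h := sq_add_add_one hε
  rw [← zero_smul ℂ (negVec ε 0)]
  refine ⟨?_, ?_, ?_, ?_, ?_, ?_, ?_⟩ <;>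
    simp [negVec, smul_mk, br_mk, -zero_smul, -neg_smul, -one_smul] <;>
    refine mk_congr ?_ ?_ ?_ ?_ ?_ ?_ ?_ ?_ ?_ ?_ ?_ ?_ ?_ ?_ ?_ ?_ ?_ <;> grind

/-- The common part is -32 times the vector with index 15, and both outer brackets contribute 2. -/
theorem negRel : NegRel (D21 ε) (negVec ε 0) (negVec ε 2) := by
  obtain ⟨h33, h13, h15, h34, h49, h115, h315⟩ := br_negVec hε
  have h00 : br (negVec ε 0) (negVec ε 0) = negVec ε 1 := by
    rw [negVec_table₁ hε]; simp [negCoef₁, negTo₁]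
  have h02 : br (negVec ε 0) (negVec ε 2) = negVec ε 3 := by
    rw [negVec_table₁ hε]; simp [negCoef₁, negTo₁]
  have h21 : br (negVec ε 2) (negVec ε 1) = (-2 : ℂ) • negVec ε 4 := by
    rw [negVec_table₂ hε]; simp [negCoef₂, negTo₂]
  have h24 : br (negVec ε 2) (negVec ε 4) = (-2 : ℂ) • negVec ε 8 := by
    rw [negVec_table₂ hε]; simp [negCoef₂, negTo₂]
  have h20 : br (negVec ε 2) (negVec ε 0) = (-1 : ℂ) • negVec ε 3 := by
    rw [negVec_table₂ hε]; simp [negCoef₂, negTo₂]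
  have h23 : br (negVec ε 2) (negVec ε 3) = (6 : ℂ) • negVec ε 7 := by
    rw [negVec_table₂ hε]; simp [negCoef₂, negTo₂]
  have h27 : br (negVec ε 2) (negVec ε 7) = 0 := by
    rw [negVec_table₂ hε]; simp [negCoef₂]
  simp only [NegRel, NegHom, negFour, negFive, h00, h02, h21, h24, h20, h23, h27, map_smul,
    LinearMap.smul_apply, h33, h13, h15, h34, h49, h115, h315, smul_smul, smul_zero, true_and]
  norm_num

theorem isPresentedBy_pos : IsPresentedBy 1 1 PosRel (posVec ε 0) (posVec ε 2) := by
  have hω : ε ≠ 0 := hε.ne_zero three_ne_zero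
  obtain ⟨-, h4, h5⟩ := posRel hε
  have h := (posBasis hε).isPresentedBy_base hω PosRel (posRel hε)
    (fun M _ _ _ m₁ h₁ m₂ h₂ hR => exists_pos_table h₁ h₂ hR.1) ?_
  · exact h
  · intro M _ _ _ m₁ m₂ hR f e1 e2
    -- In the loop algebra the left-hand side of relation 4 is 64 times the first generator of block
    -- 1. Its image under `f` is also `64 m₁` by relation 4 in `M`, and 64 can be cancelled;
    -- relation 5 treats the second generator in the same way.
    have q4 : posFour ((posBasis hε).loopVec hω (0, 0)) ((posBasis hε).loopVec hω (2, 0)) =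
        (64 : ℂ) • (posBasis hε).loopVec hω (0, 1) := by
      refine Subalg.incl_injective _ ?_
      rw [Hom.map_posFour]
      change posFour (Finsupp.single 0 (posVec ε 0)) (Finsupp.single 1 (posVec ε 2)) =
        (64 : ℂ) • Finsupp.single 3 (posVec ε 0)
      rw [posFour_single, h4, Finsupp.smul_single]; rfl
    have q5 : posFive ((posBasis hε).loopVec hω (0, 0)) ((posBasis hε).loopVec hω (2, 0)) =
        (-96 : ℂ) • (posBasis hε).loopVec hω (2, 1) := by
      refine Subalg.incl_injective _ ?_
      rw [Hom.map_posFive]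
      change posFive (Finsupp.single 0 (posVec ε 0)) (Finsupp.single 1 (posVec ε 2)) =
        (-96 : ℂ) • Finsupp.single 4 (posVec ε 2)
      rw [posFive_single, h5, Finsupp.smul_single]; rfl
    have r4 := congrArg f q4
    have r5 := congrArg f q5
    rw [Hom.map_posFour, e1, e2, hR.2.1, map_smul] at r4
    rw [Hom.map_posFive, e1, e2, hR.2.2, map_smul] at r5
    exact ⟨(smul_right_injective M (by norm_num) r4).symm,
      (smul_right_injective M (by norm_num) r5).symm⟩

theorem isPresentedBy_neg : IsPresentedBy 1 0 NegRel (negVec ε 0) (negVec ε 2) := by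
  have hω : ε ≠ 0 := hε.ne_zero three_ne_zero
  obtain ⟨-, h4, h5⟩ := negRel hε
  have h := (negBasis hε).isPresentedBy_base hω NegRel (negRel hε)
    (fun M _ _ _ m₁ h₁ m₂ h₂ hR => exists_neg_table h₁ h₂ hR.1) ?_
  · exact h
  · intro M _ _ _ m₁ m₂ hR f e1 e2
    have q4 : negFour ((negBasis hε).loopVec hω (0, 0)) ((negBasis hε).loopVec hω (2, 0)) =
        (-64 : ℂ) • (negBasis hε).loopVec hω (0, 1) := by
      refine Subalg.incl_injective _ ?_
      rw [Hom.map_negFour, map_smul, (negBasis hε).incl_loopVec hω neg_exp₀,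
        (negBasis hε).incl_loopVec hω neg_exp₂, (negBasis hε).incl_loopVec hω neg_exp₀',
        negFour_single, h4, Finsupp.smul_single]
      norm_num
    have q5 : negFive ((negBasis hε).loopVec hω (0, 0)) ((negBasis hε).loopVec hω (2, 0)) =
        (-64 : ℂ) • (negBasis hε).loopVec hω (2, 1) := by
      refine Subalg.incl_injective _ ?_
      rw [Hom.map_negFive, map_smul, (negBasis hε).incl_loopVec hω neg_exp₀,
        (negBasis hε).incl_loopVec hω neg_exp₂, (negBasis hε).incl_loopVec hω neg_exp₂',
        negFive_single, h5, Finsupp.smul_single]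
      norm_num
    have r4 := congrArg f q4
    have r5 := congrArg f q5
    rw [Hom.map_negFour, e1, e2, hR.2.1, map_smul] at r4
    rw [Hom.map_negFive, e1, e2, hR.2.2, map_smul] at r5
    exact ⟨(smul_right_injective M (by norm_num) r4).symm,
      (smul_right_injective M (by norm_num) r5).symm⟩

theorem isPresentedBy_loopPos :
    ∃ (h₁ : Finsupp.single 0 (posVec ε 0) ∈ (loopPos ε hε (rot ε hε)).toSubmodule)
      (h₂ : Finsupp.single 1 (posVec ε 2) ∈ (loopPos ε hε (rot ε hε)).toSubmodule),
      IsPresentedBy (L := (loopPos ε hε (rot ε hε)).toSubmodule) 1 1 PosHom ⟨_, h₁⟩ ⟨_, h₂⟩ := by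
  have hω : ε ≠ 0 := hε.ne_zero three_ne_zero
  refine ⟨((posBasis hε).loopVec hω (0, 0)).2, ((posBasis hε).loopVec hω (2, 0)).2, ?_⟩
  exact (posBasis hε).isPresentedBy_loop hω PosHom
    (PosHom.of_injective (Subalg.incl _) (Subalg.incl_injective _) ((posRel hε).1.single 0 1))
    (fun M _ _ _ m₁ h₁ m₂ h₂ hR => exists_pos_table h₁ h₂ hR)

theorem isPresentedBy_loopNeg :
    ∃ (h₁ : Finsupp.single 0 (negVec ε 0) ∈ (loopNeg ε hε (rotFlip ε hε)).toSubmodule)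
      (h₂ : Finsupp.single (-1) (negVec ε 2) ∈ (loopNeg ε hε (rotFlip ε hε)).toSubmodule),
      IsPresentedBy (L := (loopNeg ε hε (rotFlip ε hε)).toSubmodule) 1 0 NegHom
        ⟨_, h₁⟩ ⟨_, h₂⟩ := by
  have hω : ε ≠ 0 := hε.ne_zero three_ne_zero
  have e₀ := (negBasis hε).incl_loopVec hω neg_exp₀
  have e₂ := (negBasis hε).incl_loopVec hω neg_exp₂
  have h := (negBasis hε).isPresentedBy_loop hω NegHom
    (NegHom.of_injective (Subalg.incl _) (Subalg.incl_injective _)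
      (by rw [e₀, e₂]; exact (negRel hε).1.single 0 (-1)))
    (fun M _ _ _ m₁ h₁ m₂ h₂ hR => exists_neg_table h₁ h₂ hR)
  -- The exponents of `loopVec` carry the sign as a product; the elements are replaced by equal ones
  -- with exponents 0 and -1, and the membership proofs follow along.
  have key : ∀ (a b : (loopNeg ε hε (rotFlip ε hε)).toSubmodule) (x y : Loop (D21 ε)),
      a.1 = x → b.1 = y → IsPresentedBy 1 0 NegHom a b →
      ∃ (h₁ : x ∈ (loopNeg ε hε (rotFlip ε hε)).toSubmodule)
        (h₂ : y ∈ (loopNeg ε hε (rotFlip ε hε)).toSubmodule),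
        IsPresentedBy 1 0 NegHom (⟨x, h₁⟩ : (loopNeg ε hε (rotFlip ε hε)).toSubmodule)
          ⟨y, h₂⟩ := by
    rintro a b _ _ rfl rfl h
    exact ⟨a.2, b.2, h⟩
  exact key _ _ _ _ e₀ e₂ h

end D21

/-! ### `𝔡(ε)` as the contragredient superalgebra of the Cartan matrix. -/

namespace D21

open LieSuperalgebra

section

attribute [local instance] LieRing.ofAssociativeRing LieAlgebra.ofAssociativeAlgebra

theorem H_zero (ε : ℂ) : br (Xp ε 0) (Xm ε 0) =
    mk ε (-ε / 2) 0 0 (ε ^ 2 / 2) 0 0 ((-1 - ε) * ε / 2) 0 0 0 0 0 0 0 0 0 0 := by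
  rw [Xp_zero, Xm_zero, br_mk]
  refine mk_congr ?_ ?_ ?_ ?_ ?_ ?_ ?_ ?_ ?_ ?_ ?_ ?_ ?_ ?_ ?_ ?_ ?_ <;> ring

theorem H_one (ε : ℂ) : br (Xp ε 1) (Xm ε 1) =
    mk ε (-ε / 2) 0 0 (ε ^ 2 / 2) 0 0 ((1 + ε) * ε / 2) 0 0 0 0 0 0 0 0 0 0 := by
  rw [Xp_one, Xm_one, br_mk]
  refine mk_congr ?_ ?_ ?_ ?_ ?_ ?_ ?_ ?_ ?_ ?_ ?_ ?_ ?_ ?_ ?_ ?_ ?_ <;> ring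

theorem H_two (ε : ℂ) : br (Xp ε 2) (Xm ε 2) =
    mk ε (ε / 2) 0 0 (ε ^ 2 / 2) 0 0 ((1 + ε) * ε / 2) 0 0 0 0 0 0 0 0 0 0 := by
  rw [Xp_two, Xm_two, br_mk]
  refine mk_congr ?_ ?_ ?_ ?_ ?_ ?_ ?_ ?_ ?_ ?_ ?_ ?_ ?_ ?_ ?_ ?_ ?_ <;> ring

/-- If an ideal has no nonzero diagonal even element, it has no nonzero even element: inside each
`sl(2)` an off-diagonal coordinate can be moved to the diagonal. -/
theorem even_eq_zero {α : ℂ} {I : Submodule ℂ (D21 α)} (H : ∀ x, ∀ y ∈ I, br x y ∈ I)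
    (diag : ∀ a0 a1 a2, mk α a0 0 0 a1 0 0 a2 0 0 0 0 0 0 0 0 0 0 ∈ I → a0 = 0 ∧ a1 = 0 ∧ a2 = 0)
    {v : D21 α} (hv : v ∈ I) (h0 : v ∈ part (L := D21 α) 0) : v = 0 := by
  obtain ⟨a0, b0, c0, a1, b1, c1, a2, b2, c2, x000, x001, x010, x011, x100, x101, x110, x111,
    e⟩ := exists_mk v
  have e' := even_eq_mk h0 (zero_mem (part (L := D21 α) 1)) (by rw [add_zero]; exact e)
  subst e'
  clear e
  -- Lowering twice kills the other coordinates of this `sl(2)`, and raising once then turns the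
  -- upper coordinate into a nonzero multiple of a diagonal element; the other coordinates are
  -- treated alike.
  have hb0 : b0 = 0 := by
    have h := H (mk α 0 1 0 0 0 0 0 0 0 0 0 0 0 0 0 0 0) _
      (H (mk α 0 0 1 0 0 0 0 0 0 0 0 0 0 0 0 0 0) _
        (H (mk α 0 0 1 0 0 0 0 0 0 0 0 0 0 0 0 0 0) _ hv))
    simp only [br_mk, zero_mul, mul_zero, sub_zero, zero_sub, add_zero, one_mul, mul_one,
      neg_zero] at h
    have := diag _ _ _ h
    simpa using this
  have hc0 : c0 = 0 := by
    have h := H (mk α 0 0 1 0 0 0 0 0 0 0 0 0 0 0 0 0 0) _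
      (H (mk α 0 1 0 0 0 0 0 0 0 0 0 0 0 0 0 0 0) _
        (H (mk α 0 1 0 0 0 0 0 0 0 0 0 0 0 0 0 0 0) _ hv))
    simp only [br_mk, zero_mul, mul_zero, sub_zero, zero_sub, add_zero, one_mul, mul_one,
      neg_zero] at h
    have := diag _ _ _ h
    simpa using this
  have hb1 : b1 = 0 := by
    have h := H (mk α 0 0 0 0 1 0 0 0 0 0 0 0 0 0 0 0 0) _
      (H (mk α 0 0 0 0 0 1 0 0 0 0 0 0 0 0 0 0 0) _
        (H (mk α 0 0 0 0 0 1 0 0 0 0 0 0 0 0 0 0 0) _ hv))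
    simp only [br_mk, zero_mul, mul_zero, sub_zero, zero_sub, add_zero, one_mul, mul_one,
      neg_zero] at h
    have := diag _ _ _ h
    simpa using this
  have hc1 : c1 = 0 := by
    have h := H (mk α 0 0 0 0 0 1 0 0 0 0 0 0 0 0 0 0 0) _
      (H (mk α 0 0 0 0 1 0 0 0 0 0 0 0 0 0 0 0 0) _
        (H (mk α 0 0 0 0 1 0 0 0 0 0 0 0 0 0 0 0 0) _ hv))
    simp only [br_mk, zero_mul, mul_zero, sub_zero, zero_sub, add_zero, one_mul, mul_one,
      neg_zero] at h
    have := diag _ _ _ h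
    simpa using this
  have hb2 : b2 = 0 := by
    have h := H (mk α 0 0 0 0 0 0 0 1 0 0 0 0 0 0 0 0 0) _
      (H (mk α 0 0 0 0 0 0 0 0 1 0 0 0 0 0 0 0 0) _
        (H (mk α 0 0 0 0 0 0 0 0 1 0 0 0 0 0 0 0 0) _ hv))
    simp only [br_mk, zero_mul, mul_zero, sub_zero, zero_sub, add_zero, one_mul, mul_one,
      neg_zero] at h
    have := diag _ _ _ h
    simpa using this
  have hc2 : c2 = 0 := by
    have h := H (mk α 0 0 0 0 0 0 0 0 1 0 0 0 0 0 0 0 0) _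
      (H (mk α 0 0 0 0 0 0 0 1 0 0 0 0 0 0 0 0 0) _
        (H (mk α 0 0 0 0 0 0 0 1 0 0 0 0 0 0 0 0 0) _ hv))
    simp only [br_mk, zero_mul, mul_zero, sub_zero, zero_sub, add_zero, one_mul, mul_one,
      neg_zero] at h
    have := diag _ _ _ h
    simpa using this
  subst hb0 hb1 hb2 hc0 hc1 hc2
  obtain ⟨rfl, rfl, rfl⟩ := diag _ _ _ hv
  exact mk_zero α

/-- Bracketing with the vector of opposite weight shows each coordinate, up to sign, in the diagonal
of the first `sl(2)`, whose structure constant is 1 for every `α`. -/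
theorem odd_eq_zero {α : ℂ} {v : D21 α} (h1 : v ∈ part (L := D21 α) 1)
    (K : ∀ w ∈ part (L := D21 α) 1, br w v = 0) : v = 0 := by
  obtain ⟨a0, b0, c0, a1, b1, c1, a2, b2, c2, x000, x001, x010, x011, x100, x101, x110, x111,
    e⟩ := exists_mk v
  have e' : v = mk α 0 0 0 0 0 0 0 0 0 x000 x001 x010 x011 x100 x101 x110 x111 := by
    refine Prod.ext ?_ ?_
    · rw [mem_part_one.1 h1, ← fst_zero (α := α), ← mk_zero]; rfl
    · rw [e]; rfl
  subst e'
  clear e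
  have hx000 : x000 = 0 := by
    have h := K (mk α 0 0 0 0 0 0 0 0 0 0 0 0 0 0 0 0 1) (mk_mem_part_one ..)
    rw [br_mk] at h
    simpa using (mk_eq_zero h).1
  have hx001 : x001 = 0 := by
    have h := K (mk α 0 0 0 0 0 0 0 0 0 0 0 0 0 0 0 1 0) (mk_mem_part_one ..)
    rw [br_mk] at h
    simpa using (mk_eq_zero h).1
  have hx010 : x010 = 0 := by
    have h := K (mk α 0 0 0 0 0 0 0 0 0 0 0 0 0 0 1 0 0) (mk_mem_part_one ..)
    rw [br_mk] at h
    simpa using (mk_eq_zero h).1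
  have hx011 : x011 = 0 := by
    have h := K (mk α 0 0 0 0 0 0 0 0 0 0 0 0 0 1 0 0 0) (mk_mem_part_one ..)
    rw [br_mk] at h
    simpa using (mk_eq_zero h).1
  have hx100 : x100 = 0 := by
    have h := K (mk α 0 0 0 0 0 0 0 0 0 0 0 0 1 0 0 0 0) (mk_mem_part_one ..)
    rw [br_mk] at h
    simpa using (mk_eq_zero h).1
  have hx101 : x101 = 0 := by
    have h := K (mk α 0 0 0 0 0 0 0 0 0 0 0 1 0 0 0 0 0) (mk_mem_part_one ..)
    rw [br_mk] at h
    simpa using (mk_eq_zero h).1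
  have hx110 : x110 = 0 := by
    have h := K (mk α 0 0 0 0 0 0 0 0 0 0 1 0 0 0 0 0 0) (mk_mem_part_one ..)
    rw [br_mk] at h
    simpa using (mk_eq_zero h).1
  have hx111 : x111 = 0 := by
    have h := K (mk α 0 0 0 0 0 0 0 0 0 1 0 0 0 0 0 0 0) (mk_mem_part_one ..)
    rw [br_mk] at h
    simpa using (mk_eq_zero h).1
  subst hx000 hx001 hx010 hx011 hx100 hx101 hx110 hx111
  exact mk_zero α

variable {ε : ℂ} (hε : IsPrimitiveRoot ε 3)

include hε

theorem diag_mem_span (a0 a1 a2 : ℂ) : mk ε a0 0 0 a1 0 0 a2 0 0 0 0 0 0 0 0 0 0 ∈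
    Submodule.span ℂ (Set.range fun i => br (Xp ε i) (Xm ε i)) := by
  have h := sq_add_add_one hε
  have hH : ∀ i, br (Xp ε i) (Xm ε i) ∈
      Submodule.span ℂ (Set.range fun i => br (Xp ε i) (Xm ε i)) :=
    fun i => Submodule.subset_span ⟨i, rfl⟩
  have e : mk ε a0 0 0 a1 0 0 a2 0 0 0 0 0 0 0 0 0 0 =
      (ε * a1 + a2) • br (Xp ε 0) (Xm ε 0) + (-ε ^ 2 * a0 - a2) • br (Xp ε 1) (Xm ε 1) +
        (ε ^ 2 * a0 + ε * a1) • br (Xp ε 2) (Xm ε 2) := by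
    rw [H_zero, H_one, H_two, smul_mk, smul_mk, smul_mk, mk_add, mk_add]
    refine mk_congr ?_ ?_ ?_ ?_ ?_ ?_ ?_ ?_ ?_ ?_ ?_ ?_ ?_ ?_ ?_ ?_ ?_ <;> grind
  rw [e]
  exact add_mem (add_mem (Submodule.smul_mem _ _ (hH 0)) (Submodule.smul_mem _ _ (hH 1)))
    (Submodule.smul_mem _ _ (hH 2))

/-- The elements `Y⁺₁` and `Y⁺₂` are polynomials in the Chevalley generators, and all 17 basis
vectors are reached from these two by the tables. -/
theorem gen_eq_top : (Subalg.gen (Set.range (Xp ε) ∪ Set.range (Xm ε))).toSubmodule = ⊤ := by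
  set G := Subalg.gen (Set.range (Xp ε) ∪ Set.range (Xm ε))
  have hp : ∀ i, Xp ε i ∈ G.toSubmodule := fun i => subset_gen _ (Or.inl ⟨i, rfl⟩)
  have hm : ∀ i, Xm ε i ∈ G.toSubmodule := fun i => subset_gen _ (Or.inr ⟨i, rfl⟩)
  have h0 : posVec ε 0 ∈ G.toSubmodule := by
    rw [posVec_zero hε]
    exact add_mem (add_mem (Submodule.smul_mem _ _ (hp 0)) (Submodule.smul_mem _ _ (hp 1))) (hp 2)
  have h2 : posVec ε 2 ∈ G.toSubmodule := by
    rw [posVec_two hε]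
    exact G.br_mem' _ (hm 2) _ (G.br_mem' _ (hm 0) _ (hm 1))
  have h : ∀ i, posVec ε i ∈ G.toSubmodule := by
    refine (posBasis hε).reaches_fin (fun i => posVec ε i ∈ G.toSubmodule) h0 h2
      (fun i hc hi => ?_) (fun i hc hi => ?_)
    · have := G.br_mem' _ h0 _ hi
      rw [posVec_table₁ hε] at this
      exact (Submodule.smul_mem_iff _ hc).1 this
    · have := G.br_mem' _ h2 _ hi
      rw [posVec_table₂ hε] at this
      exact (Submodule.smul_mem_iff _ hc).1 this
  rw [eq_top_iff, ← span_of_sum_coord (sum_posCoord hε), Submodule.span_le]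
  rintro _ ⟨i, rfl⟩
  exact h i

theorem isContragredient :
    IsContragredient (cartan ε) (fun _ => 1) (Xp ε) (Xm ε) where
  det_ne_zero := by
    have h := sq_add_add_one hε
    have e : (cartan ε).det = -2 := by
      rw [cartan, Matrix.det_fin_three]
      simp
      grind
    rw [e]; norm_num
  e_mem i := mem_part_one.2 rfl
  f_mem i := mem_part_one.2 rfl
  e_f i j hij := by
    rw [← mk_zero]
    fin_cases i <;> fin_cases j <;> first | exact absurd rfl hij | skip
    all_goals
      simp only [Fin.reduceFinMk, Fin.zero_eta, Fin.mk_one, Xp_zero, Xp_one, Xp_two, Xm_zero,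
          Xm_one, Xm_two,
        br_mk]
      refine mk_congr ?_ ?_ ?_ ?_ ?_ ?_ ?_ ?_ ?_ ?_ ?_ ?_ ?_ ?_ ?_ ?_ ?_ <;> ring
  h_h i j := by
    rw [← mk_zero]
    fin_cases i <;> fin_cases j <;>
      simp only [Fin.reduceFinMk, Fin.zero_eta, Fin.mk_one, H_zero, H_one, H_two, br_mk] <;>
      refine mk_congr ?_ ?_ ?_ ?_ ?_ ?_ ?_ ?_ ?_ ?_ ?_ ?_ ?_ ?_ ?_ ?_ ?_ <;> ring
  h_e i j := by
    have h := sq_add_add_one hε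
    fin_cases i <;> fin_cases j <;>
      simp [Xp_zero, Xp_one, Xp_two, Xm_zero, Xm_one, Xm_two, br_mk, cartan, smul_mk, -neg_smul,
        -zero_smul, -one_smul] <;>
      refine mk_congr ?_ ?_ ?_ ?_ ?_ ?_ ?_ ?_ ?_ ?_ ?_ ?_ ?_ ?_ ?_ ?_ ?_ <;> grind
  h_f i j := by
    have h := sq_add_add_one hε
    rw [← neg_smul]
    fin_cases i <;> fin_cases j <;>
      simp [Xp_zero, Xp_one, Xp_two, Xm_zero, Xm_one, Xm_two, br_mk, cartan, smul_mk, -neg_smul,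
        -zero_smul, -one_smul] <;>
      refine mk_congr ?_ ?_ ?_ ?_ ?_ ?_ ?_ ?_ ?_ ?_ ?_ ?_ ?_ ?_ ?_ ?_ ?_ <;> grind
  linearIndependent := by
    have h := sq_add_add_one hε
    rw [Fintype.linearIndependent_iff]
    intro g hg
    rw [Fin.sum_univ_three, H_zero, H_one, H_two, smul_mk, smul_mk, smul_mk, mk_add, mk_add] at hg
    obtain ⟨h0, -, -, h1, -, -, h2, -⟩ := mk_eq_zero hg
    intro i
    fin_cases i
    · change g 0 = 0
      grind
    · change g 1 = 0
      grind
    · change g 2 = 0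
      grind
  generate := gen_eq_top hε
  ideal_eq_bot I hI H hbot := by
    have diag : ∀ a0 a1 a2, mk ε a0 0 0 a1 0 0 a2 0 0 0 0 0 0 0 0 0 0 ∈ I →
        a0 = 0 ∧ a1 = 0 ∧ a2 = 0 := by
      intro a0 a1 a2 h
      have h' : mk ε a0 0 0 a1 0 0 a2 0 0 0 0 0 0 0 0 0 0 ∈ I ⊓
          Submodule.span ℂ (Set.range fun i => br (Xp ε i) (Xm ε i)) := ⟨h, diag_mem_span hε _ _ _⟩
      rw [hbot, Submodule.mem_bot] at h'
      obtain ⟨h0, -, -, h1, -, -, h2, -⟩ := mk_eq_zero h'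
      exact ⟨h0, h1, h2⟩
    -- For an odd element of the ideal, its brackets with odd elements are even elements of the
    -- ideal, hence zero; so the odd element is zero as well.
    rw [Submodule.eq_bot_iff]
    intro v hv
    have hd : v ∈ part (L := D21 ε) 0 ⊔ part (L := D21 ε) 1 := by
      rw [(LieSuperalgebra.isCompl (L := D21 ε)).sup_eq_top]; trivial
    obtain ⟨a, ha, b, hb, rfl⟩ := Submodule.mem_sup.1 hd
    have haI : a ∈ I := hI a ha b hb hv
    have hbI : b ∈ I := by simpa using I.sub_mem hv haI
    rw [even_eq_zero H diag haI ha, zero_add]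
    exact odd_eq_zero hb fun w hw =>
      even_eq_zero H diag (H w b hbI) (br_mem_of_odd hw hb)

end

end D21

/-! ### The theorem. -/

open LieSuperalgebra D21 in
theorem mainTheorem7 (ε : ℂ) (hε : IsPrimitiveRoot ε 3) :
    -- `𝔡(ε)` is `𝔤(A)`, with Chevalley generators `X⁺ᵢ`, `X⁻ᵢ`
    IsContragredient (cartan ε) (fun _ => 1) (Xp ε) (Xm ε) ∧
    -- outer automorphisms of order three, conjugate by a change of sign of `X⁺₂`, `X⁻₂`
    ∃ σp σm τ : Hom (D21 ε) (D21 ε),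
      (∀ i, τ (Xp ε i) = (if i = 1 then (-1 : ℂ) else 1) • Xp ε i) ∧
      (∀ i, τ (Xm ε i) = (if i = 1 then (-1 : ℂ) else 1) • Xm ε i) ∧
      IsOuterOfOrderThree σp ∧ IsOuterOfOrderThree σm ∧
      (∀ x, σm (τ x) = τ (σp x)) ∧
      (∀ i, σp (Xp ε i) = ε • Xp ε (i + 1)) ∧
      (∀ i, σm (Xm ε i) = ε • Xm ε (i + 1)) ∧
      -- the positive part
      (∃ (h₁ : Finsupp.single 0 (Yp1 ε) ∈ (loopPos ε hε σp).toSubmodule)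
          (h₂ : Finsupp.single 1 (Yp2 ε) ∈ (loopPos ε hε σp).toSubmodule),
        IsPresentedBy (L := (loopPos ε hε σp).toSubmodule) 1 1 PosHom ⟨_, h₁⟩ ⟨_, h₂⟩) ∧
      posFour (L := Loop (D21 ε)) (Finsupp.single 0 (Yp1 ε)) (Finsupp.single 1 (Yp2 ε)) =
        (64 : ℂ) • Finsupp.single 3 (Yp1 ε) ∧
      posFive (L := Loop (D21 ε)) (Finsupp.single 0 (Yp1 ε)) (Finsupp.single 1 (Yp2 ε)) =
        (-96 : ℂ) • Finsupp.single 4 (Yp2 ε) ∧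
      IsPresentedBy 1 1 PosRel (Yp1 ε) (Yp2 ε) ∧
      -- the negative part
      (∃ (h₁ : Finsupp.single 0 (Ym1 ε) ∈ (loopNeg ε hε σm).toSubmodule)
          (h₂ : Finsupp.single (-1) (Ym2 ε) ∈ (loopNeg ε hε σm).toSubmodule),
        IsPresentedBy (L := (loopNeg ε hε σm).toSubmodule) 1 0 NegHom ⟨_, h₁⟩ ⟨_, h₂⟩) ∧
      negFour (L := Loop (D21 ε)) (Finsupp.single 0 (Ym1 ε)) (Finsupp.single (-1) (Ym2 ε)) =
        (-64 : ℂ) • Finsupp.single (-3) (Ym1 ε) ∧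
      negFive (L := Loop (D21 ε)) (Finsupp.single 0 (Ym1 ε)) (Finsupp.single (-1) (Ym2 ε)) =
        (-64 : ℂ) • Finsupp.single (-4) (Ym2 ε) ∧
      IsPresentedBy 1 0 NegRel (Ym1 ε) (Ym2 ε) := by
  have hp0 := posVec_zero hε
  have hp2 := posVec_two hε
  have hn0 := negVec_zero hε
  have hn2 := negVec_two hε
  obtain ⟨-, p4, p5⟩ := posRel hε
  obtain ⟨-, n4, n5⟩ := negRel hε
  have lp := isPresentedBy_loopPos hε
  have ln := isPresentedBy_loopNeg hε
  have bp := isPresentedBy_pos hε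
  have bn := isPresentedBy_neg hε
  rw [hp0, hp2] at p4 p5 bp
  rw [hn0, hn2] at n4 n5 bn
  simp only [hp0, hp2] at lp
  simp only [hn0, hn2] at ln
  refine ⟨isContragredient hε, rot ε hε, rotFlip ε hε, flip ε, flip_Xp, flip_Xm,
    isOuterOfOrderThree_rot hε, isOuterOfOrderThree_rotFlip hε, rotFlip_flip hε, rot_Xp hε,
    rotFlip_Xm hε, lp, ?_, ?_, bp, ln, ?_, ?_, bn⟩
  · rw [posFour_single, p4, Finsupp.smul_single, mul_one]
  · rw [posFive_single, p5, Finsupp.smul_single, mul_one]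
  · rw [negFour_single, n4, Finsupp.smul_single, mul_neg_one]
  · rw [negFive_single, n5, Finsupp.smul_single, mul_neg_one]
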